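/- Let $\phi,\psi\in L^2(\mathbb R)$ (complex-valued functions; $\langle f,h\rangle=\int_{\mathbb R} f\overline h\,dx$). The Friedrichs model consists of the operators in $L^2(\mathbb R)$ $$(Af)(x)=xf(x)+\langle f,\phi\rangle\psi(x),\qquad (\widetilde Af)(x)=xf(x)+\langle f,\psi\rangle\phi(x),$$ both with domain $\{f\in L^2(\mathbb R):\ xf\in L^2(\mathbb R),\ \lim_{R\to\infty}\int_{-R}^R f\,dx=0\}$. For $u\in D(\widetilde A^*)$ let $\Gamma_2u=c_u$ be the constant with $xu(x)-c_u\in L^2(\mathbb R)$ and $\Gamma_1u=\lim_{R\to\infty}\int_{-R}^Ru\,dx$. For $B\in\mathbb C$ let $A_B=\widetilde A^*|_{\ker(\Gamma_1-B\Gamma_2)}$, and let $\rho(A_B)$ be its resolvent set. The detectable subspace is $$\overline{\mathcal S}=\overline{\operatorname{Span}\{\ker(\widetilde A^*-\lambda):\ \lambda\in\textstyle\bigcup_{B\in\mathbb C}\rho(A_B)\}}.$$ For $f\in L^1(\mathbb R)$ or $f\in L^2(\mathbb R)$ put $$P_\pm f(k)=\pm\frac1{2\pi i}\lim_{\varepsilon\downarrow0}\int_{\mathbb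 R}\frac{f(x)}{x-(k\pm i\varepsilon)}\,dx\quad\text{for a.e. }k\in\mathbb R;$$ on $L^2(\mathbb R)$ these are the Riesz projections onto the Hardy spaces $H_2^\pm$ of boundary values on $\mathbb R$ of functions $F$ analytic in $\mathbb C_\pm$ with $\sup_{y>0}\int_{\mathbb R}|F(x\pm iy)|^2dx<\infty$. Let $$D(\lambda)=1+\int_{\mathbb R}\frac{\psi(x)\overline{\phi(x)}}{x-\lambda}\,dx\quad(\lambda\in\mathbb C\setminus\mathbb R),\qquad D_\pm(k)=\lim_{\varepsilon\downarrow0}D(k\pm i\varepsilon)\quad\text{for a.e. }k\in\mathbb R.$$ Then all these boundary values, for $D$ and for the functions to which $P_\pm$ is applied below, exist a.e., $D_\pm\neq0$ a.e., and for every $g\in L^2(\mathbb R)$ the following holds. 1. We have $g\in\overline{\mathcal S}^\perp$ if and only if, a.e. on $\mathbb R$, $$P_+\overline g-\frac{2\pi i}{D_+}(P_+\overline\phi)P_+(\psi\overline g)=0\quad\text{and}\quad P_-\overline g+\frac{2\pi i}{D_-}(P_-\overline\phi)P_-(\psi\overline g)=0.$$ Also, $g\in\overline{\mathcal S}^\perp$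 if and only if the following three conditions hold: (i) $\dfrac{(P_+\overline\phi)P_+(\psi\overline g)}{D_+}\in H_2^+$; (ii) $\dfrac{(P_-\overline\phi)P_-(\psi\overline g)}{D_-}\in H_2^-$; (iii) $\overline g-\dfrac{2\pi i}{D_+}(P_+\overline\phi)P_+(\psi\overline g)+\dfrac{2\pi i}{D_-}(P_-\overline\phi)P_-(\psi\overline g)=0$ a.e. 2. If $\psi\in L^\infty(\mathbb R)$, or if $\phi,\psi\in L^4(\mathbb R)$, then $g\in\overline{\mathcal S}^\perp$ is equivalent to each of the following three identities: $$[D_+-2\pi i(P_+\overline\phi)\psi]\,\overline g=2\pi i\,\overline\phi\,[\psi P_-\overline g-P_-(\psi\overline g)]\quad\text{a.e.},$$ $$[D_+-2\pi i(P_+\overline\phi)\psi]\,\overline g=2\pi i\,\overline\phi\,[-\psi P_+\overline g+P_+(\psi\overline g)]\quad\text{a.e.},$$ $$[D_+-2\pi i(P_+\overline\phi)\psi]\,\overline g=2\pi i\,\overline\phi\,[P_+(\psi P_-\overline g)-P_-(\psi P_+\overline g)]\quad\text{a.e.}$$ -/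

import Mathlib

open MeasureTheory Filter Topology

noncomputable section

namespace Friedrichs

/-- The Hilbert space `L²(ℝ)` of complex-valued functions. -/
abbrev L2 : Type := Lp ℂ 2 (volume : Measure ℝ)

theorem intervalIntegrable_L2 (f : L2) (a b : ℝ) : IntervalIntegrable (f : ℝ → ℂ) volume a b := by
  have h : LocallyIntegrable (f : ℝ → ℂ) volume :=
    (Lp.memLp f).locallyIntegrable (by norm_num)
  exact (h.integrableOn_isCompact isCompact_uIcc).intervalIntegrable

theorem integral_add_L2 (f g : L2) (R : ℝ) :
    ∫ x in (-R)..R, (f + g : L2) x = (∫ x in (-R)..R, f x) + ∫ x in (-R)..R, g x := by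
  rw [← intervalIntegral.integral_add (intervalIntegrable_L2 f _ _) (intervalIntegrable_L2 g _ _)]
  apply intervalIntegral.integral_congr_ae
  filter_upwards [Lp.coeFn_add f g] with x hx _
  simpa using hx

theorem integral_smul_L2 (a : ℂ) (f : L2) (R : ℝ) :
    ∫ x in (-R)..R, (a • f : L2) x = a * ∫ x in (-R)..R, f x := by
  rw [← intervalIntegral.integral_const_mul]
  apply intervalIntegral.integral_congr_ae
  filter_upwards [Lp.coeFn_smul a f] with x hx _
  simpa using hx

/-- The functions `u ∈ L²(ℝ)` for which there is a constant `c_u` with `x u(x) - c_u ∈ L²(ℝ)` and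
`lim_{R → ∞} ∫_{-R}^{R} u(x) dx = B c_u`. In terms of the trace operators
`Γ₁ u = lim_{R → ∞} ∫_{-R}^{R} u(x) dx` and `Γ₂ u = c_u` this is the condition
`(Γ₁ - B Γ₂) u = 0`. -/
def boundaryCondition (B : ℂ) : Submodule ℂ L2 where
  carrier := {u | ∃ c : ℂ, MemLp (fun x : ℝ => (x : ℂ) * u x - c) 2 volume ∧
    Tendsto (fun R : ℝ => ∫ x in (-R)..R, u x) atTop (𝓝 (B * c))}
  zero_mem' := by
    refine ⟨0, ?_, ?_⟩
    · refine (memLp_congr_ae ?_).2 (MemLp.zero (ε := ℂ) (p := 2) (μ := (volume : Measure ℝ)))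
      filter_upwards [Lp.coeFn_zero ℂ 2 (volume : Measure ℝ)] with x hx
      simp
    · simp
  add_mem' := by
    rintro u v ⟨c, hc, hu⟩ ⟨d, hd, hv⟩
    refine ⟨c + d, ?_, ?_⟩
    · refine (memLp_congr_ae ?_).2 (hc.add hd)
      filter_upwards [Lp.coeFn_add u v] with x hx
      simp only [hx, Pi.add_apply]
      ring
    · simp only [integral_add_L2, mul_add]
      exact hu.add hv
  smul_mem' := by
    rintro a u ⟨c, hc, hu⟩
    refine ⟨a * c, ?_, ?_⟩
    · refine (memLp_congr_ae ?_).2 (hc.const_mul a)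
      filter_upwards [Lp.coeFn_smul a u] with x hx
      simp only [hx, Pi.smul_apply, smul_eq_mul]
      ring
    · simp only [integral_smul_L2, mul_left_comm B a c]
      exact hu.const_mul a

/-- The domain of the minimal operator of the Friedrichs model: all `f ∈ L²(ℝ)` with
`x f(x) ∈ L²(ℝ)` such that `lim_{R → ∞} ∫_{-R}^{R} f(x) dx` exists and is zero. -/
def minimalDomain : Submodule ℂ L2 where
  carrier := {f | MemLp (fun x : ℝ => (x : ℂ) * f x) 2 volume ∧
    Tendsto (fun R : ℝ => ∫ x in (-R)..R, f x) atTop (𝓝 0)}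
  zero_mem' := by
    refine ⟨?_, ?_⟩
    · refine (memLp_congr_ae ?_).2 (MemLp.zero (ε := ℂ) (p := 2) (μ := (volume : Measure ℝ)))
      filter_upwards [Lp.coeFn_zero ℂ 2 (volume : Measure ℝ)] with x hx
      simp
    · simp
  add_mem' := by
    rintro u v ⟨hc, hu⟩ ⟨hd, hv⟩
    refine ⟨?_, ?_⟩
    · refine (memLp_congr_ae ?_).2 (hc.add hd)
      filter_upwards [Lp.coeFn_add u v] with x hx
      simp only [hx, Pi.add_apply]
      ring
    · simp only [integral_add_L2]
      simpa using hu.add hv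
  smul_mem' := by
    rintro a u ⟨hc, hu⟩
    refine ⟨?_, ?_⟩
    · refine (memLp_congr_ae ?_).2 (hc.const_mul a)
      filter_upwards [Lp.coeFn_smul a u] with x hx
      simp only [hx, Pi.smul_apply, smul_eq_mul]
      ring
    · simp only [integral_smul_L2]
      simpa using hu.const_mul a

/-- Multiplication by the independent variable, `f ↦ x f(x)`, on `minimalDomain`. -/
def mulX : minimalDomain →ₗ[ℂ] L2 where
  toFun f := f.2.1.toLp _
  map_add' u v := by
    rw [← MemLp.toLp_add]
    refine (MemLp.toLp_eq_toLp_iff _ _).2 ?_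
    filter_upwards [Lp.coeFn_add (u : L2) (v : L2)] with x hx
    simp only [Submodule.coe_add, hx, Pi.add_apply]
    ring
  map_smul' a u := by
    rw [RingHom.id_apply, ← MemLp.toLp_const_smul]
    refine (MemLp.toLp_eq_toLp_iff _ _).2 ?_
    filter_upwards [Lp.coeFn_smul a (u : L2)] with x hx
    simp only [Submodule.coe_smul, hx, Pi.smul_apply, smul_eq_mul]
    ring

/-- The minimal operator `A = A(φ, ψ)` of the Friedrichs model,
`(A f)(x) = x f(x) + ⟨f, φ⟩ ψ(x)` with `⟨f, φ⟩ = ∫ f φ̄`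
(Mathlib's inner product is conjugate-linear in its first argument). -/
def minimalOp (φ ψ : L2) : L2 →ₗ.[ℂ] L2 where
  domain := minimalDomain
  toFun := mulX + ((innerₛₗ ℂ φ).comp minimalDomain.subtype).smulRight ψ

/-- The maximal operator `Ã*`: the Hilbert space adjoint of the operator `Ã`, which is the minimal
operator with the roles of `φ` and `ψ` swapped, `Ã f = x f + ⟨f, ψ⟩ φ`. -/
def maximalOp (φ ψ : L2) : L2 →ₗ.[ℂ] L2 := (minimalOp ψ φ).adjoint

/-- The extension `A_B` of `A`: the restriction of `Ã*` to the kernel of `Γ₁ - B Γ₂`. -/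
def extensionOp (φ ψ : L2) (B : ℂ) : L2 →ₗ.[ℂ] L2 :=
  (maximalOp φ ψ).domRestrict (boundaryCondition B)

/-- The resolvent set of an unbounded operator `T`: those `μ` for which `T - μ` has a bounded
everywhere defined two-sided inverse `R`. -/
def resolventSet (T : L2 →ₗ.[ℂ] L2) : Set ℂ :=
  {μ | ∃ R : L2 →L[ℂ] L2,
    (∀ g : L2, ∃ h : R g ∈ T.domain, T ⟨R g, h⟩ - μ • R g = g) ∧
    (∀ f : T.domain, R (T f - μ • (f : L2)) = f)}

/-- The kernel of `T - μ`, as a set of vectors. -/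
def kerSub (T : L2 →ₗ.[ℂ] L2) (μ : ℂ) : Set L2 :=
  {f | ∃ h : f ∈ T.domain, T ⟨f, h⟩ = μ • f}

/-- The detectable subspace `S̄`: the closed linear span of the kernels `ker (Ã* - μ)`, where `μ`
runs through the union over all `B ∈ ℂ` of the resolvent sets of the operators `A_B`. -/
def detectableSubspace (φ ψ : L2) : Submodule ℂ L2 :=
  (Submodule.span ℂ
    (⋃ μ ∈ ⋃ B : ℂ, resolventSet (extensionOp φ ψ B), kerSub (maximalOp φ ψ) μ)).topologicalClosure

/-- The Cauchy (Borel) transform `f̂(z) = ∫ f(x) / (x - z) dx`. -/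
def cauchyTransform (f : ℝ → ℂ) (z : ℂ) : ℂ := ∫ x : ℝ, f x / ((x : ℂ) - z)

/-- The boundary value at `k ∈ ℝ` from the upper half-plane, `lim_{ε ↓ 0} F(k + iε)`. -/
def upperBoundary (F : ℂ → ℂ) (k : ℝ) : ℂ :=
  limUnder (𝓝[>] (0 : ℝ)) fun ε : ℝ => F ((k : ℂ) + (ε : ℂ) * Complex.I)

/-- The boundary value at `k ∈ ℝ` from the lower half-plane, `lim_{ε ↓ 0} F(k - iε)`. -/
def lowerBoundary (F : ℂ → ℂ) (k : ℝ) : ℂ :=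
  limUnder (𝓝[>] (0 : ℝ)) fun ε : ℝ => F ((k : ℂ) - (ε : ℂ) * Complex.I)

/-- At almost every point of the real line `F` has a boundary value from the upper half-plane and
one from the lower half-plane. -/
def HasBoundaryValues (F : ℂ → ℂ) : Prop :=
  ∀ᵐ k : ℝ,
    (∃ l : ℂ, Tendsto (fun ε : ℝ => F ((k : ℂ) + (ε : ℂ) * Complex.I)) (𝓝[>] 0) (𝓝 l)) ∧
    (∃ l : ℂ, Tendsto (fun ε : ℝ => F ((k : ℂ) - (ε : ℂ) * Complex.I)) (𝓝[>] 0) (𝓝 l))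

/-- The Riesz projection `P₊ f(k) = (1 / 2πi) lim_{ε ↓ 0} ∫ f(x) / (x - (k + iε)) dx`. -/
def rieszPlus (f : ℝ → ℂ) (k : ℝ) : ℂ :=
  1 / (2 * Real.pi * Complex.I) * upperBoundary (cauchyTransform f) k

/-- The Riesz projection `P₋ f(k) = -(1 / 2πi) lim_{ε ↓ 0} ∫ f(x) / (x - (k - iε)) dx`. -/
def rieszMinus (f : ℝ → ℂ) (k : ℝ) : ℂ :=
  -(1 / (2 * Real.pi * Complex.I)) * lowerBoundary (cauchyTransform f) k

/-- The Hardy space `H₂⁺(ℝ)`: the functions `u` on the line that are a.e. boundary values of an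
analytic function `F` in the upper half-plane with `sup_{y > 0} ∫ |F(x + iy)|² dx < ∞`. -/
def IsHardyPlus (u : ℝ → ℂ) : Prop :=
  ∃ F : ℂ → ℂ, DifferentiableOn ℂ F {z : ℂ | 0 < z.im} ∧
    (∃ C : NNReal, ∀ y : ℝ, 0 < y →
      eLpNorm (fun x : ℝ => F ((x : ℂ) + (y : ℂ) * Complex.I)) 2 volume ≤ C) ∧
    ∀ᵐ x : ℝ, Tendsto (fun y : ℝ => F ((x : ℂ) + (y : ℂ) * Complex.I)) (𝓝[>] 0) (𝓝 (u x))

/-- The Hardy space `H₂⁻(ℝ)`, the same for the lower half-plane. -/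
def IsHardyMinus (u : ℝ → ℂ) : Prop :=
  ∃ F : ℂ → ℂ, DifferentiableOn ℂ F {z : ℂ | z.im < 0} ∧
    (∃ C : NNReal, ∀ y : ℝ, 0 < y →
      eLpNorm (fun x : ℝ => F ((x : ℂ) - (y : ℂ) * Complex.I)) 2 volume ≤ C) ∧
    ∀ᵐ x : ℝ, Tendsto (fun y : ℝ => F ((x : ℂ) - (y : ℂ) * Complex.I)) (𝓝[>] 0) (𝓝 (u x))

/-- The complex conjugate of a function on the line. -/
def conjFun (f : ℝ → ℂ) (x : ℝ) : ℂ := (starRingEnd ℂ) (f x)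

/-- The perturbation determinant `D(z) = 1 + ∫ ψ(x) φ̄(x) / (x - z) dx`. -/
def perturbDet (φ ψ : L2) (z : ℂ) : ℂ :=
  1 + ∫ x : ℝ, 1 / ((x : ℂ) - z) * ψ x * conjFun φ x

/-- The boundary values `D₊` of `D` from the upper half-plane. -/
def detPlus (φ ψ : L2) : ℝ → ℂ := upperBoundary (perturbDet φ ψ)

/-- The boundary values `D₋` of `D` from the lower half-plane. -/
def detMinus (φ ψ : L2) : ℝ → ℂ := lowerBoundary (perturbDet φ ψ)

end Friedrichs

end

open Friedrichs

/-! Write f̂ for the Cauchy transform. For non-real z the kernel of Ã* - z consists of the functions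
u = (c - αψ)/(x - z) with α = ⟨u, φ⟩, and this self-consistency condition reads α D(z) = c (φ̄)^(z).
Pairing u with g gives c (ḡ)^(z) - α (ψḡ)^(z). Hence, where D(z) ≠ 0, orthogonality of g to the
kernel is the single equation E(z) = 0, where E = D (ḡ)^ - (φ̄)^ (ψḡ)^ is `defectFun`.

Every non-real z with D(z) ≠ 0 lies in the resolvent set of some A_B (`exists_mem_resolventSet`),
and no real point does. Zeros of D are isolated in each half-plane, so E vanishes there too by
continuity; conversely, at a zero of D inside a resolvent set (φ̄)^ cannot vanish, and this makes E
= 0 sufficient. Thus g is orthogonal to the detectable subspace exactly when E vanishes off the real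
line (`mem_orthogonal_iff_defectFun`).

To pass to the line, Cauchy transforms are written as quotients of bounded analytic functions
(`CauchyIntegrable.boundedType`). Such quotients have boundary values a.e., and these are non-zero
a.e. unless the function is identically zero. So E = 0 is equivalent to E₊ = E₋ = 0 a.e.; division
by 2πi D± gives the first criterion. The Hardy space criterion follows from uniqueness of the
decomposition of ḡ into its H₂⁺ and H₂⁻ parts.

For the second part, the Plemelj relations identify E₊ - E₋ with 2πi times the difference of the two
sides of the first identity, so the identity says E₊ = E₋. Under the integrability hypotheses E₊ has
vanishing Cauchy transform below the line and E₋ above it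
(`upperDefect_lowerDefect_isUpperBoundary`), so a common value has no Cauchy transform on either
side and is zero. The delicate term is the product of the boundary values of (φ̄)^ and (ψḡ)^. If ψ
is bounded, both factors come from L². If φ, ψ ∈ L⁴, then ψḡ is only in L^{4/3}, and the M. Riesz
bounds on L⁴ and, by duality, on L^{4/3} are needed (`isUpperBoundary_mul_of_L4`). -/

namespace Friedrichs

open Complex

/-! ### Cauchy transforms off the real line: integrability, algebra, analyticity -/

/-- The functions whose Cauchy transform converges absolutely off the real line. -/
def CauchyIntegrable (f : ℝ → ℂ) : Prop := Integrable (fun x : ℝ => f x / ((x : ℂ) - I))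

theorem abs_im_le_norm_sub (z : ℂ) (x : ℝ) : |z.im| ≤ ‖(x : ℂ) - z‖ := by
  have := abs_im_le_norm ((x : ℂ) - z)
  simpa using this

theorem ofReal_sub_ne_zero {z : ℂ} (hz : z.im ≠ 0) (x : ℝ) : (x : ℂ) - z ≠ 0 := by
  intro h
  have := abs_im_le_norm_sub z x
  rw [h, norm_zero] at this
  exact hz (abs_nonpos_iff.1 this)

/-- The triangle inequality and |x - z| ≥ |Im z|. All Cauchy kernels with non-real pole are
therefore comparable, which is why `CauchyIntegrable` may be tested at the single point `I`. -/
theorem norm_sub_le_mul (w : ℂ) {z : ℂ} (hz : z.im ≠ 0) (x : ℝ) :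
    ‖(x : ℂ) - w‖ ≤ (1 + ‖z - w‖ / |z.im|) * ‖(x : ℂ) - z‖ := by
  have h1 : 0 < |z.im| := abs_pos.2 hz
  have h2 : ‖(x : ℂ) - w‖ ≤ ‖(x : ℂ) - z‖ + ‖z - w‖ := by
    simpa using norm_add_le ((x : ℂ) - z) (z - w)
  have h3 : ‖z - w‖ ≤ ‖z - w‖ / |z.im| * ‖(x : ℂ) - z‖ := by
    rw [div_mul_eq_mul_div, le_div_iff₀ h1]
    exact mul_le_mul_of_nonneg_left (abs_im_le_norm_sub z x) (norm_nonneg _)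
  linarith

theorem measurable_ofReal_sub (z : ℂ) : Measurable (fun x : ℝ => (x : ℂ) - z) := by fun_prop

theorem aestronglyMeasurable_div_sub {f : ℝ → ℂ} (hf : AEStronglyMeasurable f volume) (z : ℂ) :
    AEStronglyMeasurable (fun x : ℝ => f x / ((x : ℂ) - z)) volume := by
  simp_rw [div_eq_mul_inv]
  exact hf.mul (measurable_ofReal_sub z).inv.aestronglyMeasurable

theorem CauchyIntegrable.aestronglyMeasurable {f : ℝ → ℂ} (hf : CauchyIntegrable f) :
    AEStronglyMeasurable f volume := by
  have h := hf.1.mul (measurable_ofReal_sub I).aestronglyMeasurable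
  refine h.congr (Eventually.of_forall fun x => ?_)
  simp only [Pi.mul_apply]
  exact div_mul_cancel₀ _ (ofReal_sub_ne_zero (by simp) x)

theorem integrable_div_sub_of {f : ℝ → ℂ} {w z : ℂ} (hw : w.im ≠ 0) (hz : z.im ≠ 0)
    (hf : Integrable (fun x : ℝ => f x / ((x : ℂ) - w))) :
    Integrable (fun x : ℝ => f x / ((x : ℂ) - z)) := by
  have h : ∀ x : ℝ, f x / ((x : ℂ) - z)
      = f x / ((x : ℂ) - w) * (((x : ℂ) - w) / ((x : ℂ) - z)) := fun x => by
    field_simp [ofReal_sub_ne_zero hw x, ofReal_sub_ne_zero hz x]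
  simp_rw [h]
  refine hf.mul_bdd (c := 1 + ‖z - w‖ / |z.im|)
    (aestronglyMeasurable_div_sub (measurable_ofReal_sub w).aestronglyMeasurable z)
    (Eventually.of_forall fun x => ?_)
  rw [norm_div, div_le_iff₀ (norm_pos_iff.2 (ofReal_sub_ne_zero hz x))]
  exact norm_sub_le_mul w hz x

theorem CauchyIntegrable.integrable {f : ℝ → ℂ} (hf : CauchyIntegrable f) {z : ℂ}
    (hz : z.im ≠ 0) : Integrable (fun x : ℝ => f x / ((x : ℂ) - z)) :=
  integrable_div_sub_of (by simp) hz hf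

theorem CauchyIntegrable.congr {f g : ℝ → ℂ} (hf : CauchyIntegrable f) (h : f =ᵐ[volume] g) :
    CauchyIntegrable g :=
  Integrable.congr hf (by filter_upwards [h] with x hx; rw [hx])

theorem CauchyIntegrable.add {f g : ℝ → ℂ} (hf : CauchyIntegrable f) (hg : CauchyIntegrable g) :
    CauchyIntegrable (f + g) := by
  refine (Integrable.add hf hg).congr (Eventually.of_forall fun x => ?_)
  simp [add_div]

theorem CauchyIntegrable.const_mul {f : ℝ → ℂ} (c : ℂ) (hf : CauchyIntegrable f) :
    CauchyIntegrable (fun x => c * f x) := by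
  refine (Integrable.const_mul hf c).congr (Eventually.of_forall fun x => ?_)
  simp [mul_div_assoc]

theorem CauchyIntegrable.neg {f : ℝ → ℂ} (hf : CauchyIntegrable f) : CauchyIntegrable (-f) :=
  (hf.const_mul (-1)).congr (Eventually.of_forall fun x => by simp)

theorem CauchyIntegrable.sub {f g : ℝ → ℂ} (hf : CauchyIntegrable f) (hg : CauchyIntegrable g) :
    CauchyIntegrable (f - g) := by
  rw [sub_eq_add_neg]; exact hf.add hg.neg

theorem CauchyIntegrable.mono {f g : ℝ → ℂ} (hf : CauchyIntegrable f)
    (hg : AEStronglyMeasurable g volume) (h : ∀ x, ‖g x‖ ≤ ‖f x‖) : CauchyIntegrable g := by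
  refine Integrable.mono hf ?_ (Eventually.of_forall fun x => ?_)
  · exact aestronglyMeasurable_div_sub hg I
  · rw [norm_div, norm_div]
    gcongr
    exact h x

theorem aestronglyMeasurable_conjFun {f : ℝ → ℂ} (hf : AEStronglyMeasurable f volume) :
    AEStronglyMeasurable (conjFun f) volume :=
  continuous_conj.comp_aestronglyMeasurable hf

theorem CauchyIntegrable.conj {f : ℝ → ℂ} (hf : CauchyIntegrable f) :
    CauchyIntegrable (conjFun f) :=
  hf.mono (aestronglyMeasurable_conjFun hf.aestronglyMeasurable) fun x => by simp [conjFun]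

theorem conjFun_conjFun (f : ℝ → ℂ) : conjFun (conjFun f) = f := by
  ext x; simp [conjFun]

theorem memLp_conjFun {f : ℝ → ℂ} {p : ENNReal} (hf : MemLp f p volume) :
    MemLp (conjFun f) p volume :=
  hf.of_le (aestronglyMeasurable_conjFun hf.1) (Eventually.of_forall fun x => by simp [conjFun])

/-- The Cauchy kernel is square integrable. -/
theorem memLp_inv_sub {z : ℂ} (hz : z.im ≠ 0) :
    MemLp (fun x : ℝ => 1 / ((x : ℂ) - z)) 2 volume := by
  have hm : AEStronglyMeasurable (fun x : ℝ => 1 / ((x : ℂ) - z)) volume :=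
    aestronglyMeasurable_div_sub aestronglyMeasurable_const z
  rw [memLp_two_iff_integrable_sq_norm hm]
  have h0 := integrable_inv_one_add_sq
  refine (h0.const_mul ((1 + ‖z - I‖ / |z.im|) ^ 2)).mono'
    (hm.norm.pow 2)
    (Eventually.of_forall fun x => ?_)
  have hI : ‖(x : ℂ) - I‖ ^ 2 = 1 + x ^ 2 := by
    rw [← normSq_eq_norm_sq, normSq_apply]; simp; ring
  have hp : 0 < ‖(x : ℂ) - z‖ := norm_pos_iff.2 (ofReal_sub_ne_zero hz x)
  have := pow_le_pow_left₀ (norm_nonneg _) (norm_sub_le_mul I hz x) 2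
  rw [hI, mul_pow] at this
  rw [norm_div, norm_one, Real.norm_of_nonneg (by positivity), div_pow, one_pow,
    ← div_eq_mul_inv, div_le_div_iff₀ (by positivity) (by positivity)]
  linarith

theorem integrable_mul_of_memLp_two {f g : ℝ → ℂ} (hf : MemLp f 2 volume)
    (hg : MemLp g 2 volume) : Integrable (fun x => f x * g x) :=
  hf.integrable_mul hg

theorem cauchyIntegrable_of_memLp {f : ℝ → ℂ} (hf : MemLp f 2 volume) : CauchyIntegrable f := by
  refine (integrable_mul_of_memLp_two hf (memLp_inv_sub (z := I) (by simp))).congr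
    (Eventually.of_forall fun x => ?_)
  simp [div_eq_mul_inv]

theorem cauchyIntegrable_of_integrable {f : ℝ → ℂ} (hf : Integrable f) : CauchyIntegrable f := by
  refine hf.norm.mono'
    (aestronglyMeasurable_div_sub hf.1 I)
    (Eventually.of_forall fun x => ?_)
  rw [norm_div]
  refine div_le_self (norm_nonneg _) ?_
  simpa using abs_im_le_norm_sub I x

theorem norm_inv_sub_le {z : ℂ} (hz : z.im ≠ 0) (x : ℝ) : ‖1 / ((x : ℂ) - z)‖ ≤ 1 / |z.im| := by
  rw [norm_div, norm_one]
  exact one_div_le_one_div_of_le (abs_pos.2 hz) (abs_im_le_norm_sub z x)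

theorem cauchyTransform_congr {f g : ℝ → ℂ} (h : f =ᵐ[volume] g) (z : ℂ) :
    cauchyTransform f z = cauchyTransform g z :=
  integral_congr_ae (by filter_upwards [h] with x hx; rw [hx])

theorem cauchyTransform_add {f g : ℝ → ℂ} (hf : CauchyIntegrable f) (hg : CauchyIntegrable g)
    {z : ℂ} (hz : z.im ≠ 0) :
    cauchyTransform (f + g) z = cauchyTransform f z + cauchyTransform g z := by
  unfold cauchyTransform
  rw [← integral_add (hf.integrable hz) (hg.integrable hz)]
  simp [add_div]

theorem cauchyTransform_const_mul (c : ℂ) (f : ℝ → ℂ) (z : ℂ) :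
    cauchyTransform (fun x => c * f x) z = c * cauchyTransform f z := by
  unfold cauchyTransform
  rw [← integral_const_mul]
  simp [mul_div_assoc]

theorem cauchyTransform_neg (f : ℝ → ℂ) (z : ℂ) :
    cauchyTransform (-f) z = -cauchyTransform f z := by
  have := cauchyTransform_const_mul (-1) f z
  simpa [Pi.neg_def] using this

theorem cauchyTransform_sub {f g : ℝ → ℂ} (hf : CauchyIntegrable f) (hg : CauchyIntegrable g)
    {z : ℂ} (hz : z.im ≠ 0) :
    cauchyTransform (f - g) z = cauchyTransform f z - cauchyTransform g z := by
  rw [sub_eq_add_neg, cauchyTransform_add hf hg.neg hz, cauchyTransform_neg, sub_eq_add_neg]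

theorem cauchyTransform_conj (f : ℝ → ℂ) (z : ℂ) :
    cauchyTransform (conjFun f) ((starRingEnd ℂ) z) = (starRingEnd ℂ) (cauchyTransform f z) := by
  unfold cauchyTransform
  rw [← integral_conj]
  simp [conjFun]

theorem CauchyIntegrable.differentiableAt {f : ℝ → ℂ} (hf : CauchyIntegrable f) {z : ℂ}
    (hz : z.im ≠ 0) : DifferentiableAt ℂ (cauchyTransform f) z := by
  have hd : 0 < |z.im| := abs_pos.2 hz
  have key : ∀ w ∈ Metric.ball z (|z.im| / 2), |z.im| / 2 ≤ |w.im| := by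
    intro w hw
    rw [Metric.mem_ball, dist_eq_norm] at hw
    have h1 := abs_im_le_norm (w - z)
    have h2 : |z.im| - |w.im| ≤ |w.im - z.im| := by
      rw [abs_sub_comm]; exact abs_sub_abs_le_abs_sub _ _
    rw [sub_im] at h1
    linarith
  have key0 : ∀ w ∈ Metric.ball z (|z.im| / 2), w.im ≠ 0 := fun w hw h => by
    have := key w hw
    rw [h, abs_zero] at this
    linarith
  -- On the ball of radius |Im z|/2 about z one has |x - w| ≥ |Im z|/2 and |x - z| ≤ 2|x - w|; the
  -- product of the two bounds gives 1/|x - w|² ≤ K/|x - z|.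
  set K : ℝ := 2 / |z.im| * 2 with hK
  refine (hasDerivAt_integral_of_dominated_loc_of_deriv_le (μ := volume)
    (F := fun (w : ℂ) (x : ℝ) => f x / ((x : ℂ) - w))
    (F' := fun (w : ℂ) (x : ℝ) => f x / ((x : ℂ) - w) ^ 2)
    (bound := fun x => K * ‖f x / ((x : ℂ) - z)‖)
    (Metric.ball_mem_nhds z (half_pos hd)) ?_ (hf.integrable hz) ?_ ?_ ?_ ?_).2.differentiableAt
  · exact Eventually.of_forall fun w => aestronglyMeasurable_div_sub hf.aestronglyMeasurable w
  · simp_rw [div_eq_mul_inv]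
    exact hf.aestronglyMeasurable.mul
      ((measurable_ofReal_sub z).pow_const 2).inv.aestronglyMeasurable
  · refine Eventually.of_forall fun x w hw => ?_
    have h1 : ‖(x : ℂ) - z‖ ≤ 2 * ‖(x : ℂ) - w‖ := by
      refine (norm_sub_le_mul z (key0 w hw) x).trans ?_
      gcongr
      have : ‖w - z‖ / |w.im| ≤ 1 := by
        rw [div_le_one (abs_pos.2 (key0 w hw)), ← dist_eq_norm]
        exact (Metric.mem_ball.1 hw).le.trans (key w hw)
      linarith
    have h2 : |z.im| / 2 ≤ ‖(x : ℂ) - w‖ := (key w hw).trans (abs_im_le_norm_sub w x)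
    have h3 : 0 < ‖(x : ℂ) - z‖ := norm_pos_iff.2 (ofReal_sub_ne_zero hz x)
    have h4 : 0 < ‖(x : ℂ) - w‖ := norm_pos_iff.2 (ofReal_sub_ne_zero (key0 w hw) x)
    rw [norm_div, norm_div, norm_pow, mul_div_assoc', mul_comm K, mul_div_assoc, hK]
    rw [div_eq_mul_inv]
    gcongr
    rw [div_mul_eq_mul_div, div_div, inv_eq_one_div, div_le_div_iff₀ (by positivity) (by positivity)]
    nlinarith [mul_le_mul h2 h1 h3.le h4.le]
  · exact hf.integrable hz |>.norm.const_mul K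
  · refine Eventually.of_forall fun x w hw => ?_
    have h4 := ofReal_sub_ne_zero (key0 w hw) x
    have h := ((hasDerivAt_id w).const_sub (x : ℂ)).inv h4 |>.const_mul (f x)
    simpa [div_eq_mul_inv] using h

theorem CauchyIntegrable.continuousAt {f : ℝ → ℂ} (hf : CauchyIntegrable f) {z : ℂ}
    (hz : z.im ≠ 0) : ContinuousAt (cauchyTransform f) z :=
  (hf.differentiableAt hz).continuousAt

/-! ### Poisson integrals: jump formula, a.e. convergence, contraction on `Lᵖ` -/

theorem CauchyIntegrable.locallyIntegrable {f : ℝ → ℂ} (hf : CauchyIntegrable f) :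
    LocallyIntegrable f volume := by
  rw [locallyIntegrable_iff]
  intro K hK
  have h : IntegrableOn (fun x : ℝ => f x / ((x : ℂ) - I)) K := Integrable.integrableOn hf
  refine (h.mul_continuousOn (g' := fun x : ℝ => (x : ℂ) - I) (by fun_prop) hK).congr
    (Eventually.of_forall fun x => ?_)
  exact div_mul_cancel₀ _ (ofReal_sub_ne_zero (by simp) x)

/-- The Poisson kernel of the upper half-plane. -/
noncomputable def halfPlaneKernel (x y t : ℝ) : ℝ := y / (Real.pi * ((t - x) ^ 2 + y ^ 2))

/-- The Poisson integral of `f` at the point `x + iy`. -/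
noncomputable def poissonIntegral (f : ℝ → ℂ) (x y : ℝ) : ℂ :=
  ∫ t : ℝ, (halfPlaneKernel x y t : ℂ) * f t

theorem halfPlaneKernel_pos {y : ℝ} (hy : 0 < y) (x t : ℝ) : 0 < halfPlaneKernel x y t := by
  unfold halfPlaneKernel
  have := Real.pi_pos
  positivity

theorem integrable_coe {α : Type*} [MeasurableSpace α] {μ : Measure α} {f : α → ℝ}
    (hf : Integrable f μ) : Integrable (fun x => (f x : ℂ)) μ := hf.ofReal

theorem halfPlaneKernel_comm (x y t : ℝ) : halfPlaneKernel x y t = halfPlaneKernel t y x := by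
  unfold halfPlaneKernel
  rw [← neg_sub x t, neg_sq]

theorem measurable_halfPlaneKernel (y : ℝ) :
    Measurable (fun p : ℝ × ℝ => halfPlaneKernel p.1 y p.2) := by
  unfold halfPlaneKernel
  fun_prop

theorem halfPlaneKernel_eq {y : ℝ} (hy : 0 < y) (x t : ℝ) :
    halfPlaneKernel x y t = (Real.pi * y)⁻¹ * (1 + ((t - x) / y) ^ 2)⁻¹ := by
  unfold halfPlaneKernel
  have := Real.pi_pos
  field_simp
  ring

theorem integrable_halfPlaneKernel {y : ℝ} (hy : 0 < y) (x : ℝ) :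
    Integrable (halfPlaneKernel x y) := by
  have h := ((integrable_inv_one_add_sq.comp_div hy.ne').comp_sub_right x).const_mul
    (Real.pi * y)⁻¹
  exact h.congr (Eventually.of_forall fun t => (halfPlaneKernel_eq hy x t).symm)

theorem integral_halfPlaneKernel {y : ℝ} (hy : 0 < y) (x : ℝ) :
    ∫ t, halfPlaneKernel x y t = 1 := by
  simp_rw [halfPlaneKernel_eq hy x]
  rw [integral_const_mul, integral_sub_right_eq_self (fun t : ℝ => (1 + (t / y) ^ 2)⁻¹) x,
    Measure.integral_comp_div (fun t : ℝ => (1 + t ^ 2)⁻¹) y, integral_univ_inv_one_add_sq,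
    abs_of_pos hy]
  have := Real.pi_pos
  simp only [smul_eq_mul]
  field_simp

theorem two_pi_I_mul_halfPlaneKernel {y : ℝ} (hy : 0 < y) (x t : ℝ) :
    2 * Real.pi * I * (halfPlaneKernel x y t : ℂ)
      = 1 / ((t : ℂ) - ((x : ℂ) + y * I)) - 1 / ((t : ℂ) - ((x : ℂ) - y * I)) := by
  have h1 : (t : ℂ) - ((x : ℂ) + y * I) ≠ 0 := ofReal_sub_ne_zero (by simp [hy.ne']) t
  have h2 : (t : ℂ) - ((x : ℂ) - y * I) ≠ 0 := ofReal_sub_ne_zero (by simp [hy.ne']) t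
  have h3 : (((t - x) ^ 2 + y ^ 2 : ℝ) : ℂ)
      = ((t : ℂ) - ((x : ℂ) + y * I)) * ((t : ℂ) - ((x : ℂ) - y * I)) := by
    push_cast
    ring_nf
    rw [I_sq]; ring
  have hpi : (Real.pi : ℂ) ≠ 0 := by exact_mod_cast Real.pi_ne_zero
  unfold halfPlaneKernel
  have h4 : ((t : ℂ) - ((x : ℂ) - y * I)) - ((t : ℂ) - ((x : ℂ) + y * I)) = 2 * y * I := by ring
  rw [ofReal_div, ofReal_mul, h3, div_sub_div _ _ h1 h2, one_mul, mul_one, h4]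
  field_simp

theorem CauchyIntegrable.integrable_kernel_mul {f : ℝ → ℂ} (hf : CauchyIntegrable f) {y : ℝ}
    (hy : 0 < y) (x : ℝ) : Integrable (fun t => (halfPlaneKernel x y t : ℂ) * f t) := by
  have h := ((hf.integrable (z := (x : ℂ) + y * I) (by simp [hy.ne'])).sub
    (hf.integrable (z := (x : ℂ) - y * I) (by simp [hy.ne']))).const_mul (1 / (2 * Real.pi * I))
  refine h.congr (Eventually.of_forall fun t => ?_)
  have h2 := two_pi_I_mul_halfPlaneKernel hy x t
  have hpi : (Real.pi : ℂ) ≠ 0 := by exact_mod_cast Real.pi_ne_zero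
  have h3 : (halfPlaneKernel x y t : ℂ) = 1 / (2 * Real.pi * I) *
      (1 / ((t : ℂ) - ((x : ℂ) + y * I)) - 1 / ((t : ℂ) - ((x : ℂ) - y * I))) := by
    rw [← h2]; field_simp
  simp only [Pi.sub_apply]
  rw [h3]; ring

/-- The jump of the Cauchy transform across the real line is a Poisson integral. -/
theorem CauchyIntegrable.jump_eq {f : ℝ → ℂ} (hf : CauchyIntegrable f) {y : ℝ}
    (hy : 0 < y) (x : ℝ) :
    cauchyTransform f ((x : ℂ) + y * I) - cauchyTransform f ((x : ℂ) - y * I)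
      = 2 * Real.pi * I * poissonIntegral f x y := by
  unfold cauchyTransform poissonIntegral
  rw [← integral_sub (hf.integrable (by simp [hy.ne'])) (hf.integrable (by simp [hy.ne'])),
    ← integral_const_mul]
  congr 1 with t
  rw [← mul_assoc, two_pi_I_mul_halfPlaneKernel hy x t]
  ring

/-- The radial weight that represents the Poisson kernel as a mixture of indicators. -/
noncomputable def layerWeight (r : ℝ) : ℝ := 2 * r / (Real.pi * (1 + r ^ 2) ^ 2)

theorem continuous_layerWeight : Continuous layerWeight := by
  unfold layerWeight
  have := Real.pi_pos
  refine Continuous.div (by fun_prop) (by fun_prop) fun r => by positivity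

theorem layerWeight_nonneg {r : ℝ} (hr : 0 ≤ r) : 0 ≤ layerWeight r := by
  unfold layerWeight
  have := Real.pi_pos
  positivity

/-- The weight is minus the derivative of the Poisson profile 1/(π(1 + r²)), so its tail integrals
recover the profile; this is what makes the layer-cake formula work. -/
theorem hasDerivAt_layer (r : ℝ) :
    HasDerivAt (fun r : ℝ => -(1 / Real.pi * (1 + r ^ 2)⁻¹)) (layerWeight r) r := by
  have h : HasDerivAt (fun r : ℝ => 1 + r ^ 2) (2 * r) r := by
    simpa using (hasDerivAt_pow 2 r).const_add 1
  have h2 := ((h.inv (by positivity)).const_mul (1 / Real.pi)).neg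
  have := Real.pi_pos
  have h3 : layerWeight r = -(1 / Real.pi * (-(2 * r) / (1 + r ^ 2) ^ 2)) := by
    unfold layerWeight
    field_simp
  rw [h3]
  exact h2

theorem tendsto_layer :
    Tendsto (fun r : ℝ => -(1 / Real.pi * (1 + r ^ 2)⁻¹)) atTop (𝓝 0) := by
  have h : Tendsto (fun r : ℝ => (1 + r ^ 2)⁻¹) atTop (𝓝 0) :=
    tendsto_inv_atTop_zero.comp (tendsto_atTop_add_const_left _ _ (tendsto_pow_atTop two_ne_zero))
  simpa using (h.const_mul (1 / Real.pi)).neg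

theorem integrableOn_layerWeight {a : ℝ} (ha : 0 ≤ a) : IntegrableOn layerWeight (Set.Ioi a) :=
  integrableOn_Ioi_deriv_of_nonneg' (fun r _ => hasDerivAt_layer r)
    (fun _ hr => layerWeight_nonneg (ha.trans (le_of_lt hr))) tendsto_layer

theorem integral_layerWeight {a : ℝ} (ha : 0 ≤ a) :
    ∫ r in Set.Ioi a, layerWeight r = 1 / Real.pi * (1 + a ^ 2)⁻¹ := by
  rw [integral_Ioi_of_hasDerivAt_of_nonneg' (fun r _ => hasDerivAt_layer r)
    (fun _ hr => layerWeight_nonneg (ha.trans (le_of_lt hr))) tendsto_layer]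
  ring

theorem setIntegral_layerWeight_indicator {ε : ℝ} (hε : 0 < ε) (k t : ℝ) :
    ∫ r in Set.Ioi (0 : ℝ), Set.indicator {r | |t - k| < ε * r} layerWeight r
      = ε * halfPlaneKernel k ε t := by
  have hset : {r : ℝ | |t - k| < ε * r} = Set.Ioi (|t - k| / ε) := by
    ext r
    simp [div_lt_iff₀ hε, mul_comm]
  have h0 : 0 ≤ |t - k| / ε := by positivity
  rw [hset, setIntegral_indicator measurableSet_Ioi, Set.Ioi_inter_Ioi, sup_eq_right.2 h0,
    integral_layerWeight h0, halfPlaneKernel_eq hε, div_pow, div_pow, sq_abs]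
  have := Real.pi_pos
  field_simp

/-- The Poisson kernel decreases in |t - k| and so is a superposition of indicators of symmetric
intervals about k; Fubini moves the superposition outside. Only the interval integrals of f remain,
and these are controlled by Lebesgue differentiation. -/
theorem poissonIntegral_eq_layer {f : ℝ → ℂ} (hf : LocallyIntegrable f volume) {ε : ℝ}
    (hε : 0 < ε) (k : ℝ) (hK : Integrable (fun t => (halfPlaneKernel k ε t : ℂ) * f t)) :
    ε * poissonIntegral f k ε
      = ∫ r in Set.Ioi (0 : ℝ), (layerWeight r : ℂ) * ∫ t in (k - ε * r)..(k + ε * r), f t := by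
  set G : ℝ → ℝ → ℂ := fun t r => ((Set.indicator {r | |t - k| < ε * r} layerWeight r : ℝ) : ℂ) * f t
    with hG
  have hmeas : AEStronglyMeasurable (Function.uncurry G)
      ((volume : Measure ℝ).prod (volume.restrict (Set.Ioi (0 : ℝ)))) := by
    have h1 : Measurable (fun p : ℝ × ℝ =>
        (Set.indicator {p : ℝ × ℝ | |p.1 - k| < ε * p.2} (fun p => layerWeight p.2) p)) :=
      (continuous_layerWeight.measurable.comp measurable_snd).indicator
        (measurableSet_lt (by fun_prop) (by fun_prop))
    have h2 : AEStronglyMeasurable (fun p : ℝ × ℝ => f p.1)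
      ((volume : Measure ℝ).prod (volume.restrict (Set.Ioi (0 : ℝ)))) :=
      hf.aestronglyMeasurable.comp_fst
    exact (measurable_ofReal.comp h1).aestronglyMeasurable.mul h2
  have hind : ∀ t : ℝ, Integrable (fun r => Set.indicator {r | |t - k| < ε * r} layerWeight r)
      (volume.restrict (Set.Ioi (0 : ℝ))) := fun t =>
    (integrableOn_layerWeight le_rfl).indicator
      (measurableSet_lt measurable_const (by fun_prop))
  have hint : Integrable (Function.uncurry G)
      ((volume : Measure ℝ).prod (volume.restrict (Set.Ioi (0 : ℝ)))) := by
    rw [integrable_prod_iff hmeas]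
    refine ⟨Eventually.of_forall fun t => (integrable_coe (hind t)).mul_const (f t), ?_⟩
    refine (hK.norm.const_mul ε).congr (Eventually.of_forall fun t => ?_)
    have hn : ∀ r ∈ Set.Ioi (0 : ℝ), ‖Function.uncurry G (t, r)‖
        = Set.indicator {r | |t - k| < ε * r} layerWeight r * ‖f t‖ := by
      intro r hr
      simp only [Function.uncurry, hG, norm_mul, norm_real]
      rw [Real.norm_of_nonneg]
      exact Set.indicator_apply_nonneg fun _ => layerWeight_nonneg (le_of_lt hr)
    simp only
    rw [setIntegral_congr_fun measurableSet_Ioi hn, integral_mul_const,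
      setIntegral_layerWeight_indicator hε]
    simp [abs_of_pos (halfPlaneKernel_pos hε k t), mul_assoc]
  have hswap := integral_integral_swap hint
  have hleft : ∀ t, ∫ r in Set.Ioi (0 : ℝ), G t r = ε * ((halfPlaneKernel k ε t : ℂ) * f t) := by
    intro t
    simp only [hG]
    rw [integral_mul_const, integral_complex_ofReal, setIntegral_layerWeight_indicator hε]
    push_cast; ring
  simp_rw [hleft] at hswap
  rw [integral_const_mul] at hswap
  rw [poissonIntegral, hswap]
  refine setIntegral_congr_fun measurableSet_Ioi fun r hr => ?_
  have hr0 : 0 < ε * r := mul_pos hε hr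
  rw [intervalIntegral.integral_of_le (by linarith), integral_Ioc_eq_integral_Ioo,
    ← integral_const_mul, ← integral_indicator measurableSet_Ioo]
  congr 1 with t
  simp only [hG, Set.indicator_apply, Set.mem_ofPred_eq, Set.mem_Ioo, abs_lt]
  by_cases h : -(ε * r) < t - k ∧ t - k < ε * r
  · rw [if_pos h, if_pos ⟨by linarith [h.1], by linarith [h.2]⟩]
  · rw [if_neg h, if_neg fun h' => h ⟨by linarith [h'.1], by linarith [h'.2]⟩]
    simp

/-- The layer formula for the constant function 1, whose Poisson integral is 1. -/
theorem integral_layerWeight_mul :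
    ∫ r in Set.Ioi (0 : ℝ), (layerWeight r : ℂ) * (2 * r) = 1 := by
  have hK : Integrable (fun t => (halfPlaneKernel 0 1 t : ℂ) * (1 : ℂ)) := by
    simpa using integrable_coe (integrable_halfPlaneKernel one_pos 0)
  have h := poissonIntegral_eq_layer (f := fun _ => (1 : ℂ)) (locallyIntegrable_const 1)
    one_pos 0 hK
  have h2 : poissonIntegral (fun _ => (1 : ℂ)) 0 1 = 1 := by
    unfold poissonIntegral
    simp_rw [mul_one]
    rw [integral_complex_ofReal, integral_halfPlaneKernel one_pos, ofReal_one]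
  rw [h2] at h
  simp only [ofReal_one, one_mul, zero_sub, zero_add, intervalIntegral.integral_const,
    sub_neg_eq_add, ← two_mul, real_smul, ofReal_mul, ofReal_ofNat, mul_one] at h
  exact h.symm

theorem integrableOn_layerWeight_mul :
    IntegrableOn (fun r : ℝ => layerWeight r * r) (Set.Ioi 0) := by
  refine (integrable_inv_one_add_sq.integrableOn.const_mul (2 / Real.pi)).mono'
    (continuous_layerWeight.mul continuous_id).aestronglyMeasurable
    ((ae_restrict_iff' measurableSet_Ioi).2 (Eventually.of_forall fun r hr => ?_))
  have hr' : (0 : ℝ) < r := hr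
  rw [Real.norm_of_nonneg (mul_nonneg (layerWeight_nonneg hr'.le) hr'.le)]
  unfold layerWeight
  have := Real.pi_pos
  rw [← div_eq_mul_inv, div_mul_eq_mul_div, div_div, div_le_div_iff₀ (by positivity) (by positivity)]
  have : 0 ≤ Real.pi * (1 + r ^ 2) := by positivity
  nlinarith [mul_nonneg this (sq_nonneg r)]

/-- On an interval of radius r about k the factor |t - I| is at most |k| + r + 1. The resulting
linear growth in r supplies the dominating function far from k, where differentiability at k says
nothing. -/
theorem CauchyIntegrable.exists_bound_integral {f : ℝ → ℂ} (hf : CauchyIntegrable f) (k : ℝ) :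
    ∃ M : ℝ, 0 ≤ M ∧ ∀ r : ℝ, 0 < r → ‖∫ t in (k - r)..(k + r), f t‖ ≤ (|k| + r + 1) * M := by
  refine ⟨∫ t : ℝ, ‖f t / ((t : ℂ) - I)‖, integral_nonneg fun _ => norm_nonneg _, fun r hr => ?_⟩
  rw [intervalIntegral.integral_of_le (by linarith)]
  have hfl := hf.locallyIntegrable
  have hfi : Integrable (fun t : ℝ => f t / ((t : ℂ) - I)) := hf
  have hion : IntegrableOn f (Set.Ioc (k - r) (k + r)) :=
    (hfl.integrableOn_isCompact isCompact_Icc).mono_set Set.Ioc_subset_Icc_self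
  refine (norm_integral_le_integral_norm _).trans ?_
  have h1 : ∫ t in Set.Ioc (k - r) (k + r), ‖f t‖
      ≤ ∫ t in Set.Ioc (k - r) (k + r), (|k| + r + 1) * ‖f t / ((t : ℂ) - I)‖ := by
    refine setIntegral_mono_on hion.norm (hfi.norm.integrableOn.const_mul _)
      measurableSet_Ioc fun t ht => ?_
    have h0 : 0 < ‖(t : ℂ) - I‖ := norm_pos_iff.2 (ofReal_sub_ne_zero (by simp) t)
    have h2 : ‖(t : ℂ) - I‖ ≤ |k| + r + 1 := by
      refine (norm_sub_le _ _).trans ?_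
      rw [norm_real, norm_I, Real.norm_eq_abs]
      have : |t| ≤ |k| + r := by
        rw [abs_le]
        constructor
        · linarith [ht.1, neg_abs_le k]
        · linarith [ht.2, le_abs_self k]
      linarith
    rw [norm_div, mul_div_assoc', le_div_iff₀ h0, mul_comm]
    exact mul_le_mul_of_nonneg_right h2 (norm_nonneg _)
  refine h1.trans ?_
  rw [integral_const_mul]
  exact mul_le_mul_of_nonneg_left
    (setIntegral_le_integral hfi.norm (Eventually.of_forall fun _ => norm_nonneg _))
    (by positivity)

/-- The Poisson integral converges to the function almost everywhere. -/
theorem CauchyIntegrable.ae_tendsto_poissonIntegral {f : ℝ → ℂ} (hf : CauchyIntegrable f) :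
    ∀ᵐ k : ℝ, Tendsto (fun ε : ℝ => poissonIntegral f k ε) (𝓝[>] 0) (𝓝 (f k)) := by
  filter_upwards [LocallyIntegrable.ae_hasDerivAt_integral hf.locallyIntegrable] with k hk
  have hii : ∀ a b, IntervalIntegrable f volume a b := fun a b =>
    (hf.locallyIntegrable.integrableOn_isCompact isCompact_uIcc).intervalIntegrable
  set h : ℝ → ℂ := fun r => ∫ t in (k - r)..(k + r), f t with hh
  have hsplit : ∀ r, h r = (∫ t in k..(k + r), f t) - ∫ t in k..(k - r), f t := fun r => by
    rw [hh]
    simp only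
    rw [intervalIntegral.integral_interval_sub_left (hii _ _) (hii _ _)]
  have hcont : Continuous h := by
    have hp := intervalIntegral.continuous_primitive hii k
    have : h = fun r => (∫ t in k..(k + r), f t) - ∫ t in k..(k - r), f t := funext hsplit
    rw [this]
    exact (hp.comp (by fun_prop)).sub (hp.comp (by fun_prop))
  -- Lebesgue differentiation: both endpoints move, and each contributes f(k).
  have hder : HasDerivAt h (2 * f k) 0 := by
    have h1 : HasDerivAt (fun r : ℝ => ∫ t in k..(k + r), f t) (f k) 0 := by
      have := (hk k)
      have h' := HasDerivAt.scomp (h := fun r : ℝ => k + r) (0 : ℝ)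
        (by simpa using this) ((hasDerivAt_id (0 : ℝ)).const_add k)
      simpa [Function.comp_def] using h'
    have h2 : HasDerivAt (fun r : ℝ => ∫ t in k..(k - r), f t) (-f k) 0 := by
      have := (hk k)
      have h' := HasDerivAt.scomp (h := fun r : ℝ => k - r) (0 : ℝ)
        (by simpa using this) ((hasDerivAt_id (0 : ℝ)).const_sub k)
      simpa [Function.comp_def] using h'
    have h3 := h1.sub h2
    have : h = fun r => (∫ t in k..(k + r), f t) - ∫ t in k..(k - r), f t := funext hsplit
    rw [this]
    rwa [sub_neg_eq_add, ← two_mul] at h3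
  have h0 : h 0 = 0 := by simp [hh]
  have hslope : Tendsto (fun r : ℝ => (r⁻¹ : ℝ) • h r) (𝓝[>] 0) (𝓝 (2 * f k)) := by
    have := hder.tendsto_slope_zero_right
    simpa [h0] using this
  obtain ⟨M, hM0, hM⟩ := hf.exists_bound_integral k
  -- A bound for h that is linear on the whole half-line: for small r from the limit of the slopes,
  -- for r ≥ δ from the linear growth bound, where constants are absorbed by 1 ≤ r/δ.
  obtain ⟨B, hB0, hB⟩ : ∃ B : ℝ, 0 ≤ B ∧ ∀ r : ℝ, 0 < r → ‖h r‖ ≤ B * r := by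
    have hev := hslope.norm.eventually_lt_const (lt_add_one _)
    obtain ⟨δ, hδ, hball⟩ := (mem_nhdsGT_iff_exists_Ioo_subset).1 hev
    have hδ' : (0 : ℝ) < δ := hδ
    refine ⟨(‖2 * f k‖ + 1) + ((|k| + 1) / δ + 1) * M, by positivity, fun r hr => ?_⟩
    rcases lt_or_ge r δ with hlt | hge
    · have := hball ⟨hr, hlt⟩
      simp only [Set.mem_ofPred_eq, norm_smul, norm_inv, Real.norm_of_nonneg hr.le] at this
      rw [inv_mul_lt_iff₀ hr] at this
      have h4 : 0 ≤ ((|k| + 1) / δ + 1) * M * r := by positivity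
      nlinarith
    · have h5 := hM r hr
      have h6 : |k| + r + 1 ≤ ((|k| + 1) / δ + 1) * r := by
        have : |k| + 1 ≤ (|k| + 1) / δ * r := by
          rw [div_mul_eq_mul_div, le_div_iff₀ hδ']
          exact mul_le_mul_of_nonneg_left hge (by positivity)
        linarith
      have h7 : (|k| + r + 1) * M ≤ ((|k| + 1) / δ + 1) * r * M :=
        mul_le_mul_of_nonneg_right h6 hM0
      have h8 : 0 ≤ (‖2 * f k‖ + 1) * r := by positivity
      calc ‖h r‖ ≤ _ := h5
        _ ≤ _ := h7
        _ ≤ _ := by nlinarith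
  have hrepr : ∀ ε : ℝ, 0 < ε → poissonIntegral f k ε
      = ∫ r in Set.Ioi (0 : ℝ), (layerWeight r : ℂ) * ((ε⁻¹ : ℝ) • h (ε * r)) := by
    intro ε hε
    have h1 := poissonIntegral_eq_layer hf.locallyIntegrable hε k (hf.integrable_kernel_mul hε k)
    have h2 : (ε : ℂ) ≠ 0 := by exact_mod_cast hε.ne'
    have h3 : ∀ r : ℝ, (layerWeight r : ℂ) * ((ε⁻¹ : ℝ) • h (ε * r))
        = (ε : ℂ)⁻¹ * ((layerWeight r : ℂ) * h (ε * r)) := fun r => by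
      rw [real_smul]; push_cast; ring
    simp_rw [h3]
    rw [integral_const_mul, ← h1]
    field_simp
  refine Tendsto.congr' (EventuallyEq.symm (eventually_nhdsWithin_of_forall hrepr)) ?_
  have hlim : ∫ r in Set.Ioi (0 : ℝ), (layerWeight r : ℂ) * (r * (2 * f k)) = f k := by
    have : ∀ r : ℝ, (layerWeight r : ℂ) * (r * (2 * f k)) = (layerWeight r : ℂ) * (2 * r) * f k :=
      fun r => by ring
    simp_rw [this]
    rw [integral_mul_const, integral_layerWeight_mul, one_mul]
  rw [← hlim]
  refine tendsto_integral_filter_of_dominated_convergence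
    (fun r => B * (layerWeight r * r)) ?_ ?_ (integrableOn_layerWeight_mul.const_mul B) ?_
  · refine Eventually.of_forall fun ε => Continuous.aestronglyMeasurable ?_
    exact (continuous_ofReal.comp continuous_layerWeight).mul
      ((hcont.comp (continuous_const_mul ε)).const_smul ε⁻¹)
  · refine eventually_nhdsWithin_of_forall fun ε hε => ?_
    refine (ae_restrict_iff' measurableSet_Ioi).2 (Eventually.of_forall fun r hr => ?_)
    have hε' : (0 : ℝ) < ε := hε
    have hr' : (0 : ℝ) < r := hr
    have hB' := hB (ε * r) (mul_pos hε' hr')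
    rw [norm_mul, norm_real, Real.norm_of_nonneg (layerWeight_nonneg hr'.le), norm_smul, norm_inv,
      Real.norm_of_nonneg hε'.le]
    have : ε⁻¹ * ‖h (ε * r)‖ ≤ B * r := by
      rw [inv_mul_le_iff₀ hε']
      linarith
    calc _ ≤ layerWeight r * (B * r) :=
          mul_le_mul_of_nonneg_left this (layerWeight_nonneg hr'.le)
      _ = _ := by ring
  · refine (ae_restrict_iff' measurableSet_Ioi).2 (Eventually.of_forall fun r hr => ?_)
    have hr' : (0 : ℝ) < r := hr
    have hcomp : Tendsto (fun ε : ℝ => ε * r) (𝓝[>] 0) (𝓝[>] 0) := by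
      refine tendsto_nhdsWithin_iff.2 ⟨?_, eventually_nhdsWithin_of_forall fun ε hε =>
        mul_pos hε hr'⟩
      have : Tendsto (fun ε : ℝ => ε * r) (𝓝 0) (𝓝 (0 * r)) := (continuous_mul_const r).tendsto 0
      rw [zero_mul] at this
      exact this.mono_left nhdsWithin_le_nhds
    have h1 := ((hslope.comp hcomp).const_mul (r : ℂ)).const_mul (layerWeight r : ℂ)
    refine h1.congr' (eventually_nhdsWithin_of_forall fun ε hε => ?_)
    have hε' : (ε : ℂ) ≠ 0 := by exact_mod_cast (ne_of_gt (show (0:ℝ) < ε from hε))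
    have hr'' : (r : ℂ) ≠ 0 := by exact_mod_cast hr'.ne'
    simp only [Function.comp, real_smul]
    push_cast
    field_simp

/-- The jump of the Cauchy transform across the real line recovers the function. -/
theorem CauchyIntegrable.ae_tendsto_jump {f : ℝ → ℂ} (hf : CauchyIntegrable f) :
    ∀ᵐ k : ℝ, Tendsto (fun ε : ℝ => cauchyTransform f ((k : ℂ) + ε * I)
      - cauchyTransform f ((k : ℂ) - ε * I)) (𝓝[>] 0) (𝓝 (2 * Real.pi * I * f k)) := by
  filter_upwards [hf.ae_tendsto_poissonIntegral] with k hk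
  refine (hk.const_mul (2 * Real.pi * I)).congr'
    (eventually_nhdsWithin_of_forall fun ε hε => ?_)
  exact (hf.jump_eq hε k).symm

theorem two_pi_I_ne : (2 * Real.pi * I : ℂ) ≠ 0 := two_pi_I_ne_zero

/-- The jump across the line is 2πi f, and here it is zero. -/
theorem CauchyIntegrable.ae_eq_zero {f : ℝ → ℂ} (hf : CauchyIntegrable f)
    (h1 : ∀ z : ℂ, 0 < z.im → cauchyTransform f z = 0)
    (h2 : ∀ z : ℂ, z.im < 0 → cauchyTransform f z = 0) : f =ᵐ[volume] 0 := by
  filter_upwards [hf.ae_tendsto_jump] with k hk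
  have h : Tendsto (fun ε : ℝ => cauchyTransform f ((k : ℂ) + ε * I)
      - cauchyTransform f ((k : ℂ) - ε * I)) (𝓝[>] 0) (𝓝 0) := by
    refine tendsto_const_nhds.congr' (eventually_nhdsWithin_of_forall fun ε hε => ?_)
    have hε' : (0 : ℝ) < ε := hε
    simp only
    rw [h1 _ (by simpa using hε'), h2 _ (by simpa using hε'), sub_zero]
  have := tendsto_nhds_unique hk h
  simpa [two_pi_I_ne] using this

theorem lintegral_halfPlaneKernel {y : ℝ} (hy : 0 < y) (x : ℝ) :
    ∫⁻ t, ENNReal.ofReal (halfPlaneKernel x y t) = 1 := by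
  rw [← ofReal_integral_eq_lintegral_ofReal (integrable_halfPlaneKernel hy x)
    (Eventually.of_forall fun t => (halfPlaneKernel_pos hy x t).le), integral_halfPlaneKernel hy,
    ENNReal.ofReal_one]

theorem measurable_ofReal_halfPlaneKernel (x y : ℝ) :
    Measurable fun t => ENNReal.ofReal (halfPlaneKernel x y t) :=
  ((measurable_halfPlaneKernel y).comp measurable_prodMk_left).ennreal_ofReal

/-- Jensen's inequality: the Poisson kernel is a probability density, and norms over a probability
space increase with the exponent. -/
theorem enorm_poissonIntegral_rpow_le {f : ℝ → ℂ} (hf : AEStronglyMeasurable f volume) {y : ℝ}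
    (hy : 0 < y) (x : ℝ) {p : ℝ} (hp : 1 ≤ p) :
    ‖poissonIntegral f x y‖ₑ ^ p
      ≤ ∫⁻ t, ENNReal.ofReal (halfPlaneKernel x y t) * ‖f t‖ₑ ^ p := by
  have hm : Measurable fun t => ENNReal.ofReal (halfPlaneKernel x y t) :=
    measurable_ofReal_halfPlaneKernel x y
  set μ : Measure ℝ := volume.withDensity fun t => ENNReal.ofReal (halfPlaneKernel x y t) with hμ
  have hprob : IsProbabilityMeasure μ := ⟨by
    rw [hμ, withDensity_apply _ MeasurableSet.univ, setLIntegral_univ,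
      lintegral_halfPlaneKernel hy]⟩
  have hfμ : AEStronglyMeasurable f μ := hf.mono_ac (withDensity_absolutelyContinuous _ _)
  have hint : ∀ q : ℝ, ∫⁻ t, ‖f t‖ₑ ^ q ∂μ
      = ∫⁻ t, ENNReal.ofReal (halfPlaneKernel x y t) * ‖f t‖ₑ ^ q := fun q => by
    rw [hμ, lintegral_withDensity_eq_lintegral_mul₀ hm.aemeasurable (hf.enorm.pow_const q)]
    rfl
  have h1 : ‖poissonIntegral f x y‖ₑ ≤ ∫⁻ t, ‖f t‖ₑ ∂μ := by
    have := hint 1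
    simp only [ENNReal.rpow_one] at this
    rw [this]
    refine (enorm_integral_le_lintegral_enorm _).trans (le_of_eq ?_)
    congr 1 with t
    rw [enorm_mul, ← ofReal_norm (halfPlaneKernel x y t : ℂ), norm_real,
      Real.norm_of_nonneg (halfPlaneKernel_pos hy x t).le]
  have h2 := eLpNorm'_le_eLpNorm'_of_exponent_le one_pos hp μ hfμ
  simp only [eLpNorm', ENNReal.rpow_one, one_div, inv_one] at h2
  rw [hint p] at h2
  have h3 := ENNReal.rpow_le_rpow (h1.trans h2) (zero_le_one.trans hp)
  rwa [← ENNReal.rpow_mul, inv_mul_cancel₀ (by linarith), ENNReal.rpow_one] at h3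

/-- The Poisson integral is a contraction on `Lᵖ`. -/
theorem eLpNorm_poissonIntegral_le {f : ℝ → ℂ} (hf : AEStronglyMeasurable f volume) {y : ℝ}
    (hy : 0 < y) {p : ENNReal} (hp : 1 ≤ p) (hp' : p ≠ ⊤) :
    eLpNorm (fun x => poissonIntegral f x y) p volume ≤ eLpNorm f p volume := by
  have hp0 : p ≠ 0 := (zero_lt_one.trans_le hp).ne'
  have hpr : 1 ≤ p.toReal := by
    rw [← ENNReal.toReal_one]; exact ENNReal.toReal_mono hp' hp
  rw [eLpNorm_eq_lintegral_rpow_enorm_toReal hp0 hp', eLpNorm_eq_lintegral_rpow_enorm_toReal hp0 hp']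
  refine ENNReal.rpow_le_rpow ?_ (by positivity)
  refine (lintegral_mono fun x => enorm_poissonIntegral_rpow_le hf hy x hpr).trans (le_of_eq ?_)
  -- After Tonelli the kernel is integrated in x; it is symmetric in x and t, so this integral is
  -- again 1.
  rw [lintegral_lintegral_swap]
  · refine lintegral_congr_ae (Eventually.of_forall fun t => ?_)
    have : ∀ x, ENNReal.ofReal (halfPlaneKernel x y t) * ‖f t‖ₑ ^ p.toReal
        = ENNReal.ofReal (halfPlaneKernel t y x) * ‖f t‖ₑ ^ p.toReal := fun x => by
      rw [halfPlaneKernel_comm]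
    simp_rw [this]
    rw [lintegral_mul_const _ (measurable_ofReal_halfPlaneKernel t y), lintegral_halfPlaneKernel hy, one_mul]
  · exact ((measurable_halfPlaneKernel y).ennreal_ofReal.aemeasurable).mul
      ((hf.enorm.pow_const _).comp_snd)

/-! ### Contour shifts, and the upper Hardy space as a closed subspace of L² -/

theorem continuousOn_strip_comp {G : ℂ → ℂ} {a b : ℝ}
    (hG : ContinuousOn G {z | a ≤ z.im ∧ z.im ≤ b}) {y : ℝ} (hy : y ∈ Set.Icc a b) :
    Continuous fun x : ℝ => G ((x : ℂ) + y * I) := by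
  refine hG.comp_continuous (by fun_prop) fun x => ?_
  simpa using hy

/-- Shifting the line of integration of an analytic function. -/
theorem integral_line_eq {G : ℂ → ℂ} {a b : ℝ} (hab : a ≤ b)
    (hG : DifferentiableOn ℂ G {z | a ≤ z.im ∧ z.im ≤ b}) {C : ENNReal} (hC : C ≠ ⊤)
    (hb : ∀ y ∈ Set.Icc a b, ∫⁻ x : ℝ, ‖G ((x : ℂ) + y * I)‖ₑ ≤ C) :
    ∫ x : ℝ, G ((x : ℂ) + a * I) = ∫ x : ℝ, G ((x : ℂ) + b * I) := by
  have hline : ∀ y ∈ Set.Icc a b, Integrable fun x : ℝ => G ((x : ℂ) + y * I) := fun y hy =>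
    ⟨(continuousOn_strip_comp hG.continuousOn hy).aestronglyMeasurable,
      (hb y hy).trans_lt hC.lt_top⟩
  have hmeas : AEStronglyMeasurable (fun p : ℝ × ℝ => G ((p.1 : ℂ) + p.2 * I))
      ((volume : Measure ℝ).prod (volume.restrict (Set.Icc a b))) := by
    have h1 : ContinuousOn (fun p : ℝ × ℝ => G ((p.1 : ℂ) + p.2 * I))
        (Set.univ ×ˢ Set.Icc a b) := by
      refine hG.continuousOn.comp (by fun_prop) fun p hp => ?_
      simpa using hp.2
    have h2 := h1.aestronglyMeasurable (μ := (volume : Measure ℝ).prod volume)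
      (MeasurableSet.univ.prod measurableSet_Icc)
    rwa [← Measure.prod_restrict, Measure.restrict_univ] at h2
  have hint : Integrable (fun p : ℝ × ℝ => G ((p.1 : ℂ) + p.2 * I))
      ((volume : Measure ℝ).prod (volume.restrict (Set.Icc a b))) := by
    refine ⟨hmeas, ?_⟩
    rw [HasFiniteIntegral, lintegral_prod_symm _ hmeas.enorm]
    calc ∫⁻ y in Set.Icc a b, ∫⁻ x : ℝ, ‖G ((x : ℂ) + y * I)‖ₑ
        ≤ ∫⁻ y in Set.Icc a b, C :=
          lintegral_mono_ae ((ae_restrict_iff' measurableSet_Icc).2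
            (Eventually.of_forall hb))
      _ < ⊤ := by
          rw [lintegral_const, Measure.restrict_apply MeasurableSet.univ, Set.univ_inter,
            Real.volume_Icc]
          exact ENNReal.mul_lt_top hC.lt_top ENNReal.ofReal_lt_top
  -- V(T) is the integral over the vertical side at abscissa T. No pointwise decay of G is
  -- available; instead V is integrable in T by Fubini.
  set V : ℝ → ℂ := fun T => ∫ y in Set.Icc a b, G ((T : ℂ) + y * I) with hV
  have hVint : Integrable V := hint.integral_prod_left
  have hrect : ∀ T : ℝ, I * V (-T) - I * V T
      = (∫ x in (-T)..T, G ((x : ℂ) + a * I)) - ∫ x in (-T)..T, G ((x : ℂ) + b * I) := by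
    intro T
    have h := integral_boundary_rect_eq_zero_of_differentiableOn G
      ((-T : ℝ) + a * I) ((T : ℝ) + b * I) (hG.mono fun z hz => by
        have := hz.2
        simp only [Set.mem_preimage, add_im, ofReal_im, mul_im, ofReal_re, I_im, I_re, mul_one,
          mul_zero, add_zero, zero_add, Set.uIcc_of_le hab] at this
        exact this)
    simp only [add_re, ofReal_re, mul_re, I_re, mul_zero, ofReal_im, I_im, mul_one, sub_self,
      add_zero, add_im, mul_im, zero_add, smul_eq_mul] at h
    rw [intervalIntegral.integral_of_le hab, intervalIntegral.integral_of_le hab,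
      ← integral_Icc_eq_integral_Ioc, ← integral_Icc_eq_integral_Ioc] at h
    simp only [hV]
    linear_combination -h
  have hlim : Tendsto (fun T : ℝ => I * V (-T) - I * V T) atTop
      (𝓝 ((∫ x : ℝ, G ((x : ℂ) + a * I)) - ∫ x : ℝ, G ((x : ℂ) + b * I))) := by
    simp_rw [hrect]
    exact (intervalIntegral_tendsto_integral (hline a (Set.left_mem_Icc.2 hab))
      tendsto_neg_atTop_atBot tendsto_id).sub
      (intervalIntegral_tendsto_integral (hline b (Set.right_mem_Icc.2 hab))
      tendsto_neg_atTop_atBot tendsto_id)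
  have hU : Integrable (fun T : ℝ => I * V (-T) - I * V T) :=
    (hVint.comp_neg.const_mul I).sub (hVint.const_mul I)
  -- The contribution of the vertical sides is integrable in T and has a limit as T → ∞, so the
  -- limit is 0. By the rectangle identity this limit is the difference of the two line integrals.
  have h0 := IntegrableAtFilter.eq_zero_of_tendsto (hU.integrableAtFilter atTop) (by
    intro s hs
    obtain ⟨r, hr⟩ := mem_atTop_sets.1 hs
    exact top_le_iff.1 (Real.volume_Ici (a := r) ▸ measure_mono hr)) hlim
  exact sub_eq_zero.1 h0

theorem norm_inv_sub_sq {z : ℂ} (hz : z.im ≠ 0) (x : ℝ) :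
    ‖1 / ((x : ℂ) - z)‖ ^ 2 = Real.pi / |z.im| * halfPlaneKernel z.re |z.im| x := by
  have h : ‖(x : ℂ) - z‖ ^ 2 = (x - z.re) ^ 2 + |z.im| ^ 2 := by
    rw [← normSq_eq_norm_sq, normSq_apply]; simp; ring
  have h1 : 0 < |z.im| := abs_pos.2 hz
  have := Real.pi_pos
  rw [norm_div, norm_one, div_pow, h, halfPlaneKernel]
  field_simp

/-- The squared modulus of the Cauchy kernel is π/|Im z| times a Poisson kernel, which has mass one.
The decay in |Im z| is what allows contours to be pushed to infinity. -/
theorem eLpNorm_inv_sub {z : ℂ} (hz : z.im ≠ 0) :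
    eLpNorm (fun x : ℝ => 1 / ((x : ℂ) - z)) 2 volume
      = ENNReal.ofReal (Real.sqrt (Real.pi / |z.im|)) := by
  have h1 : 0 < |z.im| := abs_pos.2 hz
  have hpi := Real.pi_pos
  have key : ∫⁻ x : ℝ, ‖1 / ((x : ℂ) - z)‖ₑ ^ (2 : ℝ) = ENNReal.ofReal (Real.pi / |z.im|) := by
    have : ∀ x : ℝ, ‖1 / ((x : ℂ) - z)‖ₑ ^ (2 : ℝ) = ENNReal.ofReal (Real.pi / |z.im|)
        * ENNReal.ofReal (halfPlaneKernel z.re |z.im| x) := fun x => by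
      rw [← ENNReal.ofReal_mul (by positivity), ← norm_inv_sub_sq hz x, ← ofReal_norm,
        ENNReal.ofReal_rpow_of_nonneg (norm_nonneg _) (by norm_num)]
      norm_num
    simp_rw [this]
    rw [lintegral_const_mul _ (measurable_ofReal_halfPlaneKernel _ _), lintegral_halfPlaneKernel h1, mul_one]
  rw [eLpNorm_eq_lintegral_rpow_enorm_toReal two_ne_zero ENNReal.ofNat_ne_top]
  simp only [ENNReal.toReal_ofNat]
  rw [key, ENNReal.ofReal_rpow_of_nonneg (by positivity) (by norm_num), Real.sqrt_eq_rpow]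

theorem lintegral_enorm_mul_le {f g : ℝ → ℂ} (hf : AEStronglyMeasurable f volume)
    (hg : AEStronglyMeasurable g volume) :
    ∫⁻ x, ‖f x * g x‖ₑ ≤ eLpNorm f 2 volume * eLpNorm g 2 volume := by
  have h := eLpNorm_smul_le_mul_eLpNorm (p := 2) (q := 2) (r := 1) hg hf
  rwa [eLpNorm_one_eq_lintegral_enorm] at h

/-- The functions in `L²` whose Cauchy transform vanishes in the lower half-plane. -/
def IsPlus (f : ℝ → ℂ) : Prop :=
  MemLp f 2 volume ∧ ∀ z : ℂ, z.im < 0 → cauchyTransform f z = 0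

theorem IsPlus.cauchyIntegrable {f : ℝ → ℂ} (hf : IsPlus f) : CauchyIntegrable f :=
  cauchyIntegrable_of_memLp hf.1

theorem IsPlus.congr {f g : ℝ → ℂ} (hf : IsPlus f) (h : f =ᵐ[volume] g) : IsPlus g :=
  ⟨(memLp_congr_ae h).1 hf.1, fun z hz => by rw [← cauchyTransform_congr h, hf.2 z hz]⟩

theorem IsPlus.const_mul {f : ℝ → ℂ} (c : ℂ) (hf : IsPlus f) : IsPlus (fun x => c * f x) :=
  ⟨hf.1.const_mul c, fun z hz => by rw [cauchyTransform_const_mul, hf.2 z hz, mul_zero]⟩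

theorem lintegral_enorm_line_div_le {F : ℝ → ℂ} (hF : AEStronglyMeasurable F volume)
    {C : ENNReal} (hC : eLpNorm F 2 volume ≤ C) {d : ℝ} (hd : 0 < d) {w : ℂ} (hw : d ≤ |w.im|) :
    ∫⁻ x : ℝ, ‖F x / ((x : ℂ) - w)‖ₑ ≤ C * ENNReal.ofReal (Real.sqrt (Real.pi / d)) := by
  have hw0 : w.im ≠ 0 := fun h => by rw [h, abs_zero] at hw; linarith
  have h := lintegral_enorm_mul_le hF (memLp_inv_sub hw0).1
  simp_rw [mul_one_div] at h
  refine h.trans ?_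
  rw [eLpNorm_inv_sub hw0]
  gcongr

theorem line_sub_eq (x y : ℝ) (w : ℂ) : (x : ℂ) + y * I - w = (x : ℂ) - (w - y * I) := by ring

/-- A square integrable analytic function on a closed half-plane has vanishing Cauchy transform
below the half-plane. -/
theorem cauchyTransform_line_eq_zero {F : ℂ → ℂ} (hF : DifferentiableOn ℂ F {z | 0 ≤ z.im})
    {C : ENNReal} (hC : C ≠ ⊤)
    (hb : ∀ y : ℝ, 0 ≤ y → eLpNorm (fun x : ℝ => F ((x : ℂ) + y * I)) 2 volume ≤ C)
    {z : ℂ} (hz : z.im < 0) : cauchyTransform (fun x : ℝ => F x) z = 0 := by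
  set G : ℂ → ℂ := fun w => F w / (w - z) with hG
  have hGd : DifferentiableOn ℂ G {w | 0 ≤ w.im} := by
    refine hF.div (by fun_prop) fun w hw h => ?_
    have : w = z := sub_eq_zero.1 h
    rw [this] at hw
    exact absurd hw (not_le.2 hz)
  have hmeas : ∀ y : ℝ, 0 ≤ y →
      AEStronglyMeasurable (fun x : ℝ => F ((x : ℂ) + y * I)) volume := fun y hy =>
    (hF.continuousOn.comp_continuous (by fun_prop) fun x => by
      simpa using hy).aestronglyMeasurable
  have hest : ∀ y : ℝ, 0 ≤ y → ∀ d : ℝ, 0 < d → d ≤ y - z.im →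
      ∫⁻ x : ℝ, ‖G ((x : ℂ) + y * I)‖ₑ ≤ C * ENNReal.ofReal (Real.sqrt (Real.pi / d)) := by
    intro y hy d hd hdy
    simp only [hG, line_sub_eq]
    refine lintegral_enorm_line_div_le (hmeas y hy) (hb y hy) hd ?_
    simp only [sub_im, mul_im, ofReal_re, I_im, mul_one, ofReal_im, I_re, mul_zero, add_zero]
    rw [abs_sub_comm]
    exact hdy.trans (le_abs_self _)
  -- The pole z lies below the half-plane, so the line of integration can be raised to any height y
  -- without changing the integral; by Cauchy-Schwarz its value is O(y^{-1/2}), hence zero.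
  have hconst : ∀ y : ℝ, 0 ≤ y → ∫ x : ℝ, G ((x : ℂ) + (0 : ℝ) * I) = ∫ x : ℝ, G ((x : ℂ) + y * I) := by
    intro y hy
    refine integral_line_eq hy (hGd.mono fun w hw => hw.1)
      (C := C * ENNReal.ofReal (Real.sqrt (Real.pi / (-z.im))))
      (ENNReal.mul_ne_top hC ENNReal.ofReal_ne_top) fun t ht => ?_
    exact hest t ht.1 _ (by linarith) (by linarith [ht.1])
  have hle : ∀ y : ℝ, 0 < y → ‖cauchyTransform (fun x : ℝ => F x) z‖ₑ
      ≤ C * ENNReal.ofReal (Real.sqrt (Real.pi / y)) := by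
    intro y hy
    have h1 : cauchyTransform (fun x : ℝ => F x) z = ∫ x : ℝ, G ((x : ℂ) + y * I) := by
      rw [← hconst y hy.le]
      simp [cauchyTransform, hG]
    rw [h1]
    exact (enorm_integral_le_lintegral_enorm _).trans (hest y hy.le y hy (by linarith))
  have hlim : Tendsto (fun y : ℝ => C * ENNReal.ofReal (Real.sqrt (Real.pi / y))) atTop (𝓝 0) := by
    have h1 : Tendsto (fun y : ℝ => Real.pi / y) atTop (𝓝 0) := tendsto_const_nhds.div_atTop tendsto_id
    have h2 := (Real.continuous_sqrt.tendsto 0).comp h1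
    rw [Real.sqrt_zero] at h2
    have h3 := ENNReal.tendsto_ofReal h2
    rw [ENNReal.ofReal_zero] at h3
    simpa using ENNReal.Tendsto.const_mul h3 (Or.inr hC)
  have h0 := ge_of_tendsto hlim ((eventually_gt_atTop 0).mono hle)
  simpa using h0

theorem eLpNorm_inv_line_le {w : ℂ} (hw : w.im < 0) {y : ℝ} (hy : 0 ≤ y) :
    eLpNorm (fun x : ℝ => 1 / ((x : ℂ) + y * I - w)) 2 volume
      ≤ ENNReal.ofReal (Real.sqrt (Real.pi / |w.im|)) := by
  simp_rw [line_sub_eq]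
  have him : (w - y * I).im = w.im - y := by simp
  rw [eLpNorm_inv_sub (by rw [him]; linarith), him]
  have h1 : |w.im| ≤ |w.im - y| := by
    rw [abs_of_neg hw, abs_of_neg (by linarith)]; linarith
  have h2 : 0 < |w.im| := abs_pos.2 hw.ne
  gcongr

theorem isPlus_inv_sub {w : ℂ} (hw : w.im < 0) : IsPlus (fun x : ℝ => 1 / ((x : ℂ) - w)) := by
  refine ⟨memLp_inv_sub hw.ne, fun z hz => ?_⟩
  refine cauchyTransform_line_eq_zero (F := fun ζ => 1 / (ζ - w)) ?_
    (C := ENNReal.ofReal (Real.sqrt (Real.pi / |w.im|))) ENNReal.ofReal_ne_top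
    (fun y hy => eLpNorm_inv_line_le hw hy) hz
  refine (differentiableOn_const _).div (by fun_prop) fun ζ hζ h => ?_
  rw [sub_eq_zero.1 h] at hζ
  exact absurd hζ (not_le.2 hw)

/-- The Riesz representer of the Cauchy transform at `z`. -/
noncomputable def cauchyVec (z : ℂ) (hz : z.im ≠ 0) : L2 :=
  (memLp_inv_sub (z := (starRingEnd ℂ) z) (by simpa using hz)).toLp _

theorem inner_L2_eq (f g : L2) : inner ℂ f g = ∫ x : ℝ, (starRingEnd ℂ) (f x) * g x := by
  rw [L2.inner_def]
  simp only [RCLike.inner_apply, mul_comm]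

theorem inner_toLp_toLp {f g : ℝ → ℂ} (hf : MemLp f 2 volume) (hg : MemLp g 2 volume) :
    inner ℂ (hf.toLp f) (hg.toLp g) = ∫ x : ℝ, (starRingEnd ℂ) (f x) * g x := by
  rw [inner_L2_eq]
  refine integral_congr_ae ?_
  filter_upwards [hf.coeFn_toLp, hg.coeFn_toLp] with x h1 h2
  rw [h1, h2]

theorem inner_cauchyVec (z : ℂ) (hz : z.im ≠ 0) (f : L2) :
    inner ℂ (cauchyVec z hz) f = cauchyTransform f z := by
  rw [inner_L2_eq, cauchyTransform]
  refine integral_congr_ae ?_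
  filter_upwards [(memLp_inv_sub (z := (starRingEnd ℂ) z) (by simpa using hz)).coeFn_toLp]
    with x hx
  unfold cauchyVec
  rw [hx]
  simp [div_eq_mul_inv, mul_comm]

/-- The Hardy space of the upper half-plane as a closed subspace of `L²`. -/
noncomputable def hardyPlus : Submodule ℂ L2 :=
  (Submodule.span ℂ {v : L2 | ∃ (z : ℂ) (hz : z.im < 0), v = cauchyVec z hz.ne})ᗮ

theorem mem_hardyPlus_iff (f : L2) : f ∈ hardyPlus ↔ IsPlus f := by
  rw [hardyPlus, Submodule.mem_orthogonal]
  constructor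
  · intro h
    refine ⟨Lp.memLp f, fun z hz => ?_⟩
    rw [← inner_cauchyVec z hz.ne]
    exact h _ (Submodule.subset_span ⟨z, hz, rfl⟩)
  · intro h u hu
    induction hu using Submodule.span_induction with
    | mem v hv =>
      obtain ⟨z, hz, rfl⟩ := hv
      rw [inner_cauchyVec]
      exact h.2 z hz
    | zero => simp
    | add a b _ _ ha hb => rw [inner_add_left, ha, hb, add_zero]
    | smul c a _ ha => rw [inner_smul_left, ha, mul_zero]

theorem isPlus_coe_cauchyVec {z : ℂ} (hz : 0 < z.im) : IsPlus (cauchyVec z hz.ne') :=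
  (isPlus_inv_sub (w := (starRingEnd ℂ) z) (by simpa using hz)).congr
    (MemLp.coeFn_toLp _).symm

/-- The representer of evaluation at z above the line is the Cauchy kernel with pole at the
conjugate of z, below the line, and so it is itself in the upper Hardy space. -/
theorem cauchyTransform_eq_zero_of_mem_orthogonal {f : L2} (hf : f ∈ hardyPlusᗮ) {z : ℂ}
    (hz : 0 < z.im) : cauchyTransform f z = 0 := by
  rw [← inner_cauchyVec z hz.ne']
  exact (Submodule.mem_orthogonal _ _).1 hf _ ((mem_hardyPlus_iff _).2 (isPlus_coe_cauchyVec hz))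

theorem isPlus_conj_iff {f : ℝ → ℂ} (hf : MemLp f 2 volume) :
    IsPlus (conjFun f) ↔ ∀ z : ℂ, 0 < z.im → cauchyTransform f z = 0 := by
  constructor
  · intro h z hz
    have := h.2 ((starRingEnd ℂ) z) (by simpa using hz)
    rw [cauchyTransform_conj] at this
    simpa using this
  · intro h
    refine ⟨memLp_conjFun hf, fun z hz => ?_⟩
    have := cauchyTransform_conj f ((starRingEnd ℂ) z)
    rw [conj_conj] at this
    rw [this, h _ (by simpa using hz), map_zero]

/-- Decomposition of `L²` into the two Hardy spaces. -/
theorem exists_isPlus_decomp {f : ℝ → ℂ} (hf : MemLp f 2 volume) :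
    ∃ u v : ℝ → ℂ, IsPlus u ∧ IsPlus (conjFun v) ∧ MemLp v 2 volume ∧ f =ᵐ[volume] u + v := by
  have : CompleteSpace hardyPlus := by unfold hardyPlus; infer_instance
  obtain ⟨p, hp, q, hq, hpq⟩ := hardyPlus.exists_add_mem_mem_orthogonal (hf.toLp f)
  refine ⟨p, q, (mem_hardyPlus_iff p).1 hp, (isPlus_conj_iff (Lp.memLp q)).2
    fun z hz => cauchyTransform_eq_zero_of_mem_orthogonal hq hz, Lp.memLp q, ?_⟩
  filter_upwards [hf.coeFn_toLp, Lp.coeFn_add p q] with x h1 h2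
  rw [← h1, hpq, h2]

/-- The component of f in the upper Hardy space has no Cauchy transform on either side of the line,
hence vanishes. With the previous inclusion this identifies the orthogonal complement as the lower
Hardy space. -/
theorem mem_orthogonal_of_cauchyTransform_eq_zero {f : L2}
    (hf : ∀ z : ℂ, 0 < z.im → cauchyTransform f z = 0) : f ∈ hardyPlusᗮ := by
  have : CompleteSpace hardyPlus := by unfold hardyPlus; infer_instance
  obtain ⟨p, hp, q, hq, hpq⟩ := hardyPlus.exists_add_mem_mem_orthogonal f
  have hpP := (mem_hardyPlus_iff p).1 hp
  have hsum : (f : ℝ → ℂ) =ᵐ[volume] p + q := by rw [hpq]; exact Lp.coeFn_add p q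
  have hp0 : (p : ℝ → ℂ) =ᵐ[volume] 0 := by
    refine hpP.cauchyIntegrable.ae_eq_zero (fun z hz => ?_) hpP.2
    have h1 := cauchyTransform_congr hsum z
    rw [cauchyTransform_add hpP.cauchyIntegrable (cauchyIntegrable_of_memLp (Lp.memLp q)) hz.ne',
      hf z hz, cauchyTransform_eq_zero_of_mem_orthogonal hq hz, add_zero] at h1
    exact h1.symm
  have hp0' : p = 0 := by
    rw [Lp.eq_zero_iff_ae_eq_zero]; exact hp0
  rw [hpq, hp0', zero_add]
  exact hq

/-- The integral is the inner product of the conjugate of v, which is in the orthogonal complement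
of the upper Hardy space, with u, which is in that space. -/
theorem integral_mul_eq_zero {u v : ℝ → ℂ} (hu : IsPlus u) (hv : IsPlus v) :
    ∫ x, u x * v x = 0 := by
  have hvc : MemLp (conjFun v) 2 volume := memLp_conjFun hv.1
  have h1 : hvc.toLp _ ∈ hardyPlusᗮ := by
    refine mem_orthogonal_of_cauchyTransform_eq_zero ?_
    have h2 : IsPlus (conjFun (conjFun v)) := by rwa [conjFun_conjFun]
    intro z hz
    rw [cauchyTransform_congr hvc.coeFn_toLp]
    exact (isPlus_conj_iff hvc).1 h2 z hz
  have h2 : hu.1.toLp u ∈ hardyPlus :=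
    (mem_hardyPlus_iff _).2 (hu.congr hu.1.coeFn_toLp.symm)
  have h3 := Submodule.inner_left_of_mem_orthogonal h2 h1
  rw [inner_toLp_toLp] at h3
  rw [← h3]
  congr 1 with x
  simp [conjFun, mul_comm]

theorem norm_div_sub_le {z : ℂ} (hz : z.im ≠ 0) (f : ℝ → ℂ) (x : ℝ) :
    ‖f x / ((x : ℂ) - z)‖ ≤ ‖1 / ((|z.im| : ℝ) : ℂ) * f x‖ := by
  have h := norm_inv_sub_le hz x
  rw [div_eq_mul_one_div, norm_mul, norm_mul, mul_comm]
  refine mul_le_mul_of_nonneg_right (h.trans (le_of_eq ?_)) (norm_nonneg _)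
  simp

theorem memLp_div_sub {f : ℝ → ℂ} {p : ENNReal} (hf : MemLp f p volume) {z : ℂ} (hz : z.im ≠ 0) :
    MemLp (fun x : ℝ => f x / ((x : ℂ) - z)) p volume :=
  (hf.const_mul (1 / ((|z.im| : ℝ) : ℂ))).of_le (aestronglyMeasurable_div_sub hf.1 z)
    (Eventually.of_forall fun x => norm_div_sub_le hz f x)

/-- Partial fractions express the new transform at w ≠ z by the values of the old one at z and w,
both zero; the point w = z follows by continuity. -/
theorem IsPlus.div_sub {f : ℝ → ℂ} (hf : IsPlus f) {z : ℂ} (hz : z.im < 0) :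
    IsPlus (fun x : ℝ => f x / ((x : ℂ) - z)) := by
  have hm := memLp_div_sub hf.1 hz.ne
  refine ⟨hm, fun w hw => ?_⟩
  have key : ∀ w : ℂ, w.im < 0 → w ≠ z →
      cauchyTransform (fun x : ℝ => f x / ((x : ℂ) - z)) w = 0 := by
    intro w hw hne
    have h1 : cauchyTransform (fun x : ℝ => f x / ((x : ℂ) - z)) w
        = (1 / (z - w)) * (cauchyTransform f z - cauchyTransform f w) := by
      unfold cauchyTransform
      rw [← integral_sub (hf.cauchyIntegrable.integrable hz.ne)
        (hf.cauchyIntegrable.integrable hw.ne), ← integral_const_mul]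
      congr 1 with x
      have h2 := ofReal_sub_ne_zero hz.ne x
      have h3 := ofReal_sub_ne_zero hw.ne x
      have h4 : z - w ≠ 0 := sub_ne_zero.2 hne.symm
      field_simp
      ring
    rw [h1, hf.2 z hz, hf.2 w hw, sub_zero, mul_zero]
  by_cases hne : w = z
  · subst hne
    have hc := ((cauchyIntegrable_of_memLp hm).continuousAt hz.ne).tendsto.mono_left
      (nhdsWithin_le_nhds (s := {w}ᶜ))
    refine tendsto_nhds_unique hc (tendsto_const_nhds.congr' ?_)
    have hopen : ∀ᶠ v in 𝓝[≠] w, v.im < 0 :=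
      nhdsWithin_le_nhds ((isOpen_lt continuous_im continuous_const).mem_nhds hz)
    filter_upwards [hopen, self_mem_nhdsWithin] with v hv hvne
    exact (key v hv hvne).symm
  · exact key w hw hne

/-- The product of two functions in the upper Hardy space has no Cauchy transform below. -/
theorem cauchyTransform_mul_eq_zero {u v : ℝ → ℂ} (hu : IsPlus u) (hv : IsPlus v) {z : ℂ}
    (hz : z.im < 0) : cauchyTransform (u * v) z = 0 := by
  have h := integral_mul_eq_zero hu (hv.div_sub hz)
  rw [← h]
  unfold cauchyTransform
  congr 1 with x
  simp [mul_div_assoc]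

theorem IsPlus.cauchyTransform_eq {f : ℝ → ℂ} (hf : IsPlus f) {y : ℝ} (hy : 0 < y) (x : ℝ) :
    cauchyTransform f ((x : ℂ) + y * I) = 2 * Real.pi * I * poissonIntegral f x y := by
  have h := hf.cauchyIntegrable.jump_eq hy x
  rwa [hf.2 ((x : ℂ) - y * I) (by simpa using hy), sub_zero] at h

theorem IsPlus.ae_tendsto {f : ℝ → ℂ} (hf : IsPlus f) :
    ∀ᵐ k : ℝ, Tendsto (fun ε : ℝ => cauchyTransform f ((k : ℂ) + ε * I)) (𝓝[>] 0)
      (𝓝 (2 * Real.pi * I * f k)) := by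
  filter_upwards [hf.cauchyIntegrable.ae_tendsto_poissonIntegral] with k hk
  exact (hk.const_mul (2 * Real.pi * I)).congr'
    (eventually_nhdsWithin_of_forall fun ε hε => (hf.cauchyTransform_eq hε k).symm)

/-- Functions in the upper Hardy space are boundary values of analytic functions. -/
theorem IsPlus.isHardyPlus {f : ℝ → ℂ} (hf : IsPlus f) : IsHardyPlus f := by
  refine ⟨fun z => 1 / (2 * Real.pi * I) * cauchyTransform f z, fun z hz => ?_, ?_, ?_⟩
  · exact ((hf.cauchyIntegrable.differentiableAt (ne_of_gt hz)).const_mul _).differentiableWithinAt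
  · refine ⟨(eLpNorm f 2 volume).toNNReal, fun y hy => ?_⟩
    rw [ENNReal.coe_toNNReal hf.1.eLpNorm_ne_top]
    have : ∀ x : ℝ, 1 / (2 * Real.pi * I) * cauchyTransform f ((x : ℂ) + y * I)
        = poissonIntegral f x y := fun x => by
      rw [hf.cauchyTransform_eq hy x]; field_simp [two_pi_I_ne]
    simp_rw [this]
    exact eLpNorm_poissonIntegral_le hf.1.1 hy one_le_two ENNReal.ofNat_ne_top
  · filter_upwards [hf.ae_tendsto] with k hk
    have := hk.const_mul (1 / (2 * Real.pi * I))
    convert this using 2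
    field_simp [two_pi_I_ne]

/-! ### Identification with the Hardy space defined by bounds on horizontal lines -/

/-- Square integrability on horizontal lines, uniformly in the upper half-plane. -/
def HardyBound (F : ℂ → ℂ) (C : ENNReal) : Prop :=
  DifferentiableOn ℂ F {z | 0 < z.im} ∧ C ≠ ⊤ ∧
    ∀ y : ℝ, 0 < y → eLpNorm (fun x : ℝ => F ((x : ℂ) + y * I)) 2 volume ≤ C

theorem shift_im_eq (x y ε : ℝ) : (x : ℂ) + y * I + ε * I = (x : ℂ) + ((ε + y : ℝ) : ℂ) * I := by
  push_cast; ring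

theorem HardyBound.continuous_line {F : ℂ → ℂ} {C : ENNReal} (hF : HardyBound F C) {y : ℝ}
    (hy : 0 < y) : Continuous fun x : ℝ => F ((x : ℂ) + y * I) :=
  hF.1.continuousOn.comp_continuous (by fun_prop) fun x => by simpa using hy

theorem HardyBound.memLp {F : ℂ → ℂ} {C : ENNReal} (hF : HardyBound F C) {y : ℝ}
    (hy : 0 < y) : MemLp (fun x : ℝ => F ((x : ℂ) + y * I)) 2 volume :=
  ⟨(hF.continuous_line hy).aestronglyMeasurable, (hF.2.2 y hy).trans_lt hF.2.1.lt_top⟩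

theorem HardyBound.differentiableOn_shift {F : ℂ → ℂ} {C : ENNReal} (hF : HardyBound F C)
    {ε : ℝ} (hε : 0 < ε) : DifferentiableOn ℂ (fun z => F (z + ε * I)) {z | 0 ≤ z.im} := by
  refine hF.1.comp (by fun_prop) fun z hz => ?_
  have hz' : 0 ≤ z.im := hz
  simp only [Set.mem_ofPred_eq, add_im, mul_im, ofReal_re, I_im, mul_one, ofReal_im, I_re, mul_zero,
    add_zero]
  linarith

theorem HardyBound.isPlus_line {F : ℂ → ℂ} {C : ENNReal} (hF : HardyBound F C) {ε : ℝ}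
    (hε : 0 < ε) : IsPlus (fun x : ℝ => F ((x : ℂ) + ε * I)) := by
  refine ⟨hF.memLp hε, fun z hz => ?_⟩
  refine cauchyTransform_line_eq_zero (F := fun z => F (z + ε * I))
    (hF.differentiableOn_shift hε) hF.2.1 (fun y hy => ?_) hz
  simp_rw [shift_im_eq]
  exact hF.2.2 _ (by linarith)

/-- Raise the contour by y: the pole w + iy lies above the strip because Im w > 0, so no residue
appears. -/
theorem HardyBound.cauchyTransform_shift {F : ℂ → ℂ} {C : ENNReal} (hF : HardyBound F C) {ε : ℝ}
    (hε : 0 < ε) {y : ℝ} (hy : 0 ≤ y) {w : ℂ} (hw : 0 < w.im) :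
    cauchyTransform (fun x : ℝ => F ((x : ℂ) + ((ε + y : ℝ) : ℂ) * I)) w
      = cauchyTransform (fun x : ℝ => F ((x : ℂ) + ε * I)) (w + y * I) := by
  set G : ℂ → ℂ := fun ζ => F (ζ + ε * I) / (ζ - (w + y * I)) with hG
  have h := integral_line_eq (G := G) hy (by
    refine ((hF.differentiableOn_shift hε).mono fun ζ hζ => hζ.1).div (by fun_prop) ?_
    intro ζ hζ h
    have h1 := hζ.2
    rw [sub_eq_zero.1 h] at h1
    simp at h1
    linarith)
    (C := C * ENNReal.ofReal (Real.sqrt (Real.pi / w.im)))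
    (ENNReal.mul_ne_top hF.2.1 ENNReal.ofReal_ne_top) (by
      intro t ht
      simp only [hG, shift_im_eq, line_sub_eq]
      refine lintegral_enorm_line_div_le
        (hF.continuous_line (by linarith [ht.1] : 0 < ε + t)).aestronglyMeasurable
        (hF.2.2 _ (by linarith [ht.1])) hw ?_
      simp only [sub_im, add_im, mul_im, ofReal_re, I_im, mul_one, ofReal_im, I_re, mul_zero,
        add_zero]
      exact le_trans (by linarith [ht.2]) (le_abs_self _))
  unfold cauchyTransform
  simp only [hG, shift_im_eq] at h
  simp only [ofReal_zero, zero_mul, add_zero] at h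
  rw [h]
  congr 1 with x
  congr 1
  ring

/-- Cauchy's formula obtained without residues. The restriction of F to the line at height ε + y is
a.e. the limit of its own Cauchy transform from above. By the shift identity these transforms are
values of the transform of the line at height ε, and this is continuous at height y. Both sides are
continuous along the line, so the a.e. equality holds everywhere. -/
theorem HardyBound.eq_cauchyTransform_line {F : ℂ → ℂ} {C : ENNReal} (hF : HardyBound F C) {ε : ℝ}
    (hε : 0 < ε) {z : ℂ} (hz : 0 < z.im) :
    2 * Real.pi * I * F (z + ε * I)
      = cauchyTransform (fun x : ℝ => F ((x : ℂ) + ε * I)) z := by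
  set y := z.im with hy
  have hεy : 0 < ε + y := by linarith
  have hP := hF.isPlus_line hε
  have hQ := hF.isPlus_line hεy
  have hline : Continuous fun x : ℝ =>
      cauchyTransform (fun x : ℝ => F ((x : ℂ) + ε * I)) ((x : ℂ) + y * I) := by
    refine continuous_iff_continuousAt.2 fun x => ?_
    have h1 : ((x : ℂ) + y * I).im ≠ 0 := by simpa using hz.ne'
    exact ContinuousAt.comp (f := fun x : ℝ => (x : ℂ) + y * I)
      (hP.cauchyIntegrable.continuousAt h1) (by fun_prop)
  have hae : (fun x : ℝ => 2 * Real.pi * I * F ((x : ℂ) + ((ε + y : ℝ) : ℂ) * I)) =ᵐ[volume]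
      fun x : ℝ => cauchyTransform (fun x : ℝ => F ((x : ℂ) + ε * I)) ((x : ℂ) + y * I) := by
    filter_upwards [hQ.ae_tendsto] with k hk
    refine tendsto_nhds_unique hk ?_
    have h1 : ((k : ℂ) + y * I).im ≠ 0 := by simpa using hz.ne'
    have h2 : Tendsto (fun η : ℝ => (k : ℂ) + η * I + y * I) (𝓝[>] 0) (𝓝 ((k : ℂ) + y * I)) := by
      have : Continuous fun η : ℝ => (k : ℂ) + η * I + y * I := by fun_prop
      have h3 := this.tendsto 0
      simp only [ofReal_zero, zero_mul, add_zero] at h3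
      exact h3.mono_left nhdsWithin_le_nhds
    refine ((hP.cauchyIntegrable.continuousAt h1).tendsto.comp h2).congr'
      (eventually_nhdsWithin_of_forall fun η hη => ?_)
    exact (hF.cauchyTransform_shift hε hz.le (w := (k : ℂ) + η * I) (by simpa using hη)).symm
  have heq := (Continuous.ae_eq_iff_eq (μ := volume)
    ((hF.continuous_line hεy).const_mul (2 * Real.pi * I)) hline).1 hae
  have h1 := congrFun heq z.re
  have h2 : z = (z.re : ℂ) + y * I := by rw [hy, re_add_im]
  simp only [← shift_im_eq, ← h2] at h1
  exact h1

/-- Bounded families in a Hilbert space have weak limit points. -/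
theorem exists_weak_limit {H : Type*} [NormedAddCommGroup H] [InnerProductSpace ℂ H]
    [CompleteSpace H] {ι : Type*} (U : Ultrafilter ι) (v : ι → H) (C : ℝ)
    (hv : ∀ᶠ i in U, ‖v i‖ ≤ C) :
    ∃ w : H, ∀ h : H, Tendsto (fun i => inner ℂ h (v i)) U (𝓝 (inner ℂ h w)) := by
  have hc := WeakDual.isCompact_closedBall (𝕜 := ℂ) (E := H) 0 C
  set φ : ι → WeakDual ℂ H := fun i =>
    StrongDual.toWeakDual (InnerProductSpace.toDual ℂ H (v i)) with hφ
  have hmem : ∀ᶠ i in U, φ i ∈ WeakDual.toStrongDual ⁻¹' Metric.closedBall (0 : StrongDual ℂ H) C := by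
    filter_upwards [hv] with i hi
    simp only [Set.mem_preimage, mem_closedBall_zero_iff]
    change ‖InnerProductSpace.toDual ℂ H (v i)‖ ≤ C
    rwa [LinearIsometryEquiv.norm_map]
  obtain ⟨l, -, hl⟩ := hc.ultrafilter_le_nhds (U.map φ)
    (le_principal_iff.2 hmem)
  have hl' : Tendsto φ U (𝓝 l) := hl
  refine ⟨(InnerProductSpace.toDual ℂ H).symm (WeakDual.toStrongDual l), fun h => ?_⟩
  have h1 := ((WeakDual.eval_continuous h).tendsto l).comp hl'
  have h2 : Tendsto (fun i => inner ℂ (v i) h) U (𝓝 (l h)) := h1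
  have h3 := (continuous_star.tendsto _).comp h2
  have h4 : inner ℂ h ((InnerProductSpace.toDual ℂ H).symm (WeakDual.toStrongDual l))
      = star (l h) := by
    rw [← inner_conj_symm, InnerProductSpace.toDual_symm_apply]
    rfl
  rw [h4]
  refine h3.congr fun i => ?_
  exact inner_conj_symm _ _

/-- Functions with uniformly bounded `L²` norms on horizontal lines are Cauchy integrals. -/
theorem HardyBound.exists_isPlus {F : ℂ → ℂ} {C : ENNReal} (hF : HardyBound F C) :
    ∃ f : ℝ → ℂ, IsPlus f ∧ ∀ z : ℂ, 0 < z.im → 2 * Real.pi * I * F z = cauchyTransform f z := by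
  classical
  -- The restrictions of F to the lines at height ε are bounded in L², so they converge weakly along
  -- an ultrafilter finer than ε ↓ 0. A Cauchy transform at a fixed point is an inner product with a
  -- fixed vector, so it passes to the limit.
  set U : Ultrafilter ℝ := Ultrafilter.of (𝓝[>] (0 : ℝ)) with hU
  have hUle : (U : Filter ℝ) ≤ 𝓝[>] (0 : ℝ) := Ultrafilter.of_le _
  set v : ℝ → L2 := fun ε => if h : 0 < ε then (hF.memLp h).toLp _ else 0 with hv
  have hvb : ∀ᶠ ε in U, ‖v ε‖ ≤ C.toReal := by
    refine hUle (eventually_nhdsWithin_of_forall fun ε hε => ?_)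
    have hε' : 0 < ε := hε
    simp only [hv, dif_pos hε', Lp.norm_toLp]
    exact ENNReal.toReal_mono hF.2.1 (hF.2.2 ε hε)
  obtain ⟨f, hf⟩ := exists_weak_limit U v C.toReal hvb
  have hC : ∀ z : ℂ, z.im ≠ 0 → Tendsto (fun ε : ℝ =>
      cauchyTransform (fun x : ℝ => F ((x : ℂ) + ε * I)) z) U (𝓝 (cauchyTransform f z)) := by
    intro z hz
    have := hf (cauchyVec z hz)
    rw [inner_cauchyVec] at this
    refine this.congr' (hUle (eventually_nhdsWithin_of_forall fun ε hε => ?_))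
    have hε' : 0 < ε := hε
    simp only [inner_cauchyVec]
    simp only [hv, dif_pos hε']
    exact cauchyTransform_congr (MemLp.coeFn_toLp _) z
  refine ⟨f, ⟨Lp.memLp f, fun z hz => ?_⟩, fun z hz => ?_⟩
  · refine tendsto_nhds_unique (hC z hz.ne) (tendsto_const_nhds.congr'
      (hUle (eventually_nhdsWithin_of_forall fun ε hε => ?_)))
    exact ((hF.isPlus_line hε).2 z hz).symm
  · refine tendsto_nhds_unique ?_ (hC z hz.ne')
    have h1 : ContinuousAt F z :=
      (hF.1.differentiableAt ((isOpen_lt continuous_const continuous_im).mem_nhds hz)).continuousAt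
    have h2 : Tendsto (fun ε : ℝ => z + ε * I) (𝓝[>] 0) (𝓝 z) := by
      have : Continuous fun ε : ℝ => z + ε * I := by fun_prop
      have h3 := this.tendsto 0
      simp only [ofReal_zero, zero_mul, add_zero] at h3
      exact h3.mono_left nhdsWithin_le_nhds
    refine (((h1.tendsto.comp h2).const_mul (2 * Real.pi * I)).mono_left hUle).congr'
      (hUle (eventually_nhdsWithin_of_forall fun ε hε => ?_))
    exact hF.eq_cauchyTransform_line hε hz

theorem IsHardyPlus.exists_hardyBound {u : ℝ → ℂ} (hu : IsHardyPlus u) :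
    ∃ F C, HardyBound F C ∧
      ∀ᵐ x : ℝ, Tendsto (fun y : ℝ => F ((x : ℂ) + y * I)) (𝓝[>] 0) (𝓝 (u x)) := by
  obtain ⟨F, h1, ⟨C, hC⟩, h3⟩ := hu
  exact ⟨F, C, ⟨h1, ENNReal.coe_ne_top, hC⟩, h3⟩

/-- The function F is, up to the factor 2πi, the Cauchy transform of some f that satisfies `IsPlus`;
its boundary values are then f by the jump formula and u by assumption. -/
theorem isHardyPlus_iff {u : ℝ → ℂ} : IsHardyPlus u ↔ IsPlus u := by
  refine ⟨fun hu => ?_, IsPlus.isHardyPlus⟩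
  obtain ⟨F, C, hF, hlim⟩ := hu.exists_hardyBound
  obtain ⟨f, hf, hfF⟩ := hF.exists_isPlus
  refine hf.congr ?_
  filter_upwards [hlim, hf.ae_tendsto] with x h1 h2
  have h3 : Tendsto (fun ε : ℝ => cauchyTransform f ((x : ℂ) + ε * I)) (𝓝[>] 0)
      (𝓝 (2 * Real.pi * I * u x)) := by
    refine (h1.const_mul (2 * Real.pi * I)).congr'
      (eventually_nhdsWithin_of_forall fun ε hε => hfF _ (by simpa using hε))
  exact mul_left_cancel₀ two_pi_I_ne (tendsto_nhds_unique h2 h3)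

/-! ### Bounded analytic functions, functions of bounded type and boundary uniqueness -/

/-- Bounded analytic functions in the upper half-plane. -/
def BddAnalytic (B : ℂ → ℂ) : Prop :=
  DifferentiableOn ℂ B {z | 0 < z.im} ∧ ∃ M : ℝ, 0 ≤ M ∧ ∀ z : ℂ, 0 < z.im → ‖B z‖ ≤ M

theorem BddAnalytic.const (c : ℂ) : BddAnalytic fun _ => c :=
  ⟨differentiableOn_const c, ‖c‖, norm_nonneg c, fun _ _ => le_rfl⟩

theorem BddAnalytic.add {A B : ℂ → ℂ} (hA : BddAnalytic A) (hB : BddAnalytic B) :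
    BddAnalytic fun z => A z + B z := by
  obtain ⟨hA1, M, hM0, hM⟩ := hA
  obtain ⟨hB1, N, hN0, hN⟩ := hB
  exact ⟨hA1.add hB1, M + N, add_nonneg hM0 hN0,
    fun z hz => (norm_add_le _ _).trans (add_le_add (hM z hz) (hN z hz))⟩

theorem BddAnalytic.mul {A B : ℂ → ℂ} (hA : BddAnalytic A) (hB : BddAnalytic B) :
    BddAnalytic fun z => A z * B z := by
  obtain ⟨hA1, M, hM0, hM⟩ := hA
  obtain ⟨hB1, N, hN0, hN⟩ := hB
  exact ⟨hA1.mul hB1, M * N, mul_nonneg hM0 hN0,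
    fun z hz => (norm_mul_le _ _).trans (mul_le_mul (hM z hz) (hN z hz) (norm_nonneg _) hM0)⟩

theorem add_I_ne_zero {z : ℂ} (hz : 0 < z.im) : z + I ≠ 0 := by
  intro h
  have := congrArg im h
  simp at this
  linarith

/-- Division by z + i, which has no zero above the line, turns boundedness into uniform square
integrability on horizontal lines. -/
theorem BddAnalytic.hardyBound {B : ℂ → ℂ} (hB : BddAnalytic B) :
    ∃ C, HardyBound (fun z => B z / (z + I)) C := by
  obtain ⟨h1, M, hM0, hM⟩ := hB
  refine ⟨ENNReal.ofReal M * ENNReal.ofReal (Real.sqrt (Real.pi / |(-I).im|)), ?_,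
    ENNReal.mul_ne_top ENNReal.ofReal_ne_top ENNReal.ofReal_ne_top, fun y hy => ?_⟩
  · exact h1.div (by fun_prop) fun z hz => add_I_ne_zero hz
  · refine (eLpNorm_le_mul_eLpNorm_of_ae_le_mul (c := M)
      (g := fun x : ℝ => 1 / ((x : ℂ) + y * I - -I)) (Eventually.of_forall fun x => ?_) 2).trans ?_
    · simp only
      rw [div_eq_mul_one_div, norm_mul, sub_neg_eq_add]
      exact mul_le_mul_of_nonneg_right (hM _ (by simpa using hy)) (norm_nonneg _)
    · gcongr
      exact eLpNorm_inv_line_le (by simp) hy.le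

theorem tendsto_vertical (k : ℝ) :
    Tendsto (fun ε : ℝ => (k : ℂ) + ε * I) (𝓝[>] 0) (𝓝 (k : ℂ)) := by
  have : Continuous fun ε : ℝ => (k : ℂ) + ε * I := by fun_prop
  have h3 := this.tendsto 0
  simp only [ofReal_zero, zero_mul, add_zero] at h3
  exact h3.mono_left nhdsWithin_le_nhds

/-- Boundary representation of a bounded analytic function. -/
theorem BddAnalytic.exists_boundary {B : ℂ → ℂ} (hB : BddAnalytic B) :
    ∃ f : ℝ → ℂ, IsPlus f ∧
      (∀ z : ℂ, 0 < z.im → 2 * Real.pi * I * (B z / (z + I)) = cauchyTransform f z) ∧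
      ∀ᵐ k : ℝ, Tendsto (fun ε : ℝ => B ((k : ℂ) + ε * I)) (𝓝[>] 0) (𝓝 (f k * (k + I))) := by
  obtain ⟨C, hC⟩ := hB.hardyBound
  obtain ⟨f, hf, hfF⟩ := hC.exists_isPlus
  refine ⟨f, hf, hfF, ?_⟩
  filter_upwards [hf.ae_tendsto] with k hk
  have h1 := ((hk.const_mul (1 / (2 * Real.pi * I))).mul ((tendsto_vertical k).add_const I))
  have h2 : 1 / (2 * Real.pi * I) * (2 * Real.pi * I * f k) * (k + I) = f k * (k + I) := by
    field_simp [two_pi_I_ne]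
  rw [h2] at h1
  refine h1.congr' (eventually_nhdsWithin_of_forall fun ε hε => ?_)
  have hε' : 0 < ((k : ℂ) + ε * I).im := by simpa using hε
  have hne := add_I_ne_zero hε'
  simp only
  rw [← hfF _ hε']
  generalize (k : ℂ) + ε * I = w at hne ⊢
  field_simp [two_pi_I_ne]

theorem poissonIntegral_ofReal (h : ℝ → ℝ) (x y : ℝ) :
    poissonIntegral (fun t => (h t : ℂ)) x y = ((∫ t, halfPlaneKernel x y t * h t : ℝ) : ℂ) := by
  unfold poissonIntegral
  rw [← integral_complex_ofReal]
  simp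

/-- For real h the transform takes conjugate values at conjugate points, so the jump formula
computes its imaginary part. -/
theorem im_cauchyTransform_ofReal {h : ℝ → ℝ} (hh : CauchyIntegrable fun t => (h t : ℂ)) {y : ℝ}
    (hy : 0 < y) (x : ℝ) :
    (cauchyTransform (fun t => (h t : ℂ)) ((x : ℂ) + y * I)).im
      = Real.pi * ∫ t, halfPlaneKernel x y t * h t := by
  have h1 := hh.jump_eq hy x
  have h2 : cauchyTransform (fun t => (h t : ℂ)) ((x : ℂ) - y * I)
      = (starRingEnd ℂ) (cauchyTransform (fun t => (h t : ℂ)) ((x : ℂ) + y * I)) := by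
    rw [← cauchyTransform_conj]
    congr 1
    · ext t; simp [conjFun]
    · simp [sub_eq_add_neg]
  rw [h2, poissonIntegral_ofReal] at h1
  have h3 := congrArg im h1
  simp only [sub_im, conj_im, sub_neg_eq_add, mul_im, mul_re, re_ofNat, ofReal_re, im_ofNat,
    ofReal_im, mul_zero, sub_zero, I_re, I_im, mul_one, zero_mul, add_zero, zero_add] at h3
  linarith

theorem exists_eq_add_mul_I {z : ℂ} : z = (z.re : ℂ) + (z.im : ℝ) * I := (re_add_im z).symm

/-- The weight used to detect a set of positive measure. -/
theorem integrable_weight (s : Set ℝ) (hs : MeasurableSet s) :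
    Integrable (s.indicator fun x : ℝ => (1 + x ^ 2)⁻¹) :=
  integrable_inv_one_add_sq.indicator hs

theorem norm_poissonIntegral_le {f g : ℝ → ℂ} {x y : ℝ} (hy : 0 < y)
    (h : ∀ᵐ t, ‖f t‖ = ‖g t‖) :
    ‖poissonIntegral f x y‖ ≤ ∫ t, halfPlaneKernel x y t * ‖g t‖ := by
  refine (norm_integral_le_integral_norm _).trans (le_of_eq ?_)
  refine integral_congr_ae ?_
  filter_upwards [h] with t ht
  rw [norm_mul, norm_real, Real.norm_of_nonneg (halfPlaneKernel_pos hy x t).le, ht]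

/-- A bounded analytic function whose boundary values vanish on a set of positive measure is
zero. -/
theorem BddAnalytic.eq_zero_of_boundary {B : ℂ → ℂ} (hB : BddAnalytic B) {f : ℝ → ℂ}
    (hlim : ∀ᵐ k : ℝ, Tendsto (fun ε : ℝ => B ((k : ℂ) + ε * I)) (𝓝[>] 0) (𝓝 (f k * (k + I))))
    {s : Set ℝ} (hs : MeasurableSet s) (hs0 : volume s ≠ 0) (hfs : ∀ k ∈ s, f k = 0)
    {z : ℂ} (hz : 0 < z.im) : B z = 0 := by
  set h : ℝ → ℝ := s.indicator fun x : ℝ => (1 + x ^ 2)⁻¹ with hh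
  have hint : Integrable h := integrable_weight s hs
  have hh0 : ∀ t, 0 ≤ h t := fun t => Set.indicator_nonneg (fun x _ => by positivity) t
  have hh1 : ∀ t, h t ≤ 1 := fun t => by
    refine Set.indicator_le_self' (fun x _ => by positivity) t |>.trans ?_
    exact inv_le_one_of_one_le₀ (by nlinarith [sq_nonneg t])
  have hci : CauchyIntegrable fun t => (h t : ℂ) := cauchyIntegrable_of_integrable (integrable_coe hint)
  set P : ℝ → ℝ → ℝ := fun x y => ∫ t, halfPlaneKernel x y t * h t with hP
  have hKint : ∀ x y : ℝ, 0 < y → Integrable fun t => halfPlaneKernel x y t * h t := fun x y hy =>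
    (integrable_halfPlaneKernel hy x).mul_bdd (c := 1) hint.1 (Eventually.of_forall fun t => by
      rw [Real.norm_of_nonneg (hh0 t)]; exact hh1 t)
  have hP1 : ∀ x y : ℝ, 0 < y → P x y ≤ 1 := fun x y hy => by
    rw [← integral_halfPlaneKernel hy x]
    refine integral_mono (hKint x y hy) (integrable_halfPlaneKernel hy x) fun t => ?_
    exact mul_le_of_le_one_right (halfPlaneKernel_pos hy x t).le (hh1 t)
  set x := z.re
  set y := z.im
  have hzxy : z = (x : ℂ) + y * I := exists_eq_add_mul_I
  have hPpos : 0 < P x y := by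
    rw [hP]
    simp only
    rw [integral_pos_iff_support_of_nonneg
      (fun t => mul_nonneg (halfPlaneKernel_pos hz x t).le (hh0 t)) (hKint x y hz)]
    refine lt_of_lt_of_le (pos_iff_ne_zero.2 hs0) (measure_mono fun t ht => ?_)
    simp only [Function.mem_support, hh, Set.indicator_of_mem ht]
    have := halfPlaneKernel_pos hz x t
    positivity
  -- u n is a bounded analytic function of modulus exp(n P), where P is the Poisson integral of the
  -- weight h. Its boundary modulus is 1 off s, while P > 0 inside because s has positive measure.
  set u : ℕ → ℂ → ℂ := fun n w =>
    exp (n * (cauchyTransform (fun t => (h t : ℂ)) w / (Real.pi * I))) with hu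
  have hunorm : ∀ n (x y : ℝ), 0 < y → ‖u n ((x : ℂ) + y * I)‖ = Real.exp (n * P x y) := by
    intro n x y hy
    simp only [hu]
    rw [norm_exp]
    congr 1
    have h1 := im_cauchyTransform_ofReal hci hy x
    have hpi := Real.pi_pos
    set w := cauchyTransform (fun t => (h t : ℂ)) ((x : ℂ) + y * I)
    have h2 : w / (Real.pi * I) = ((w.im / Real.pi : ℝ) : ℂ) + ((-(w.re / Real.pi) : ℝ) : ℂ) * I := by
      have hpi' : (Real.pi : ℂ) ≠ 0 := by exact_mod_cast hpi.ne'
      rw [div_eq_iff (mul_ne_zero hpi' I_ne_zero)]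
      conv_lhs => rw [← re_add_im w]
      push_cast
      field_simp
      ring_nf
      rw [I_sq]
      ring
    rw [h2, h1]
    simp only [hP]
    have : (n : ℂ) = ((n : ℝ) : ℂ) := by simp
    rw [this, re_ofReal_mul]
    simp
  have hubdd : ∀ n, BddAnalytic (u n) := by
    intro n
    refine ⟨fun w hw => ?_, Real.exp n, (Real.exp_pos _).le, fun w hw => ?_⟩
    · have h1 := hci.differentiableAt (ne_of_gt hw)
      exact (((h1.div_const _).const_mul _).cexp).differentiableWithinAt
    · have hw' : w = (w.re : ℂ) + (w.im : ℝ) * I := exists_eq_add_mul_I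
      rw [hw', hunorm n _ _ hw, Real.exp_le_exp]
      exact mul_le_of_le_one_right (Nat.cast_nonneg n) (hP1 _ _ hw)
  have hhlim := hci.ae_tendsto_poissonIntegral
  set A : ℝ := ∫ t, halfPlaneKernel x y t * ‖f t‖ with hA
  -- Multiplying B by u n changes no boundary modulus: off s the factor is unimodular, on s the
  -- boundary value of B is 0. The Poisson representation of B u n / (z + i) thus gives a bound A
  -- that is independent of n, while |u n| grows exponentially at z.
  have hbound : ∀ n : ℕ, ‖B z / (z + I)‖ * Real.exp (n * P x y) ≤ A := by
    intro n
    obtain ⟨g, hg, hgrep, hglim⟩ := (hB.mul (hubdd n)).exists_boundary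
    have hnorm : ∀ᵐ k : ℝ, ‖g k‖ = ‖f k‖ := by
      filter_upwards [hglim, hlim, hhlim] with k h1 h2 h3
      have h4 : Tendsto (fun ε : ℝ => ‖u n ((k : ℂ) + ε * I)‖) (𝓝[>] 0)
          (𝓝 (Real.exp (n * h k))) := by
        have h5 : Tendsto (fun ε : ℝ => P k ε) (𝓝[>] 0) (𝓝 (h k)) := by
          have := (continuous_re.tendsto _).comp h3
          refine this.congr fun ε => ?_
          simp only [Function.comp, poissonIntegral_ofReal, ofReal_re, hP]
        refine ((Real.continuous_exp.tendsto _).comp (h5.const_mul (n : ℝ))).congr'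
          (eventually_nhdsWithin_of_forall fun ε hε => (hunorm n k ε hε).symm)
      have h5 := h2.norm.mul h4
      have h6 := tendsto_nhds_unique h1.norm (by simpa only [norm_mul] using h5)
      have hkI : (k : ℂ) + I ≠ 0 := by
        intro h
        have := congrArg im h
        simp at this
      have hkI' : 0 < ‖(k : ℂ) + I‖ := norm_pos_iff.2 hkI
      by_cases hks : k ∈ s
      · rw [hfs k hks] at h6 ⊢
        simp only [norm_mul, norm_zero, zero_mul, mul_eq_zero] at h6
        rw [norm_zero]
        exact h6.resolve_right hkI'.ne'
      · rw [show h k = 0 from Set.indicator_of_notMem hks _, mul_zero, Real.exp_zero, mul_one] at h6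
        simp only [norm_mul] at h6
        exact mul_right_cancel₀ hkI'.ne' h6
    have h1 := hgrep z hz
    rw [hzxy, hg.cauchyTransform_eq hz x, ← hzxy] at h1
    have h2 := mul_left_cancel₀ two_pi_I_ne h1
    have h3 : ‖B z / (z + I)‖ * Real.exp (n * P x y) = ‖poissonIntegral g x y‖ := by
      rw [← h2, ← hunorm n x y hz, ← hzxy, ← norm_mul]
      congr 1
      ring
    rw [h3]
    exact norm_poissonIntegral_le hz hnorm
  have hle : ∀ n : ℕ, ‖B z / (z + I)‖ ≤ A * Real.exp (-(n * P x y)) := fun n => by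
    rw [Real.exp_neg, ← div_eq_mul_inv, le_div_iff₀ (Real.exp_pos _)]
    exact hbound n
  have hexp : Tendsto (fun n : ℕ => A * Real.exp (-(n * P x y))) atTop (𝓝 0) := by
    have h1 : Tendsto (fun n : ℕ => (n : ℝ) * P x y) atTop atTop :=
      tendsto_natCast_atTop_atTop.atTop_mul_const hPpos
    simpa using (Real.tendsto_exp_neg_atTop_nhds_zero.comp h1).const_mul A
  have h0 := ge_of_tendsto' hexp hle
  have h1 : B z / (z + I) = 0 := norm_le_zero_iff.1 h0
  exact (div_eq_zero_iff.1 h1).resolve_right (add_I_ne_zero hz)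

/-- Boundary values of a non-zero bounded analytic function are non-zero almost everywhere. -/
theorem BddAnalytic.ae_boundary {B : ℂ → ℂ} (hB : BddAnalytic B) :
    (∀ᵐ k : ℝ, ∃ l : ℂ, Tendsto (fun ε : ℝ => B ((k : ℂ) + ε * I)) (𝓝[>] 0) (𝓝 l)) ∧
    ((∃ z : ℂ, 0 < z.im ∧ B z ≠ 0) →
      ∀ᵐ k : ℝ, ∃ l : ℂ, l ≠ 0 ∧
        Tendsto (fun ε : ℝ => B ((k : ℂ) + ε * I)) (𝓝[>] 0) (𝓝 l)) := by
  obtain ⟨f, hf, -, hlim⟩ := hB.exists_boundary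
  refine ⟨hlim.mono fun k hk => ⟨_, hk⟩, ?_⟩
  rintro ⟨z, hz, hBz⟩
  have hf0 : ∀ᵐ k : ℝ, f k ≠ 0 := by
    by_contra hcon
    obtain ⟨f', hf', hff'⟩ := hf.1.1
    have hs : MeasurableSet {k | f' k = 0} := hf'.measurable (measurableSet_singleton 0)
    have hs0 : volume {k | f' k = 0} ≠ 0 := by
      intro h0
      refine hcon ?_
      have : ∀ᵐ k : ℝ, f' k ≠ 0 := by
        rw [ae_iff]; simpa using h0
      filter_upwards [this, hff'] with k h1 h2
      rwa [h2]
    refine hBz (hB.eq_zero_of_boundary ?_ hs hs0 (fun k hk => hk) hz)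
    filter_upwards [hlim, hff'] with k h1 h2
    rwa [← h2]
  filter_upwards [hlim, hf0] with k h1 h2
  refine ⟨_, mul_ne_zero h2 fun h => ?_, h1⟩
  have := congrArg im h
  simp at this

/-- Quotients of bounded analytic functions in the upper half-plane, with zero-free denominator. -/
def BoundedType (F : ℂ → ℂ) : Prop :=
  ∃ p q : ℂ → ℂ, BddAnalytic p ∧ BddAnalytic q ∧ ∀ z : ℂ, 0 < z.im → q z ≠ 0 ∧ F z = p z / q z

theorem BoundedType.congr {F G : ℂ → ℂ} (hF : BoundedType F)
    (h : ∀ z : ℂ, 0 < z.im → F z = G z) : BoundedType G := by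
  obtain ⟨p, q, hp, hq, hpq⟩ := hF
  exact ⟨p, q, hp, hq, fun z hz => ⟨(hpq z hz).1, by rw [← h z hz, (hpq z hz).2]⟩⟩

theorem BoundedType.const (c : ℂ) : BoundedType fun _ => c :=
  ⟨fun _ => c, fun _ => 1, .const c, .const 1, fun z _ => ⟨one_ne_zero, by simp⟩⟩

theorem BoundedType.mul {F G : ℂ → ℂ} (hF : BoundedType F) (hG : BoundedType G) :
    BoundedType fun z => F z * G z := by
  obtain ⟨p, q, hp, hq, h1⟩ := hF
  obtain ⟨r, s, hr, hs, h2⟩ := hG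
  refine ⟨_, _, hp.mul hr, hq.mul hs, fun z hz => ⟨mul_ne_zero (h1 z hz).1 (h2 z hz).1, ?_⟩⟩
  simp only
  rw [(h1 z hz).2, (h2 z hz).2, div_mul_div_comm]

theorem BoundedType.add {F G : ℂ → ℂ} (hF : BoundedType F) (hG : BoundedType G) :
    BoundedType fun z => F z + G z := by
  obtain ⟨p, q, hp, hq, h1⟩ := hF
  obtain ⟨r, s, hr, hs, h2⟩ := hG
  refine ⟨_, _, (hp.mul hs).add (hq.mul hr), hq.mul hs,
    fun z hz => ⟨mul_ne_zero (h1 z hz).1 (h2 z hz).1, ?_⟩⟩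
  simp only
  rw [(h1 z hz).2, (h2 z hz).2, div_add_div _ _ (h1 z hz).1 (h2 z hz).1]

theorem BoundedType.sub {F G : ℂ → ℂ} (hF : BoundedType F) (hG : BoundedType G) :
    BoundedType fun z => F z - G z :=
  (hF.add ((BoundedType.const (-1)).mul hG)).congr fun z _ => by ring

theorem BoundedType.ae_boundary {F : ℂ → ℂ} (hF : BoundedType F) :
    (∀ᵐ k : ℝ, ∃ l : ℂ, Tendsto (fun ε : ℝ => F ((k : ℂ) + ε * I)) (𝓝[>] 0) (𝓝 l)) ∧
    ((∃ z : ℂ, 0 < z.im ∧ F z ≠ 0) →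
      ∀ᵐ k : ℝ, ∃ l : ℂ, l ≠ 0 ∧
        Tendsto (fun ε : ℝ => F ((k : ℂ) + ε * I)) (𝓝[>] 0) (𝓝 l)) := by
  obtain ⟨p, q, hp, hq, hpq⟩ := hF
  have hq0 := hq.ae_boundary.2 ⟨I, by simp, (hpq I (by simp)).1⟩
  have hFpq : ∀ k : ℝ, ∀ᶠ ε : ℝ in 𝓝[>] 0,
      p ((k : ℂ) + ε * I) / q ((k : ℂ) + ε * I) = F ((k : ℂ) + ε * I) := fun k =>
    eventually_nhdsWithin_of_forall fun ε hε => (hpq _ (by simpa using hε)).2.symm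
  constructor
  · filter_upwards [hp.ae_boundary.1, hq0] with k ⟨a, ha⟩ ⟨b, hb0, hb⟩
    exact ⟨a / b, (ha.div hb hb0).congr' (hFpq k)⟩
  · rintro ⟨z, hz, hFz⟩
    have hpz : p z ≠ 0 := fun h => hFz (by rw [(hpq z hz).2, h, zero_div])
    filter_upwards [hp.ae_boundary.2 ⟨z, hz, hpz⟩, hq0] with k ⟨a, ha0, ha⟩ ⟨b, hb0, hb⟩
    exact ⟨a / b, div_ne_zero ha0 hb0, (ha.div hb hb0).congr' (hFpq k)⟩

/-- A function of bounded type with vanishing boundary values is zero. -/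
theorem BoundedType.eq_zero {F : ℂ → ℂ} (hF : BoundedType F)
    (h : ∀ᵐ k : ℝ, Tendsto (fun ε : ℝ => F ((k : ℂ) + ε * I)) (𝓝[>] 0) (𝓝 0))
    {z : ℂ} (hz : 0 < z.im) : F z = 0 := by
  by_contra hne
  obtain ⟨k, ⟨l, hl0, hl⟩, hk⟩ := ((hF.ae_boundary.2 ⟨z, hz, hne⟩).and h).exists
  exact hl0 (tendsto_nhds_unique hl hk)

/-- The transform F of a non-negative function has non-negative imaginary part above the line, so |F
+ i| ≥ 1 there. Then q = 1/(F + i) is bounded, and F = (1 - iq)/q. -/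
theorem boundedType_cauchyTransform_nonneg {h : ℝ → ℝ} (hh : CauchyIntegrable fun t => (h t : ℂ))
    (h0 : ∀ t, 0 ≤ h t) : BoundedType (cauchyTransform fun t => (h t : ℂ)) := by
  set F := cauchyTransform fun t => (h t : ℂ) with hF
  have him : ∀ z : ℂ, 0 < z.im → 0 ≤ (F z).im := by
    intro z hz
    have hw : z = (z.re : ℂ) + (z.im : ℝ) * I := exists_eq_add_mul_I
    rw [hw, hF, im_cauchyTransform_ofReal hh hz]
    exact mul_nonneg Real.pi_pos.le
      (integral_nonneg fun t => mul_nonneg (halfPlaneKernel_pos hz _ t).le (h0 t))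
  have him1 : ∀ z : ℂ, 0 < z.im → 1 ≤ ‖F z + I‖ := by
    intro z hz
    refine le_trans ?_ (abs_im_le_norm _)
    rw [add_im, I_im]
    exact le_trans (by linarith [him z hz]) (le_abs_self _)
  have hne : ∀ z : ℂ, 0 < z.im → F z + I ≠ 0 := fun z hz h => by
    have := him1 z hz
    rw [h, norm_zero] at this
    linarith
  have hq : BddAnalytic fun z => 1 / (F z + I) := by
    refine ⟨(differentiableOn_const _).div (fun z hz =>
      ((hh.differentiableAt (ne_of_gt hz)).add_const I).differentiableWithinAt) hne, 1,
      zero_le_one, fun z hz => ?_⟩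
    rw [norm_div, norm_one]
    exact div_le_one_of_le₀ (him1 z hz) (norm_nonneg _)
  refine ⟨_, _, (BddAnalytic.const 1).add ((BddAnalytic.const (-I)).mul hq), hq,
    fun z hz => ⟨one_div_ne_zero (hne z hz), ?_⟩⟩
  have := hne z hz
  field_simp
  ring

/-- Cauchy transforms are of bounded type. -/
theorem CauchyIntegrable.boundedType {f : ℝ → ℂ} (hf : CauchyIntegrable f) :
    BoundedType (cauchyTransform f) := by
  have hm := hf.aestronglyMeasurable
  -- L will be ±Re and ±Im. The four positive parts are dominated by |f|, and f is recovered from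
  -- them as a linear combination.
  have key : ∀ L : ℂ → ℝ, Continuous L → (∀ w, |L w| ≤ ‖w‖) →
      CauchyIntegrable (fun t => ((max (L (f t)) 0 : ℝ) : ℂ)) := by
    intro L hL hL'
    refine hf.mono ?_ fun x => ?_
    · exact (continuous_ofReal.comp (hL.max continuous_const)).comp_aestronglyMeasurable hm
    · rw [norm_real, Real.norm_of_nonneg (le_max_right _ _)]
      exact max_le ((le_abs_self _).trans (hL' _)) (norm_nonneg _)
  have h1 := key re continuous_re abs_re_le_norm
  have h2 := key (fun w => -re w) continuous_re.neg (fun w => by rw [abs_neg]; exact abs_re_le_norm w)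
  have h3 := key im continuous_im abs_im_le_norm
  have h4 := key (fun w => -im w) continuous_im.neg (fun w => by rw [abs_neg]; exact abs_im_le_norm w)
  have b1 := boundedType_cauchyTransform_nonneg h1 fun t => le_max_right _ _
  have b2 := boundedType_cauchyTransform_nonneg h2 fun t => le_max_right _ _
  have b3 := boundedType_cauchyTransform_nonneg h3 fun t => le_max_right _ _
  have b4 := boundedType_cauchyTransform_nonneg h4 fun t => le_max_right _ _
  refine ((b1.sub b2).add ((BoundedType.const I).mul (b3.sub b4))).congr fun z hz => ?_
  rw [← cauchyTransform_sub h1 h2 hz.ne', ← cauchyTransform_sub h3 h4 hz.ne',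
    ← cauchyTransform_const_mul, ← cauchyTransform_add (h1.sub h2) ((h3.sub h4).const_mul I) hz.ne']
  congr 1
  ext t
  have hmax : ∀ a : ℝ, max a 0 - max (-a) 0 = a := fun a => by
    rcases le_total 0 a with h | h
    · rw [max_eq_left h, max_eq_right (by linarith), sub_zero]
    · rw [max_eq_right h, max_eq_left (by linarith)]; ring
  simp only [Pi.add_apply, Pi.sub_apply, ← ofReal_sub, hmax]
  rw [mul_comm, re_add_im]

/-! ### The minimal operator, its adjoint and the extensions in explicit form -/

theorem mulX_coe (f : minimalDomain) :
    (mulX f : ℝ → ℂ) =ᵐ[volume] fun x => (x : ℂ) * (f : L2) x := f.2.1.coeFn_toLp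

/-- A step function of mean zero attached to a bounded set. -/
noncomputable def testFun (K : Set ℝ) (x : ℝ) : ℂ :=
  K.indicator (fun _ => (1 : ℂ)) x - (volume.real K : ℂ) * (Set.Icc (0 : ℝ) 1).indicator (fun _ => (1 : ℂ)) x

theorem memLp_indicator_one {K : Set ℝ} (hK : IsCompact K) (p : ENNReal) :
    MemLp (K.indicator fun _ => (1 : ℂ)) p volume :=
  memLp_indicator_const p hK.measurableSet 1 (Or.inr hK.measure_lt_top.ne)

theorem memLp_testFun {K : Set ℝ} (hK : IsCompact K) (p : ENNReal) : MemLp (testFun K) p volume :=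
  (memLp_indicator_one hK p).sub ((memLp_indicator_one isCompact_Icc p).const_mul _)

/-- Bounded support and mean zero suffice for membership in the minimal domain. -/
theorem toLp_mem_minimalDomain {f : ℝ → ℂ} (hf : MemLp f 2 volume) {M : ℝ} (hM : 0 ≤ M)
    (hsupp : ∀ x, M < |x| → f x = 0) (h1 : Integrable f) (h0 : ∫ x, f x = 0) :
    hf.toLp f ∈ minimalDomain := by
  constructor
  · have h2 : MemLp (fun x : ℝ => (x : ℂ) * f x) 2 volume := by
      refine (hf.const_mul (M : ℂ)).of_le
        ((measurable_ofReal.aestronglyMeasurable).mul hf.1) (Eventually.of_forall fun x => ?_)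
      rw [norm_mul, norm_mul, norm_real, norm_real, Real.norm_eq_abs, Real.norm_of_nonneg hM]
      rcases le_or_gt |x| M with h | h
      · exact mul_le_mul_of_nonneg_right h (norm_nonneg _)
      · rw [hsupp x h]; simp
    refine (memLp_congr_ae ?_).1 h2
    filter_upwards [hf.coeFn_toLp] with x hx
    rw [hx]
  · have h3 : ∀ R : ℝ, ∫ x in (-R)..R, (hf.toLp f : L2) x = ∫ x in (-R)..R, f x := fun R =>
      intervalIntegral.integral_congr_ae (by filter_upwards [hf.coeFn_toLp] with x hx _ using hx)
    simp_rw [h3]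
    rw [← h0]
    exact intervalIntegral_tendsto_integral h1 tendsto_neg_atTop_atBot tendsto_id

theorem testFun_mem {K : Set ℝ} (hK : IsCompact K) :
    (memLp_testFun hK 2).toLp _ ∈ minimalDomain := by
  obtain ⟨M, hM⟩ := hK.isBounded.exists_norm_le
  refine toLp_mem_minimalDomain _ (M := max M 1) (zero_le_one.trans (le_max_right _ _)) ?_
    (memLp_one_iff_integrable.1 (memLp_testFun hK 1)) ?_
  · intro x hx
    have h1 : x ∉ K := fun h => by
      have := hM x h
      rw [Real.norm_eq_abs] at this
      exact absurd (this.trans (le_max_left _ _)) (not_le.2 hx)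
    have h2 : x ∉ Set.Icc (0 : ℝ) 1 := fun h => by
      have : |x| ≤ 1 := by rw [abs_of_nonneg h.1]; exact h.2
      exact absurd (this.trans (le_max_right _ _)) (not_le.2 hx)
    simp [testFun, h1, h2]
  · unfold testFun
    rw [integral_sub (memLp_one_iff_integrable.1 (memLp_indicator_one hK 1))
      ((memLp_one_iff_integrable.1 (memLp_indicator_one isCompact_Icc 1)).const_mul _),
      integral_const_mul, integral_indicator_const _ hK.measurableSet,
      integral_indicator_const _ measurableSet_Icc]
    simp

/-- The condition says that the integral of h over K is |K| times c, where c is the mean of h on [0,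
1]; so h - c integrates to zero over every compact set. -/
theorem ae_eq_const_of_testFun {h : ℝ → ℂ} (hh : LocallyIntegrable h volume)
    (H : ∀ K : Set ℝ, IsCompact K → ∫ x, h x * testFun K x = 0) :
    ∃ c : ℂ, h =ᵐ[volume] fun _ => c := by
  set c := ∫ x in Set.Icc (0 : ℝ) 1, h x with hc
  refine ⟨c, ?_⟩
  have h1 : (fun x => h x - c) =ᵐ[volume] 0 := by
    refine ae_eq_zero_of_forall_setIntegral_isCompact_eq_zero'
      (hh.sub (locallyIntegrable_const c)) fun K hK => ?_
    have hK1 : IntegrableOn h K := hh.integrableOn_isCompact hK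
    have hI1 : IntegrableOn h (Set.Icc 0 1) := hh.integrableOn_isCompact isCompact_Icc
    have h2 := H K hK
    have h3 : ∀ x, h x * testFun K x = K.indicator h x
        - (volume.real K : ℂ) * (Set.Icc (0 : ℝ) 1).indicator h x := fun x => by
      have key : ∀ s : Set ℝ, h x * s.indicator (fun _ => (1 : ℂ)) x = s.indicator h x := fun s => by
        by_cases hx : x ∈ s <;> simp [hx]
      rw [testFun, mul_sub, key, ← key (Set.Icc 0 1)]
      ring
    simp_rw [h3] at h2
    rw [integral_sub ((integrable_indicator_iff hK.measurableSet).2 hK1)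
      (((integrable_indicator_iff measurableSet_Icc).2 hI1).const_mul _), integral_const_mul,
      integral_indicator hK.measurableSet, integral_indicator measurableSet_Icc, ← hc] at h2
    have hcK : IntegrableOn (fun _ : ℝ => c) K := (locallyIntegrable_const c).integrableOn_isCompact hK
    rw [integral_sub hK1 hcK, setIntegral_const, real_smul]
    exact h2
  filter_upwards [h1] with x hx
  exact sub_eq_zero.1 hx

theorem memLp_const_eq_zero {c : ℂ} (h : MemLp (fun _ : ℝ => c) 2 volume) : c = 0 := by
  rw [memLp_const_iff two_ne_zero ENNReal.ofNat_ne_top] at h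
  rcases h with h | h
  · exact h
  · simp at h

/-- The adjoint relation for multiplication by the variable on the minimal domain. -/
theorem exists_const_of_inner_mulX {u w : L2}
    (H : ∀ f : minimalDomain, inner ℂ w (f : L2) = inner ℂ u (mulX f)) :
    ∃ c : ℂ, (w : ℝ → ℂ) =ᵐ[volume] fun x => (x : ℂ) * u x - c := by
  have hlu : LocallyIntegrable (u : ℝ → ℂ) volume := (Lp.memLp u).locallyIntegrable (by norm_num)
  have hlw : LocallyIntegrable (w : ℝ → ℂ) volume := (Lp.memLp w).locallyIntegrable (by norm_num)
  have hl : LocallyIntegrable (fun x : ℝ => (x : ℂ) * u x - w x) volume := by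
    rw [locallyIntegrable_iff]
    intro K hK
    exact ((hlu.integrableOn_isCompact hK).continuousOn_mul (by fun_prop) hK).sub
      (hlw.integrableOn_isCompact hK)
  have hconj : LocallyIntegrable (conjFun fun x : ℝ => (x : ℂ) * u x - w x) volume := by
    rw [locallyIntegrable_iff] at hl ⊢
    intro K hK
    exact (hl K hK).norm.mono' (continuous_conj.comp_aestronglyMeasurable (hl K hK).1)
      (Eventually.of_forall fun x => (Complex.norm_conj _).le)
  -- The conjugate of xu - w annihilates all mean-zero step functions, so it is constant.
  obtain ⟨c, hc⟩ := ae_eq_const_of_testFun hconj fun K hK => by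
    have hm := testFun_mem hK
    have h1 := H ⟨_, hm⟩
    rw [inner_L2_eq, inner_L2_eq, ← sub_eq_zero] at h1
    have hint1 : ∀ a b : L2, Integrable (fun x => (starRingEnd ℂ) (a x) * b x) := fun a b =>
      integrable_mul_of_memLp_two (memLp_conjFun (Lp.memLp a)) (Lp.memLp b)
    rw [← integral_sub (hint1 _ _) (hint1 _ _)] at h1
    rw [← neg_eq_zero, ← integral_neg, ← h1]
    refine integral_congr_ae ?_
    filter_upwards [mulX_coe ⟨_, hm⟩, (memLp_testFun hK 2).coeFn_toLp] with x h2 h3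
    simp only [h2, h3, conjFun, map_sub, map_mul, conj_ofReal]
    ring
  refine ⟨(starRingEnd ℂ) c, ?_⟩
  filter_upwards [hc] with x hx
  rw [← hx]
  simp [conjFun]

/-- The adjoint relation with u = 0: a vector orthogonal to the domain is a.e. constant, and the
only constant in L² is zero. -/
theorem dense_minimalDomain : Dense (minimalDomain : Set L2) := by
  rw [Submodule.dense_iff_topologicalClosure_eq_top, Submodule.topologicalClosure_eq_top_iff,
    Submodule.eq_bot_iff]
  intro w hw
  obtain ⟨c, hc⟩ := exists_const_of_inner_mulX (u := 0) (w := w) fun f => by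
    rw [inner_zero_left]
    exact Submodule.inner_left_of_mem_orthogonal f.2 hw
  have hc' : (w : ℝ → ℂ) =ᵐ[volume] fun _ => -c := by
    filter_upwards [hc, Lp.coeFn_zero ℂ 2 (volume : Measure ℝ)] with x h1 h2
    rw [h1, h2]; simp
  have h0 := memLp_const_eq_zero ((memLp_congr_ae hc').1 (Lp.memLp w))
  rw [Lp.eq_zero_iff_ae_eq_zero]
  filter_upwards [hc'] with x hx
  rw [hx, h0]; rfl

/-- The two integrands differ by a multiple of f, whose integrals over [-R, R] tend to zero by the
boundary condition in `minimalDomain`. -/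
theorem inner_eq_inner_mulX {u w : L2} {c : ℂ}
    (h : (w : ℝ → ℂ) =ᵐ[volume] fun x => (x : ℂ) * u x - c) (f : minimalDomain) :
    inner ℂ w (f : L2) = inner ℂ u (mulX f) := by
  have hint1 : ∀ a b : L2, Integrable (fun x => (starRingEnd ℂ) (a x) * b x) := fun a b =>
    integrable_mul_of_memLp_two (memLp_conjFun (Lp.memLp a)) (Lp.memLp b)
  have hint := (hint1 w f).sub (hint1 u (mulX f))
  have hae : (fun x => (starRingEnd ℂ) (w x) * (f : L2) x - (starRingEnd ℂ) (u x) * mulX f x)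
      =ᵐ[volume] fun x => -(starRingEnd ℂ) c * (f : L2) x := by
    filter_upwards [h, mulX_coe f] with x h1 h2
    rw [h1, h2]
    simp only [map_sub, map_mul, conj_ofReal]
    ring
  have hlim := intervalIntegral_tendsto_integral hint tendsto_neg_atTop_atBot tendsto_id
  have hlim2 := (f.2.2).const_mul (-(starRingEnd ℂ) c)
  rw [mul_zero] at hlim2
  have h0 := tendsto_nhds_unique hlim (hlim2.congr fun R => by
    rw [← intervalIntegral.integral_const_mul]
    exact (intervalIntegral.integral_congr_ae (by filter_upwards [hae] with x hx _ using hx)).symm)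
  rw [integral_sub' (hint1 w f) (hint1 u (mulX f))] at h0
  rw [inner_L2_eq, inner_L2_eq]
  exact sub_eq_zero.1 h0

/-- Explicit description of the maximal operator. -/
theorem maximalOp_iff (φ ψ u v : L2) :
    (∃ h : u ∈ (maximalOp φ ψ).domain, maximalOp φ ψ ⟨u, h⟩ = v) ↔
      ∃ c : ℂ, (v : ℝ → ℂ) =ᵐ[volume]
        fun x => (x : ℂ) * u x - c + inner ℂ φ u * ψ x := by
  have hcoe : (((v - inner ℂ φ u • ψ : L2)) : ℝ → ℂ) =ᵐ[volume]
      fun x => v x - inner ℂ φ u * ψ x := by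
    filter_upwards [Lp.coeFn_sub v (inner ℂ φ u • ψ), Lp.coeFn_smul (inner ℂ φ u) ψ] with x h1 h2
    rw [h1, Pi.sub_apply, h2]; rfl
  have hd : Dense ((minimalOp ψ φ).domain : Set L2) := dense_minimalDomain
  have hin : ∀ f : minimalDomain, inner ℂ (v - inner ℂ φ u • ψ) (f : L2)
      = inner ℂ v (f : L2) - inner ℂ u φ * inner ℂ ψ (f : L2) := fun f => by
    rw [inner_sub_left, inner_smul_left, inner_conj_symm]
  have hT : ∀ (f : L2) (hf : f ∈ minimalDomain), inner ℂ u (minimalOp ψ φ ⟨f, hf⟩)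
      = inner ℂ u (mulX ⟨f, hf⟩) + inner ℂ u φ * inner ℂ ψ f := fun f hf => by
    change inner ℂ u (mulX ⟨f, hf⟩ + inner ℂ ψ f • φ) = _
    rw [inner_add_right, inner_smul_right, mul_comm]
  constructor
  · rintro ⟨h, hv⟩
    -- Moving the rank-one term to the side of v reduces the adjoint relation to the one for
    -- multiplication by x.
    obtain ⟨c, hc⟩ := exists_const_of_inner_mulX (u := u) (w := v - inner ℂ φ u • ψ)
      fun ⟨f, hf⟩ => by
      have h1 := LinearPMap.adjoint_isFormalAdjoint hd ⟨u, h⟩ ⟨f, hf⟩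
      change inner ℂ (maximalOp φ ψ ⟨u, h⟩) _ = _ at h1
      rw [hv, hT] at h1
      rw [hin]
      simp only at h1 ⊢
      linear_combination h1
    refine ⟨c, ?_⟩
    filter_upwards [hc, hcoe] with x h1 h2
    rw [h1] at h2
    linear_combination -h2
  · rintro ⟨c, hc⟩
    have key : ∀ f : (minimalOp ψ φ).domain, inner ℂ v (f : L2) = inner ℂ u (minimalOp ψ φ f) := by
      rintro ⟨f, hf⟩
      have h1 := inner_eq_inner_mulX (u := u) (w := v - inner ℂ φ u • ψ) (c := c) (by
        filter_upwards [hc, hcoe] with x h1 h2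
        rw [h2, h1]; ring) ⟨f, hf⟩
      rw [hin] at h1
      refine Eq.trans ?_ (hT f hf).symm
      simp only at h1 ⊢
      linear_combination h1
    exact ⟨LinearPMap.mem_adjoint_domain_of_exists _ ⟨v, key⟩,
      LinearPMap.adjoint_apply_eq hd _ key⟩

theorem extensionOp_iff (φ ψ u v : L2) (B : ℂ) :
    (∃ h : u ∈ (extensionOp φ ψ B).domain, extensionOp φ ψ B ⟨u, h⟩ = v) ↔
      u ∈ boundaryCondition B ∧ ∃ c : ℂ, (v : ℝ → ℂ) =ᵐ[volume]
        fun x => (x : ℂ) * u x - c + inner ℂ φ u * ψ x := by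
  rw [← maximalOp_iff]
  constructor
  · rintro ⟨h, hv⟩
    exact ⟨h.1, h.2, hv⟩
  · rintro ⟨h1, h2, hv⟩
    exact ⟨⟨h1, h2⟩, hv⟩

/-! ### Kernels and resolvents -/

theorem cauchyIntegrable_mul_conj {f g : ℝ → ℂ} (hf : MemLp f 2 volume) (hg : MemLp g 2 volume) :
    CauchyIntegrable (f * conjFun g) :=
  cauchyIntegrable_of_integrable (integrable_mul_of_memLp_two hf (memLp_conjFun hg))

theorem perturbDet_eq (φ ψ : L2) (z : ℂ) :
    perturbDet φ ψ z = 1 + cauchyTransform (ψ * conjFun φ) z := by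
  unfold perturbDet cauchyTransform
  congr 2 with x
  simp only [Pi.mul_apply]
  ring

theorem cauchyIntegrable_L2 (f : L2) : CauchyIntegrable f := cauchyIntegrable_of_memLp (Lp.memLp f)

/-- The ansatz (h + c - αψ)/(x - z) covers both uses: h = 0 gives the vectors of the kernel of Ã* -
z, h = g the resolvent applied to g. -/
theorem inner_resolvent {u ψ : L2} {h : ℝ → ℂ} (hh : MemLp h 2 volume) {z : ℂ} (hz : z.im ≠ 0)
    {c α : ℂ} (hu : (u : ℝ → ℂ) =ᵐ[volume] fun x => (h x + c - α * ψ x) / ((x : ℂ) - z)) (w : L2) :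
    inner ℂ w u = cauchyTransform (h * conjFun w) z + c * cauchyTransform (conjFun w) z
      - α * cauchyTransform (ψ * conjFun w) z := by
  have i1 := (cauchyIntegrable_mul_conj hh (Lp.memLp w)).integrable hz
  have i2 := ((cauchyIntegrable_of_memLp (memLp_conjFun (Lp.memLp w))).integrable hz).const_mul c
  have i3 := ((cauchyIntegrable_mul_conj (Lp.memLp ψ) (Lp.memLp w)).integrable hz).const_mul α
  have i12 : Integrable (fun x : ℝ => (h * conjFun w) x / ((x : ℂ) - z)
      + c * (conjFun w x / ((x : ℂ) - z))) := i1.add i2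
  rw [inner_L2_eq]
  unfold cauchyTransform
  rw [← integral_const_mul, ← integral_const_mul, ← integral_add i1 i2,
    ← integral_sub i12 i3]
  refine integral_congr_ae ?_
  filter_upwards [hu] with x hx
  rw [hx]
  simp only [Pi.mul_apply, conjFun]
  ring

/-- Over a symmetric interval only the even part of the Cauchy kernel counts. It equals z/((x - z)(x
+ z)), a multiple of a product of two square integrable kernels, and is therefore integrable. -/
theorem exists_tendsto_integral_inv_sub {z : ℂ} (hz : z.im ≠ 0) :
    ∃ m : ℂ, Tendsto (fun R : ℝ => ∫ x in (-R)..R, 1 / ((x : ℂ) - z)) atTop (𝓝 m) := by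
  have hz' : (-z).im ≠ 0 := by simpa using hz
  have hint := (integrable_mul_of_memLp_two (memLp_inv_sub hz) (memLp_inv_sub hz')).const_mul z
  refine ⟨_, (intervalIntegral_tendsto_integral hint tendsto_neg_atTop_atBot tendsto_id).congr
    fun R => ?_⟩
  have hii : ∀ (w : ℂ), w.im ≠ 0 → ∀ a b : ℝ,
      IntervalIntegrable (fun x : ℝ => 1 / ((x : ℂ) - w)) volume a b := fun w hw a b => by
    refine Continuous.intervalIntegrable ?_ a b
    exact continuous_const.div (by fun_prop) fun x => ofReal_sub_ne_zero hw x
  have h1 : ∫ x in (-R)..R, 1 / ((x : ℂ) - z) = -∫ x in (-R)..R, 1 / ((x : ℂ) - -z) := by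
    have := intervalIntegral.integral_comp_neg (a := -R) (b := R) (fun x : ℝ => 1 / ((x : ℂ) - z))
    rw [neg_neg] at this
    rw [← this, ← intervalIntegral.integral_neg]
    congr 1 with x
    push_cast
    rw [← neg_add', one_div, one_div, ← inv_neg, sub_neg_eq_add]
  have h2 : ∫ x in (-R)..R, z * (1 / ((x : ℂ) - z) * (1 / ((x : ℂ) - -z)))
      = (1 / 2) * ((∫ x in (-R)..R, 1 / ((x : ℂ) - z)) - ∫ x in (-R)..R, 1 / ((x : ℂ) - -z)) := by
    rw [← intervalIntegral.integral_sub (hii z hz _ _) (hii _ hz' _ _),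
      ← intervalIntegral.integral_const_mul]
    congr 1 with x
    have h3 := ofReal_sub_ne_zero hz x
    have h4 := ofReal_sub_ne_zero hz' x
    field_simp
    ring
  change ∫ x in (-R)..R, z * (1 / ((x : ℂ) - z) * (1 / ((x : ℂ) - -z))) = _
  rw [h2]
  linear_combination (-1 / 2 : ℂ) * h1

theorem tendsto_integral_resolvent {u ψ : L2} {h : ℝ → ℂ} (hh : MemLp h 2 volume) {z : ℂ}
    (hz : z.im ≠ 0) {c α m : ℂ}
    (hm : Tendsto (fun R : ℝ => ∫ x in (-R)..R, 1 / ((x : ℂ) - z)) atTop (𝓝 m))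
    (hu : (u : ℝ → ℂ) =ᵐ[volume] fun x => (h x + c - α * ψ x) / ((x : ℂ) - z)) :
    Tendsto (fun R : ℝ => ∫ x in (-R)..R, u x) atTop
      (𝓝 (cauchyTransform h z + c * m - α * cauchyTransform ψ z)) := by
  have i1 := (cauchyIntegrable_of_memLp hh).integrable hz
  have i3 := (cauchyIntegrable_L2 ψ).integrable hz
  have l1 := intervalIntegral_tendsto_integral i1 tendsto_neg_atTop_atBot tendsto_id
  have l3 := intervalIntegral_tendsto_integral i3 tendsto_neg_atTop_atBot tendsto_id
  refine ((l1.add (hm.const_mul c)).sub (l3.const_mul α)).congr fun R => ?_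
  have hii : IntervalIntegrable (fun x : ℝ => 1 / ((x : ℂ) - z)) volume (-R) R := by
    refine Continuous.intervalIntegrable ?_ _ _
    exact continuous_const.div (by fun_prop) fun x => ofReal_sub_ne_zero hz x
  rw [← intervalIntegral.integral_const_mul, ← intervalIntegral.integral_const_mul]
  simp only [id]
  rw [← intervalIntegral.integral_add i1.intervalIntegrable (hii.const_mul c),
    ← intervalIntegral.integral_sub (i1.intervalIntegrable.add (hii.const_mul c))
      (i3.intervalIntegrable.const_mul α)]
  refine intervalIntegral.integral_congr_ae ?_
  filter_upwards [hu] with x hx _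
  rw [hx]
  ring

theorem memLp_resolvent {ψ : L2} {h : ℝ → ℂ} (hh : MemLp h 2 volume) {z : ℂ} (hz : z.im ≠ 0)
    (c α : ℂ) : MemLp (fun x : ℝ => (h x + c - α * ψ x) / ((x : ℂ) - z)) 2 volume := by
  have h1 := memLp_div_sub hh hz
  have h2 := (memLp_inv_sub hz).const_mul c
  have h3 := (memLp_div_sub (Lp.memLp ψ) hz).const_mul α
  refine (memLp_congr_ae (Eventually.of_forall fun x => ?_)).1 ((h1.add h2).sub h3)
  simp only [Pi.sub_apply, Pi.add_apply]
  ring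

theorem resolvent_eq_iff {z : ℂ} (hz : z.im ≠ 0) (x : ℝ) (u h c a : ℂ) :
    u = (h + c - a) / ((x : ℂ) - z) ↔ z * u + h = (x : ℂ) * u - c + a := by
  rw [eq_div_iff (ofReal_sub_ne_zero hz x)]
  constructor <;> intro h <;> linear_combination -h

theorem memLp_of_eq {u v ψ : L2} {c a : ℂ}
    (h : (v : ℝ → ℂ) =ᵐ[volume] fun x => (x : ℂ) * u x - c + a * ψ x) :
    MemLp (fun x : ℝ => (x : ℂ) * u x - c) 2 volume := by
  refine (memLp_congr_ae ?_).1 ((Lp.memLp v).sub ((Lp.memLp ψ).const_mul a))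
  filter_upwards [h] with x hx
  simp only [Pi.sub_apply, hx]
  ring

theorem trace_const_unique {u : L2} {c d : ℂ}
    (h1 : MemLp (fun x : ℝ => (x : ℂ) * u x - c) 2 volume)
    (h2 : MemLp (fun x : ℝ => (x : ℂ) * u x - d) 2 volume) : c = d := by
  have h3 := memLp_const_eq_zero (c := d - c) ((memLp_congr_ae (Eventually.of_forall fun x => by
    simp only [Pi.sub_apply]; ring)).1 (h1.sub h2))
  exact (sub_eq_zero.1 h3).symm

theorem mem_kerSub_iff (φ ψ u : L2) {z : ℂ} (hz : z.im ≠ 0) :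
    u ∈ kerSub (maximalOp φ ψ) z ↔ ∃ c : ℂ, (u : ℝ → ℂ) =ᵐ[volume]
      fun x => (0 + c - inner ℂ φ u * ψ x) / ((x : ℂ) - z) := by
  change (∃ h : u ∈ (maximalOp φ ψ).domain, maximalOp φ ψ ⟨u, h⟩ = z • u) ↔ _
  rw [maximalOp_iff]
  refine exists_congr fun c => ?_
  constructor <;> intro h
  · filter_upwards [h, Lp.coeFn_smul z u] with x h1 h2
    rw [resolvent_eq_iff hz, ← h1, h2, add_zero]; rfl
  · filter_upwards [h, Lp.coeFn_smul z u] with x h1 h2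
    rw [resolvent_eq_iff hz, add_zero] at h1
    rw [h2, ← h1]; rfl

theorem cauchyTransform_zero_mul (f : ℝ → ℂ) (z : ℂ) :
    cauchyTransform ((fun _ => (0 : ℂ)) * f) z = 0 := by
  simp [cauchyTransform]

theorem memLp_zero_fun : MemLp (fun _ : ℝ => (0 : ℂ)) 2 volume := MemLp.zero

theorem inner_kerSub {φ ψ u : L2} {z : ℂ} (hz : z.im ≠ 0) {c α : ℂ}
    (hu : (u : ℝ → ℂ) =ᵐ[volume] fun x => (0 + c - α * ψ x) / ((x : ℂ) - z)) :
    inner ℂ φ u = c * cauchyTransform (conjFun φ) z - α * cauchyTransform (ψ * conjFun φ) z := by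
  rw [inner_resolvent memLp_zero_fun hz hu, cauchyTransform_zero_mul, zero_add]

/-- The condition on c and α is exactly the self-consistency requirement that the coefficient α of ψ
be the inner product of the resulting vector with φ. -/
theorem exists_mem_kerSub (φ ψ : L2) {z : ℂ} (hz : z.im ≠ 0) {c α : ℂ}
    (h : α * perturbDet φ ψ z = c * cauchyTransform (conjFun φ) z) :
    ∃ u : L2, u ∈ kerSub (maximalOp φ ψ) z ∧ inner ℂ φ u = α ∧
      (u : ℝ → ℂ) =ᵐ[volume] fun x => (0 + c - α * ψ x) / ((x : ℂ) - z) := by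
  have hm := memLp_resolvent (ψ := ψ) memLp_zero_fun hz c α
  have hu := hm.coeFn_toLp
  have hin : inner ℂ φ (hm.toLp _) = α := by
    rw [inner_kerSub hz hu]
    rw [perturbDet_eq] at h
    linear_combination -h
  refine ⟨hm.toLp _, (mem_kerSub_iff φ ψ _ hz).2 ⟨c, ?_⟩, hin, hu⟩
  rw [hin]; exact hu

/-- Multiplication by the Cauchy kernel as a bounded operator. -/
noncomputable def mulCauchyKernel (z : ℂ) (hz : z.im ≠ 0) : L2 →L[ℂ] L2 :=
  LinearMap.mkContinuous
    { toFun := fun f => (memLp_div_sub (Lp.memLp f) hz).toLp _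
      map_add' := fun f g => by
        rw [← MemLp.toLp_add]
        refine (MemLp.toLp_eq_toLp_iff _ _).2 ?_
        filter_upwards [Lp.coeFn_add f g] with x hx
        simp only [hx, Pi.add_apply, add_div]
      map_smul' := fun a f => by
        rw [RingHom.id_apply, ← MemLp.toLp_const_smul]
        refine (MemLp.toLp_eq_toLp_iff _ _).2 ?_
        filter_upwards [Lp.coeFn_smul a f] with x hx
        simp only [hx, Pi.smul_apply, smul_eq_mul, mul_div_assoc] }
    (1 / |z.im|) fun f => by
      refine Lp.norm_le_mul_norm_of_ae_le_mul ?_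
      filter_upwards [(memLp_div_sub (Lp.memLp f) hz).coeFn_toLp] with x hx
      change ‖((memLp_div_sub (Lp.memLp f) hz).toLp _ : L2) x‖ ≤ _
      rw [hx, div_eq_mul_one_div, norm_mul, mul_comm]
      exact mul_le_mul_of_nonneg_right (norm_inv_sub_le hz x) (norm_nonneg _)

theorem mulCauchyKernel_coe (z : ℂ) (hz : z.im ≠ 0) (f : L2) :
    (mulCauchyKernel z hz f : ℝ → ℂ) =ᵐ[volume] fun x => f x / ((x : ℂ) - z) :=
  (memLp_div_sub (Lp.memLp f) hz).coeFn_toLp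

/-- Every non-real point where the perturbation determinant does not vanish belongs to the
resolvent set of one of the extensions. -/
theorem exists_mem_resolventSet (φ ψ : L2) {z : ℂ} (hz : z.im ≠ 0) (hD : perturbDet φ ψ z ≠ 0) :
    ∃ B : ℂ, z ∈ resolventSet (extensionOp φ ψ B) := by
  obtain ⟨m, hm⟩ := exists_tendsto_integral_inv_sub hz
  set D := perturbDet φ ψ z with hDdef
  have hDe : D = 1 + cauchyTransform (ψ * conjFun φ) z := perturbDet_eq φ ψ z
  set a := cauchyTransform (conjFun φ) z with ha
  set b := cauchyTransform ψ z with hb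
  set M := mulCauchyKernel z hz with hM
  set l1 : L2 →L[ℂ] ℂ := innerSL ℂ (cauchyVec z hz) with hl1
  set l2 : L2 →L[ℂ] ℂ := (innerSL ℂ φ).comp M with hl2
  have hl1' : ∀ g : L2, l1 g = cauchyTransform g z := fun g => inner_cauchyVec z hz g
  have hl2' : ∀ g : L2, l2 g = cauchyTransform (g * conjFun φ) z := fun g => by
    change inner ℂ φ (M g) = _
    rw [inner_resolvent (ψ := 0) (c := 0) (α := 0) (Lp.memLp g) hz
      (by simpa using mulCauchyKernel_coe z hz g)]
    simp
  -- c and α solve two equations: self-consistency, αD = ca + l2(g), and the boundary condition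
  -- l1(g) + cm - αb = Bc.
  set c : L2 →L[ℂ] ℂ := -l1 + (b / D) • l2 with hc
  set α : L2 →L[ℂ] ℂ := (a / D) • c + (1 / D) • l2 with hα
  set κ : L2 := (memLp_inv_sub hz).toLp _ with hκ
  set R : L2 →L[ℂ] L2 := M + c.smulRight κ - α.smulRight (M ψ) with hR
  have hc' : ∀ g : L2, c g = -cauchyTransform g z + b / D * cauchyTransform (g * conjFun φ) z :=
    fun g => by rw [← hl1', ← hl2']; rfl
  have hα' : ∀ g : L2, α g = a / D * c g + 1 / D * cauchyTransform (g * conjFun φ) z :=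
    fun g => by rw [← hl2']; rfl
  have hRcoe : ∀ g : L2, (R g : ℝ → ℂ) =ᵐ[volume]
      fun x => (g x + c g - α g * ψ x) / ((x : ℂ) - z) := by
    intro g
    have h0 : R g = (M g + c g • κ) - α g • M ψ := rfl
    rw [h0]
    filter_upwards [Lp.coeFn_sub (M g + c g • κ) (α g • M ψ), Lp.coeFn_add (M g) (c g • κ),
      Lp.coeFn_smul (c g) κ, Lp.coeFn_smul (α g) (M ψ), mulCauchyKernel_coe z hz g,
      mulCauchyKernel_coe z hz ψ, (memLp_inv_sub hz).coeFn_toLp] with x h1 h2 h3 h4 h5 h6 h7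
    rw [h1, Pi.sub_apply, h2, Pi.add_apply, h3, h4, Pi.smul_apply, Pi.smul_apply, h5, h6, h7]
    simp only [smul_eq_mul]
    ring
  -- After elimination of α the boundary condition has coefficient m - ab/D - B in front of c. This
  -- B makes the coefficient 1, so c is always determined.
  refine ⟨m - a * b / D - 1, R, fun g => ?_, ?_⟩
  · have hin : inner ℂ φ (R g) = α g := by
      rw [inner_resolvent (Lp.memLp g) hz (hRcoe g), ← ha, hα']
      have : cauchyTransform (ψ * conjFun φ) z = D - 1 := by rw [hDe]; ring
      rw [this]
      field_simp
      ring
    have heq : ((z • R g + g : L2) : ℝ → ℂ) =ᵐ[volume]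
        fun x => (x : ℂ) * R g x - c g + inner ℂ φ (R g) * ψ x := by
      filter_upwards [hRcoe g, Lp.coeFn_add (z • R g) g, Lp.coeFn_smul z (R g)] with x h1 h2 h3
      rw [resolvent_eq_iff hz] at h1
      rw [hin, h2, Pi.add_apply, h3, ← h1]; rfl
    have hbd : R g ∈ boundaryCondition (m - a * b / D - 1) := by
      refine ⟨c g, memLp_of_eq heq, ?_⟩
      have hlim := tendsto_integral_resolvent (Lp.memLp g) hz hm (hRcoe g)
      convert hlim using 2
      rw [← hb, hα', hc']
      field_simp
      ring
    obtain ⟨h1, h2⟩ := (extensionOp_iff φ ψ (R g) _ _).2 ⟨hbd, c g, heq⟩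
    exact ⟨h1, by rw [h2]; simp⟩
  · rintro ⟨f, hf⟩
    obtain ⟨⟨d, hd1, hd2⟩, e, he⟩ := (extensionOp_iff φ ψ f _ _).1 ⟨hf, rfl⟩
    set g : L2 := extensionOp φ ψ (m - a * b / D - 1) ⟨f, hf⟩ - z • f with hg
    have hde : d = e := trace_const_unique hd1 (memLp_of_eq he)
    subst hde
    have hfe : (f : ℝ → ℂ) =ᵐ[volume]
        fun x => (g x + d - inner ℂ φ f * ψ x) / ((x : ℂ) - z) := by
      filter_upwards [he, Lp.coeFn_sub (extensionOp φ ψ (m - a * b / D - 1) ⟨f, hf⟩) (z • f),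
        Lp.coeFn_smul z f] with x h1 h2 h3
      rw [resolvent_eq_iff hz, hg, h2, Pi.sub_apply, h1, h3, Pi.smul_apply, smul_eq_mul]
      ring
    set A := inner ℂ φ f with hA
    have h1 : A = cauchyTransform (g * conjFun φ) z + d * a - A * (D - 1) := by
      have := inner_resolvent (Lp.memLp g) hz hfe φ
      rw [hDe, add_sub_cancel_left]
      exact this
    have h2 : (m - a * b / D - 1) * d = cauchyTransform g z + d * m - A * b :=
      tendsto_nhds_unique hd2 (tendsto_integral_resolvent (Lp.memLp g) hz hm hfe)
    have hAD : A = a / D * d + 1 / D * cauchyTransform (g * conjFun φ) z := by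
      field_simp
      linear_combination h1
    have hd : d = c g := by
      rw [hc']
      rw [hAD] at h2
      linear_combination -h2
    have hA' : A = α g := by rw [hα', ← hd, hAD]
    change R g = f
    refine Lp.ext ?_
    filter_upwards [hfe, hRcoe g] with x h3 h4
    rw [h3, h4, hA', hd]

/-! ### Real points, and zeros of the perturbation determinant -/

/-- A normalized oscillating step function near `k`. -/
noncomputable def stepFun (k δ : ℝ) (x : ℝ) : ℂ :=
  (Set.Icc k (k + δ)).indicator (fun _ => (1 : ℂ)) x
    - 2 * (Set.Icc k (k + δ / 2)).indicator (fun _ => (1 : ℂ)) x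

theorem memLp_stepFun (k δ : ℝ) (p : ENNReal) : MemLp (stepFun k δ) p volume :=
  (memLp_indicator_one isCompact_Icc p).sub ((memLp_indicator_one isCompact_Icc p).const_mul _)

theorem stepFun_eq_zero {k δ x : ℝ} (hδ : 0 < δ) (hx : x ∉ Set.Icc k (k + δ)) :
    stepFun k δ x = 0 := by
  have h2 : x ∉ Set.Icc k (k + δ / 2) := fun h => hx ⟨h.1, h.2.trans (by linarith)⟩
  simp only [stepFun, Set.indicator_of_notMem hx, Set.indicator_of_notMem h2]
  ring

theorem norm_stepFun {k δ x : ℝ} (hx : x ∈ Set.Icc k (k + δ)) : ‖stepFun k δ x‖ = 1 := by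
  by_cases h2 : x ∈ Set.Icc k (k + δ / 2)
  · simp only [stepFun, Set.indicator_of_mem hx, Set.indicator_of_mem h2]
    norm_num
  · simp only [stepFun, Set.indicator_of_mem hx, Set.indicator_of_notMem h2]
    norm_num

theorem stepFun_mem {k δ : ℝ} (hδ : 0 < δ) :
    (memLp_stepFun k δ 2).toLp _ ∈ minimalDomain := by
  refine toLp_mem_minimalDomain _ (M := |k| + δ) (by positivity) ?_
    (memLp_one_iff_integrable.1 (memLp_stepFun k δ 1)) ?_
  · intro x hx
    refine stepFun_eq_zero hδ fun h => absurd hx (not_lt.2 ?_)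
    rw [abs_le]
    exact ⟨by linarith [h.1, neg_abs_le k], by linarith [h.2, le_abs_self k]⟩
  · unfold stepFun
    rw [integral_sub (memLp_one_iff_integrable.1 (memLp_indicator_one isCompact_Icc 1))
      ((memLp_one_iff_integrable.1 (memLp_indicator_one isCompact_Icc 1)).const_mul _),
      integral_const_mul, integral_indicator_const _ measurableSet_Icc,
      integral_indicator_const _ measurableSet_Icc]
    simp only [Real.volume_real_Icc, add_sub_cancel_left, real_smul, mul_one]
    rw [max_eq_left hδ.le, max_eq_left (by linarith)]
    push_cast
    ring

theorem mem_minimalDomain_boundaryCondition {f : L2} (hf : f ∈ minimalDomain) (B : ℂ) :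
    f ∈ boundaryCondition B :=
  ⟨0, by simpa using hf.1, by simpa using hf.2⟩

/-- Real points never belong to the resolvent set of an extension. -/
theorem im_ne_zero_of_mem_resolventSet {φ ψ : L2} {B z : ℂ}
    (hz : z ∈ resolventSet (extensionOp φ ψ B)) : z.im ≠ 0 := by
  intro him
  obtain ⟨R, -, hR⟩ := hz
  set k := z.re
  have hzk : z = (k : ℂ) := Complex.ext rfl (by simpa using him)
  set N : ℝ := ‖R‖ + 1 with hN
  have hN0 : 0 < N := by positivity
  -- For f supported in [k, k + δ], multiplication by x - k costs a factor δ and the inner product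
  -- with φ a factor ε, by absolute continuity of the L² norm of φ. The constants make each
  -- contribution at most 1/4 of the norm of f after R is applied, which contradicts that R inverts
  -- on the left.
  set ε : ℝ := 1 / (4 * N * (‖ψ‖ + 1)) with hε
  have hε0 : 0 < ε := by positivity
  obtain ⟨δ₀, hδ₀, hφ⟩ := (Lp.memLp φ).eLpNorm_indicator_le one_le_two ENNReal.ofNat_ne_top hε0
  set δ : ℝ := min δ₀ (1 / (4 * N)) with hδ
  have hδ0 : 0 < δ := lt_min hδ₀ (by positivity)
  have hm := memLp_stepFun k δ 2
  set f : L2 := hm.toLp _ with hf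
  have hfmem : f ∈ minimalDomain := stepFun_mem hδ0
  have hfcoe : (f : ℝ → ℂ) =ᵐ[volume] stepFun k δ := hm.coeFn_toLp
  have hfne : f ≠ 0 := by
    intro h0
    have h1 : stepFun k δ =ᵐ[volume] 0 := hfcoe.symm.trans ((Lp.eq_zero_iff_ae_eq_zero).1 h0)
    have h2 : volume (Set.Icc k (k + δ)) = 0 := by
      refine measure_mono_null (fun x hx => ?_) (ae_iff.1 h1)
      intro h3
      have := norm_stepFun hx
      rw [show stepFun k δ x = 0 from h3, norm_zero] at this
      exact zero_ne_one this
    rw [Real.volume_Icc, add_sub_cancel_left, ENNReal.ofReal_eq_zero] at h2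
    linarith
  have hxm : MemLp (fun x : ℝ => ((x : ℂ) - z) * f x) 2 volume := by
    refine (memLp_congr_ae (Eventually.of_forall fun x => ?_)).1
      (hfmem.1.sub ((Lp.memLp f).const_mul z))
    simp only [Pi.sub_apply]; ring
  set v : L2 := hfmem.1.toLp _ + inner ℂ φ f • ψ with hv
  have hvcoe : (v : ℝ → ℂ) =ᵐ[volume] fun x => (x : ℂ) * f x - 0 + inner ℂ φ f * ψ x := by
    filter_upwards [Lp.coeFn_add (hfmem.1.toLp _) (inner ℂ φ f • ψ), hfmem.1.coeFn_toLp,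
      Lp.coeFn_smul (inner ℂ φ f) ψ] with x h1 h2 h3
    rw [hv, h1, Pi.add_apply, h2, h3, sub_zero]; rfl
  obtain ⟨hdom, hT⟩ := (extensionOp_iff φ ψ f v B).2
    ⟨mem_minimalDomain_boundaryCondition hfmem B, 0, hvcoe⟩
  have h1 := hR ⟨f, hdom⟩
  rw [hT] at h1
  have hsplit : v - z • f = hxm.toLp _ + inner ℂ φ f • ψ := by
    refine Lp.ext ?_
    filter_upwards [Lp.coeFn_sub v (z • f), Lp.coeFn_smul z f, hvcoe,
      Lp.coeFn_add (hxm.toLp _) (inner ℂ φ f • ψ), hxm.coeFn_toLp,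
      Lp.coeFn_smul (inner ℂ φ f) ψ] with x h1 h2 h3 h4 h5 h6
    rw [h1, Pi.sub_apply, h2, h3, h4, Pi.add_apply, h5, h6, Pi.smul_apply, Pi.smul_apply]
    simp only [smul_eq_mul]
    ring
  have hn1 : ‖hxm.toLp _‖ ≤ δ * ‖f‖ := by
    refine Lp.norm_le_mul_norm_of_ae_le_mul ?_
    filter_upwards [hxm.coeFn_toLp, hfcoe] with x h1 h2
    rw [h1, norm_mul]
    by_cases hx : x ∈ Set.Icc k (k + δ)
    · refine mul_le_mul_of_nonneg_right ?_ (norm_nonneg _)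
      rw [hzk, ← ofReal_sub, norm_real, Real.norm_eq_abs, abs_le]
      exact ⟨by linarith [hx.1], by linarith [hx.2]⟩
    · rw [h2, stepFun_eq_zero hδ0 hx]; simp
  have hφind := hφ (Set.Icc k (k + δ)) measurableSet_Icc (by
    rw [Real.volume_Icc, add_sub_cancel_left]
    exact ENNReal.ofReal_le_ofReal (min_le_left _ _))
  have hφm : MemLp ((Set.Icc k (k + δ)).indicator (φ : ℝ → ℂ)) 2 volume :=
    (Lp.memLp φ).indicator measurableSet_Icc
  have hinner : inner ℂ φ f = inner ℂ (hφm.toLp _) f := by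
    rw [inner_L2_eq, inner_L2_eq]
    refine integral_congr_ae ?_
    filter_upwards [hφm.coeFn_toLp, hfcoe] with x h1 h2
    rw [h1, h2]
    by_cases hx : x ∈ Set.Icc k (k + δ)
    · rw [Set.indicator_of_mem hx]
    · rw [stepFun_eq_zero hδ0 hx, mul_zero, mul_zero]
  have hn2 : ‖inner ℂ φ f‖ ≤ ε * ‖f‖ := by
    rw [hinner]
    refine (norm_inner_le_norm _ _).trans (mul_le_mul_of_nonneg_right ?_ (norm_nonneg _))
    rw [Lp.norm_toLp]
    exact ENNReal.toReal_le_of_le_ofReal hε0.le hφind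
  have hfpos : 0 < ‖f‖ := norm_pos_iff.2 hfne
  have hfin : ‖f‖ ≤ N * (δ * ‖f‖ + ε * ‖f‖ * ‖ψ‖) := by
    calc ‖f‖ = ‖R (v - z • f)‖ := by rw [h1]
      _ ≤ ‖R‖ * ‖v - z • f‖ := R.le_opNorm _
      _ ≤ N * (δ * ‖f‖ + ε * ‖f‖ * ‖ψ‖) := by
        refine mul_le_mul (by linarith) ?_ (norm_nonneg _) hN0.le
        rw [hsplit]
        refine (norm_add_le _ _).trans (add_le_add hn1 ?_)
        rw [norm_smul]
        exact mul_le_mul_of_nonneg_right hn2 (norm_nonneg _)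
  have h2 : N * δ ≤ 1 / 4 := by
    have := min_le_right δ₀ (1 / (4 * N))
    calc N * δ ≤ N * (1 / (4 * N)) := mul_le_mul_of_nonneg_left this hN0.le
      _ = 1 / 4 := by field_simp
  have h3 : N * (ε * ‖ψ‖) ≤ 1 / 4 := by
    have h4 : ε * ‖ψ‖ ≤ ε * (‖ψ‖ + 1) := mul_le_mul_of_nonneg_left (by linarith) hε0.le
    calc N * (ε * ‖ψ‖) ≤ N * (ε * (‖ψ‖ + 1)) := mul_le_mul_of_nonneg_left h4 hN0.le
      _ = 1 / 4 := by rw [hε]; field_simp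
  nlinarith [mul_le_mul_of_nonneg_right (add_le_add h2 h3) hfpos.le]

/-- At a zero of the perturbation determinant in the resolvent set the transform of `φ̄` does not
vanish. -/
theorem cauchyTransform_ne_zero_of_mem_resolventSet {φ ψ : L2} {B z : ℂ}
    (hz : z ∈ resolventSet (extensionOp φ ψ B)) (hD : perturbDet φ ψ z = 0) :
    cauchyTransform (conjFun φ) z ≠ 0 := by
  intro ha
  have him := im_ne_zero_of_mem_resolventSet hz
  obtain ⟨m, hm⟩ := exists_tendsto_integral_inv_sub him
  -- With D and the transform of φ̄ both zero at z, self-consistency holds for every pair (c, α).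
  -- One non-trivial pair also satisfies the boundary condition. Injectivity makes its vector zero,
  -- so αψ = c a.e.; then c = 0 and ψ = 0, which forces D = 1.
  obtain ⟨c, α, hne, hrel⟩ : ∃ c α : ℂ, (c ≠ 0 ∨ α ≠ 0) ∧
      c * m - α * cauchyTransform ψ z = B * c := by
    by_cases hb : cauchyTransform ψ z = 0
    · by_cases hmB : m = B
      · exact ⟨1, 0, Or.inl one_ne_zero, by rw [hmB]; ring⟩
      · exact ⟨0, 1, Or.inr one_ne_zero, by rw [hb]; ring⟩
    · exact ⟨cauchyTransform ψ z, m - B, Or.inl hb, by ring⟩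
  obtain ⟨u, hker, hin, hu⟩ := exists_mem_kerSub φ ψ him (c := c) (α := α) (by rw [hD, ha]; ring)
  obtain ⟨R, -, hR⟩ := hz
  have heq : ((z • u : L2) : ℝ → ℂ) =ᵐ[volume]
      fun x => (x : ℂ) * u x - c + inner ℂ φ u * ψ x := by
    filter_upwards [hu, Lp.coeFn_smul z u] with x h1 h2
    rw [resolvent_eq_iff him, add_zero] at h1
    rw [h2, hin, ← h1]; rfl
  have hlim := tendsto_integral_resolvent memLp_zero_fun him hm hu
  have h0 : cauchyTransform (fun _ => (0 : ℂ)) z = 0 := by simp [cauchyTransform]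
  rw [h0, zero_add, hrel] at hlim
  obtain ⟨hdom, hT⟩ := (extensionOp_iff φ ψ u (z • u) B).2 ⟨⟨c, memLp_of_eq heq, hlim⟩, c, heq⟩
  have h1 := hR ⟨u, hdom⟩
  rw [hT, sub_self, map_zero] at h1
  have hu0 : (u : ℝ → ℂ) =ᵐ[volume] 0 := (Lp.eq_zero_iff_ae_eq_zero).1 h1.symm
  have hcα : (fun x => α * ψ x) =ᵐ[volume] fun _ => c := by
    filter_upwards [hu, hu0] with x h2 h3
    rw [h3, eq_comm, Pi.zero_apply, div_eq_zero_iff] at h2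
    have := h2.resolve_right (ofReal_sub_ne_zero him x)
    linear_combination -this
  have hc : c = 0 := memLp_const_eq_zero ((memLp_congr_ae hcα).1 ((Lp.memLp ψ).const_mul α))
  have hα : α ≠ 0 := hne.resolve_left (not_not.2 hc)
  have hψ : (ψ * conjFun φ : ℝ → ℂ) =ᵐ[volume] fun _ => 0 := by
    filter_upwards [hcα] with x hx
    rw [hc] at hx
    simp only [Pi.mul_apply, (mul_eq_zero.1 hx).resolve_left hα, zero_mul]
  rw [perturbDet_eq, cauchyTransform_congr hψ, h0, add_zero] at hD
  exact one_ne_zero hD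

/-! ### Orthogonality to the detectable subspace as vanishing of an analytic function -/

theorem mem_detectable_orthogonal_iff (φ ψ g : L2) :
    g ∈ (detectableSubspace φ ψ)ᗮ ↔ ∀ (B z : ℂ), z ∈ resolventSet (extensionOp φ ψ B) →
      ∀ u ∈ kerSub (maximalOp φ ψ) z, inner ℂ g u = 0 := by
  rw [detectableSubspace, Submodule.orthogonal_closure, Submodule.mem_orthogonal']
  constructor
  · intro h B z hz u hu
    refine h u (Submodule.subset_span ?_)
    simp only [Set.mem_iUnion]
    exact ⟨z, ⟨B, hz⟩, hu⟩
  · intro h u hu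
    induction hu using Submodule.span_induction with
    | mem v hv =>
      simp only [Set.mem_iUnion] at hv
      obtain ⟨z, ⟨B, hz⟩, hv⟩ := hv
      exact h B z hz v hv
    | zero => simp
    | add a b _ _ ha hb => rw [inner_add_right, ha, hb, add_zero]
    | smul c a _ ha => rw [inner_smul_right, ha, mul_zero]

/-- The analytic function whose vanishing characterizes the orthogonal complement of the
detectable subspace. -/
noncomputable def defectFun (φ ψ g : L2) (z : ℂ) : ℂ :=
  perturbDet φ ψ z * cauchyTransform (conjFun g) z
    - cauchyTransform (conjFun φ) z * cauchyTransform (ψ * conjFun g) z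

theorem cauchyIntegrable_conj_L2 (g : L2) : CauchyIntegrable (conjFun g) :=
  (cauchyIntegrable_L2 g).conj

theorem cauchyIntegrable_mul_conj_L2 (f g : L2) : CauchyIntegrable (f * conjFun g) :=
  cauchyIntegrable_mul_conj (Lp.memLp f) (Lp.memLp g)

theorem differentiableAt_perturbDet (φ ψ : L2) {z : ℂ} (hz : z.im ≠ 0) :
    DifferentiableAt ℂ (perturbDet φ ψ) z := by
  rw [funext (perturbDet_eq φ ψ)]
  exact ((cauchyIntegrable_mul_conj_L2 ψ φ).differentiableAt hz).const_add 1

theorem differentiableAt_defectFun (φ ψ g : L2) {z : ℂ} (hz : z.im ≠ 0) :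
    DifferentiableAt ℂ (defectFun φ ψ g) z :=
  ((differentiableAt_perturbDet φ ψ hz).mul ((cauchyIntegrable_conj_L2 g).differentiableAt hz)).sub
    (((cauchyIntegrable_conj_L2 φ).differentiableAt hz).mul
      ((cauchyIntegrable_mul_conj_L2 ψ g).differentiableAt hz))

theorem norm_cauchyTransform_le {f : ℝ → ℂ} (hf : Integrable f) {z : ℂ} (hz : z.im ≠ 0) :
    ‖cauchyTransform f z‖ ≤ (∫ x, ‖f x‖) / |z.im| := by
  unfold cauchyTransform
  refine (norm_integral_le_integral_norm _).trans ?_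
  rw [div_eq_inv_mul, ← integral_const_mul]
  refine integral_mono_of_nonneg (Eventually.of_forall fun _ => norm_nonneg _)
    (hf.norm.const_mul _) (Eventually.of_forall fun x => ?_)
  have h := norm_inv_sub_le hz x
  simp only
  rw [div_eq_mul_one_div, norm_mul, mul_comm, ← one_div]
  exact mul_le_mul_of_nonneg_right h (norm_nonneg _)

/-- |D - 1| is at most the L¹ norm of ψφ̄ divided by |Im z|, hence less than 1 far enough from the
line on either side. -/
theorem exists_perturbDet_ne_zero (φ ψ : L2) :
    ∃ y : ℝ, 0 < y ∧ perturbDet φ ψ (y * I) ≠ 0 ∧ perturbDet φ ψ (-(y * I)) ≠ 0 := by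
  have hint : Integrable (ψ * conjFun φ : ℝ → ℂ) :=
    integrable_mul_of_memLp_two (Lp.memLp ψ) (memLp_conjFun (Lp.memLp φ))
  set A := ∫ x, ‖(ψ * conjFun φ : ℝ → ℂ) x‖ with hA
  have hA0 : 0 ≤ A := integral_nonneg fun _ => norm_nonneg _
  have key : ∀ z : ℂ, |z.im| = A + 1 → perturbDet φ ψ z ≠ 0 := by
    intro z hz h0
    have hz0 : z.im ≠ 0 := fun h => by rw [h, abs_zero] at hz; linarith
    have h1 := norm_cauchyTransform_le hint hz0
    rw [perturbDet_eq] at h0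
    have h2 : cauchyTransform (ψ * conjFun φ) z = -1 := by linear_combination h0
    rw [h2, hz, norm_neg, norm_one, ← hA, le_div_iff₀ (by linarith)] at h1
    linarith
  refine ⟨A + 1, by linarith, key _ ?_, key _ ?_⟩
  · simp [abs_of_pos (by linarith : 0 < A + 1)]
  · simp only [neg_im, mul_im, ofReal_re, I_im, mul_one, ofReal_im, I_re, mul_zero, add_zero,
      abs_neg]
    exact abs_of_pos (by linarith)

/-- If `f * g = 0` on an open convex set and the analytic function `f` is not identically zero, the
continuous function `g` vanishes. -/
theorem eq_zero_of_mul_eq_zero {U : Set ℂ} (hU : IsOpen U) (hUc : Convex ℝ U) {f g : ℂ → ℂ}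
    (hf : DifferentiableOn ℂ f U) (hg : ContinuousOn g U) (hfg : ∀ z ∈ U, f z ≠ 0 → g z = 0)
    {w : ℂ} (hw : w ∈ U) (hfw : f w ≠ 0) {z : ℂ} (hz : z ∈ U) : g z = 0 := by
  by_contra hgz
  have h1 : ∀ᶠ v in 𝓝 z, g v ≠ 0 := (hg.continuousAt (hU.mem_nhds hz)).eventually_ne hgz
  have h2 : f =ᶠ[𝓝 z] 0 := by
    filter_upwards [h1, hU.mem_nhds hz] with v h3 h4
    by_contra h5
    exact h3 (hfg v h4 h5)
  exact hfw ((hf.analyticOnNhd hU).eqOn_zero_of_preconnected_of_eventuallyEq_zero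
    hUc.isPreconnected hz h2 hw)

/-- Pairing with the kernel vector of parameters (c, α) gives c (ḡ)^ - α (ψḡ)^. With αD = c (φ̄)^,
multiplication by D turns this into c times `defectFun`; only zeros of D need separate care. -/
theorem mem_orthogonal_iff_defectFun (φ ψ g : L2) :
    g ∈ (detectableSubspace φ ψ)ᗮ ↔ ∀ z : ℂ, z.im ≠ 0 → defectFun φ ψ g z = 0 := by
  rw [mem_detectable_orthogonal_iff]
  have hinner : ∀ (z : ℂ) (hz : z.im ≠ 0) (c α : ℂ) (u : L2),
      ((u : ℝ → ℂ) =ᵐ[volume] fun x => (0 + c - α * ψ x) / ((x : ℂ) - z)) →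
      inner ℂ g u = c * cauchyTransform (conjFun g) z - α * cauchyTransform (ψ * conjFun g) z := by
    intro z hz c α u hu
    rw [inner_resolvent memLp_zero_fun hz hu, cauchyTransform_zero_mul, zero_add]
  constructor
  · intro h
    have key : ∀ z : ℂ, z.im ≠ 0 → perturbDet φ ψ z ≠ 0 → defectFun φ ψ g z = 0 := by
      intro z hz hD
      obtain ⟨B, hB⟩ := exists_mem_resolventSet φ ψ hz hD
      -- The choice c = D, α = (φ̄)^ satisfies the consistency condition trivially and makes the
      -- pairing equal to `defectFun`.
      obtain ⟨u, hu1, -, hu2⟩ := exists_mem_kerSub φ ψ hz (c := perturbDet φ ψ z)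
        (α := cauchyTransform (conjFun φ) z) (mul_comm _ _)
      have h1 := h B z hB u hu1
      rwa [hinner z hz _ _ u hu2] at h1
    obtain ⟨y, hy, hp, hm⟩ := exists_perturbDet_ne_zero φ ψ
    intro z hz
    rcases lt_or_gt_of_ne hz with h1 | h1
    · refine eq_zero_of_mul_eq_zero (U := {z : ℂ | z.im < 0}) (f := perturbDet φ ψ)
        (isOpen_lt continuous_im continuous_const)
        (convex_halfSpace_im_lt 0)
        (fun w hw => (differentiableAt_perturbDet φ ψ (ne_of_lt hw)).differentiableWithinAt)
        (fun w hw => (differentiableAt_defectFun φ ψ g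
          (ne_of_lt hw)).continuousAt.continuousWithinAt)
        (fun w hw => key w (ne_of_lt hw)) (w := -(y * I)) (by simpa using hy) hm h1
    · refine eq_zero_of_mul_eq_zero (U := {z : ℂ | 0 < z.im}) (f := perturbDet φ ψ)
        (isOpen_lt continuous_const continuous_im)
        (convex_halfSpace_im_gt 0)
        (fun w hw => (differentiableAt_perturbDet φ ψ (ne_of_gt hw)).differentiableWithinAt)
        (fun w hw => (differentiableAt_defectFun φ ψ g
          (ne_of_gt hw)).continuousAt.continuousWithinAt)
        (fun w hw => key w (ne_of_gt hw)) (w := y * I) (by simpa using hy) hp h1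
  · intro h B z hz u hu
    have him := im_ne_zero_of_mem_resolventSet hz
    obtain ⟨c, hc⟩ := (mem_kerSub_iff φ ψ u him).1 hu
    have hE := h z him
    have hα := inner_kerSub (φ := φ) him hc
    set α := inner ℂ φ u
    have hαD : α * perturbDet φ ψ z = c * cauchyTransform (conjFun φ) z := by
      rw [perturbDet_eq]; linear_combination hα
    rw [hinner z him c α u hc]
    unfold defectFun at hE
    by_cases hD : perturbDet φ ψ z = 0
    -- At a zero of D in the resolvent set (φ̄)^ ≠ 0, so consistency gives c = 0 and the vanishing
    -- of `defectFun` gives (ψḡ)^ = 0.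
    · have ha := cauchyTransform_ne_zero_of_mem_resolventSet hz hD
      rw [hD, mul_zero, eq_comm] at hαD
      have hc0 := (mul_eq_zero.1 hαD).resolve_right ha
      rw [hD, zero_mul, zero_sub, neg_eq_zero] at hE
      rw [hc0, (mul_eq_zero.1 hE).resolve_left ha]
      ring
    · refine (mul_eq_zero.1 ?_).resolve_left hD
      linear_combination c * hE - cauchyTransform (ψ * conjFun g) z * hαD

/-! ### Boundary values of Cauchy transforms and the Plemelj relation -/

/-- Boundary values of the Cauchy transform from above. -/
noncomputable abbrev cauchyUpper (f : ℝ → ℂ) : ℝ → ℂ := upperBoundary (cauchyTransform f)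

/-- Boundary values of the Cauchy transform from below. -/
noncomputable abbrev cauchyLower (f : ℝ → ℂ) : ℝ → ℂ := lowerBoundary (cauchyTransform f)

theorem conj_line (k ε : ℝ) :
    (starRingEnd ℂ) ((k : ℂ) + ε * I) = (k : ℂ) - ε * I := by
  simp [sub_eq_add_neg]

theorem cauchyTransform_lower_eq (f : ℝ → ℂ) (k ε : ℝ) :
    cauchyTransform f ((k : ℂ) - ε * I)
      = (starRingEnd ℂ) (cauchyTransform (conjFun f) ((k : ℂ) + ε * I)) := by
  rw [← cauchyTransform_conj, conjFun_conjFun, conj_line]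

theorem CauchyIntegrable.ae_tendsto_upper {f : ℝ → ℂ} (hf : CauchyIntegrable f) :
    ∀ᵐ k : ℝ, Tendsto (fun ε : ℝ => cauchyTransform f ((k : ℂ) + ε * I)) (𝓝[>] 0)
      (𝓝 (cauchyUpper f k)) := by
  filter_upwards [hf.boundedType.ae_boundary.1] with k hk
  exact tendsto_nhds_limUnder hk

theorem CauchyIntegrable.ae_tendsto_lower {f : ℝ → ℂ} (hf : CauchyIntegrable f) :
    ∀ᵐ k : ℝ, Tendsto (fun ε : ℝ => cauchyTransform f ((k : ℂ) - ε * I)) (𝓝[>] 0)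
      (𝓝 (cauchyLower f k)) := by
  filter_upwards [hf.conj.boundedType.ae_boundary.1] with k ⟨l, hl⟩
  refine tendsto_nhds_limUnder ⟨(starRingEnd ℂ) l, ?_⟩
  simp_rw [cauchyTransform_lower_eq]
  exact (continuous_conj.tendsto _).comp hl

theorem CauchyIntegrable.hasBoundaryValues {f : ℝ → ℂ} (hf : CauchyIntegrable f) :
    HasBoundaryValues (cauchyTransform f) := by
  filter_upwards [hf.ae_tendsto_upper, hf.ae_tendsto_lower] with k h1 h2
  exact ⟨⟨_, h1⟩, ⟨_, h2⟩⟩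

theorem CauchyIntegrable.lower_eq {f : ℝ → ℂ} (hf : CauchyIntegrable f) :
    cauchyLower f =ᵐ[volume] conjFun (cauchyUpper (conjFun f)) := by
  filter_upwards [hf.ae_tendsto_lower, hf.conj.ae_tendsto_upper] with k h1 h2
  refine tendsto_nhds_unique h1 ?_
  simp_rw [cauchyTransform_lower_eq]
  exact (continuous_conj.tendsto _).comp h2

/-- Plemelj jump relation. -/
theorem CauchyIntegrable.upper_sub_lower {f : ℝ → ℂ} (hf : CauchyIntegrable f) :
    ∀ᵐ k : ℝ, cauchyUpper f k - cauchyLower f k = 2 * Real.pi * I * f k := by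
  filter_upwards [hf.ae_tendsto_upper, hf.ae_tendsto_lower, hf.ae_tendsto_jump] with k h1 h2 h3
  exact tendsto_nhds_unique (h1.sub h2) h3

theorem cauchyLower_congr {f g : ℝ → ℂ} (h : f =ᵐ[volume] g) : cauchyLower f = cauchyLower g := by
  unfold cauchyLower
  rw [funext (cauchyTransform_congr h)]

theorem cauchyUpper_add {f g : ℝ → ℂ} (hf : CauchyIntegrable f) (hg : CauchyIntegrable g) :
    cauchyUpper (f + g) =ᵐ[volume] cauchyUpper f + cauchyUpper g := by
  filter_upwards [hf.ae_tendsto_upper, hg.ae_tendsto_upper, (hf.add hg).ae_tendsto_upper]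
    with k h1 h2 h3
  refine tendsto_nhds_unique h3 ((h1.add h2).congr' (eventually_nhdsWithin_of_forall
    fun ε hε => ?_))
  exact (cauchyTransform_add hf hg (by simpa using (ne_of_gt hε))).symm

theorem cauchyLower_add {f g : ℝ → ℂ} (hf : CauchyIntegrable f) (hg : CauchyIntegrable g) :
    cauchyLower (f + g) =ᵐ[volume] cauchyLower f + cauchyLower g := by
  filter_upwards [hf.ae_tendsto_lower, hg.ae_tendsto_lower, (hf.add hg).ae_tendsto_lower]
    with k h1 h2 h3
  refine tendsto_nhds_unique h3 ((h1.add h2).congr' (eventually_nhdsWithin_of_forall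
    fun ε hε => ?_))
  exact (cauchyTransform_add hf hg (by simpa using (ne_of_gt hε))).symm

/-- The boundary values are determined by a decomposition into Hardy functions. -/
theorem cauchyUpper_of_decomp {f u v : ℝ → ℂ} (hu : IsPlus u) (hv : IsPlus (conjFun v))
    (hfuv : f =ᵐ[volume] u + v) :
    ∀ᵐ k : ℝ, cauchyUpper f k = 2 * Real.pi * I * u k := by
  have hv2 : MemLp v 2 volume := by
    rw [← conjFun_conjFun v]; exact memLp_conjFun hv.1
  have hvi := cauchyIntegrable_of_memLp hv2
  have hfi : CauchyIntegrable f := (hu.cauchyIntegrable.add hvi).congr hfuv.symm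
  filter_upwards [hfi.ae_tendsto_upper, hu.ae_tendsto] with k h1 h2
  refine tendsto_nhds_unique h1 (h2.congr' (eventually_nhdsWithin_of_forall fun ε hε => ?_))
  have hε' : 0 < ((k : ℂ) + ε * I).im := by simpa using hε
  simp only
  rw [cauchyTransform_congr hfuv, cauchyTransform_add hu.cauchyIntegrable hvi hε'.ne',
    (isPlus_conj_iff hv2).1 hv _ hε', add_zero]

theorem cauchyLower_of_decomp {f u v : ℝ → ℂ} (hu : IsPlus u) (hv : IsPlus (conjFun v))
    (hfuv : f =ᵐ[volume] u + v) :
    ∀ᵐ k : ℝ, cauchyLower f k = -(2 * Real.pi * I) * v k := by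
  have hv2 : MemLp v 2 volume := by
    rw [← conjFun_conjFun v]; exact memLp_conjFun hv.1
  have hfi : CauchyIntegrable f :=
    (hu.cauchyIntegrable.add (cauchyIntegrable_of_memLp hv2)).congr hfuv.symm
  filter_upwards [hfi.upper_sub_lower, cauchyUpper_of_decomp hu hv hfuv, hfuv] with k h1 h2 h3
  rw [h2, h3, Pi.add_apply] at h1
  linear_combination -h1

theorem rieszPlus_of_decomp {f u v : ℝ → ℂ} (hu : IsPlus u) (hv : IsPlus (conjFun v))
    (hfuv : f =ᵐ[volume] u + v) : rieszPlus f =ᵐ[volume] u := by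
  filter_upwards [cauchyUpper_of_decomp hu hv hfuv] with k hk
  change 1 / (2 * Real.pi * I) * cauchyUpper f k = u k
  rw [hk]
  field_simp [two_pi_I_ne]

theorem rieszMinus_of_decomp {f u v : ℝ → ℂ} (hu : IsPlus u) (hv : IsPlus (conjFun v))
    (hfuv : f =ᵐ[volume] u + v) : rieszMinus f =ᵐ[volume] v := by
  filter_upwards [cauchyLower_of_decomp hu hv hfuv] with k hk
  change -(1 / (2 * Real.pi * I)) * cauchyLower f k = v k
  rw [hk]
  field_simp [two_pi_I_ne]

theorem isPlus_cauchyUpper {f : ℝ → ℂ} (hf : MemLp f 2 volume) : IsPlus (cauchyUpper f) := by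
  obtain ⟨u, v, hu, hv, -, h⟩ := exists_isPlus_decomp hf
  exact (hu.const_mul (2 * Real.pi * I)).congr
    (by filter_upwards [cauchyUpper_of_decomp hu hv h] with k hk using hk.symm)

/-! ### Products of boundary values, beyond L² -/

/-- Cauchy integrable functions whose Cauchy transform vanishes in the lower half-plane. -/
def IsUpperBoundary (f : ℝ → ℂ) : Prop :=
  CauchyIntegrable f ∧ ∀ z : ℂ, z.im < 0 → cauchyTransform f z = 0

theorem IsPlus.isUpperBoundary {f : ℝ → ℂ} (hf : IsPlus f) : IsUpperBoundary f :=
  ⟨hf.cauchyIntegrable, hf.2⟩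

theorem IsUpperBoundary.congr {f g : ℝ → ℂ} (hf : IsUpperBoundary f) (h : f =ᵐ[volume] g) :
    IsUpperBoundary g :=
  ⟨hf.1.congr h, fun z hz => by rw [← cauchyTransform_congr h, hf.2 z hz]⟩

theorem IsUpperBoundary.add {f g : ℝ → ℂ} (hf : IsUpperBoundary f) (hg : IsUpperBoundary g) :
    IsUpperBoundary (f + g) :=
  ⟨hf.1.add hg.1, fun z hz => by
    rw [cauchyTransform_add hf.1 hg.1 hz.ne, hf.2 z hz, hg.2 z hz, add_zero]⟩

theorem IsUpperBoundary.sub {f g : ℝ → ℂ} (hf : IsUpperBoundary f) (hg : IsUpperBoundary g) :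
    IsUpperBoundary (f - g) :=
  ⟨hf.1.sub hg.1, fun z hz => by
    rw [cauchyTransform_sub hf.1 hg.1 hz.ne, hf.2 z hz, hg.2 z hz, sub_zero]⟩

/-- A function that is a boundary value from both sides vanishes. -/
theorem IsUpperBoundary.ae_eq_zero {f : ℝ → ℂ} (hf : IsUpperBoundary f)
    (hf' : IsUpperBoundary (conjFun f)) : f =ᵐ[volume] 0 := by
  refine hf.1.ae_eq_zero (fun z hz => ?_) hf.2
  have := hf'.2 ((starRingEnd ℂ) z) (by simpa using hz)
  rw [cauchyTransform_conj] at this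
  simpa using this

theorem IsPlus.isUpperBoundary_mul {f g : ℝ → ℂ} (hf : IsPlus f) (hg : IsPlus g) :
    IsUpperBoundary (f * g) :=
  ⟨cauchyIntegrable_of_integrable (integrable_mul_of_memLp_two hf.1 hg.1),
    fun _ hz => cauchyTransform_mul_eq_zero hf hg hz⟩

theorem isUpperBoundary_mul_of_L2 {f g : ℝ → ℂ} (hf : MemLp f 2 volume) (hg : MemLp g 2 volume) :
    IsUpperBoundary (cauchyUpper f * cauchyUpper g) :=
  (isPlus_cauchyUpper hf).isUpperBoundary_mul (isPlus_cauchyUpper hg)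

/-- Above the line only the upper Hardy component of f contributes, and its transform is 2πi times a
Poisson integral. -/
theorem exists_hardyBound_cauchyTransform {f : ℝ → ℂ} (hf : MemLp f 2 volume) :
    ∃ C, HardyBound (cauchyTransform f) C := by
  obtain ⟨u, v, hu, hv, hv2, h⟩ := exists_isPlus_decomp hf
  have heq : ∀ z : ℂ, 0 < z.im → cauchyTransform f z = cauchyTransform u z := fun z hz => by
    rw [cauchyTransform_congr h, cauchyTransform_add hu.cauchyIntegrable
      (cauchyIntegrable_of_memLp hv2) hz.ne', (isPlus_conj_iff hv2).1 hv _ hz, add_zero]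
  refine ⟨‖(2 * Real.pi * I : ℂ)‖ₑ * eLpNorm u 2 volume, fun z hz =>
    ((cauchyIntegrable_of_memLp hf).differentiableAt (ne_of_gt hz)).differentiableWithinAt,
    ENNReal.mul_ne_top enorm_ne_top hu.1.eLpNorm_ne_top, fun y hy => ?_⟩
  have : (fun x : ℝ => cauchyTransform f ((x : ℂ) + y * I))
      = (2 * Real.pi * I : ℂ) • fun x => poissonIntegral u x y := by
    ext x
    rw [heq _ (by simpa using hy), hu.cauchyTransform_eq hy x]; rfl
  rw [this, eLpNorm_const_smul]
  gcongr
  exact eLpNorm_poissonIntegral_le hu.1.1 hy one_le_two ENNReal.ofNat_ne_top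

/-! ### M. Riesz bounds for the Cauchy transform on L⁴ and L^{4/3} -/

/-- The right side minus the left is (Re² - 7 Im²)². Since the integral of F⁴ over a horizontal line
will vanish, this controls F in L⁴ by its imaginary part. -/
theorem norm_pow_four_le (w : ℂ) : ‖w‖ ^ 4 ≤ 48 * w.im ^ 4 + 2 * (w ^ 4).re := by
  have h1 : ‖w‖ ^ 4 = (w.re ^ 2 + w.im ^ 2) ^ 2 := by
    rw [show ‖w‖ ^ 4 = (‖w‖ ^ 2) ^ 2 by ring, ← normSq_eq_norm_sq, normSq_apply]; ring
  have h2 : (w ^ 4).re = w.re ^ 4 - 6 * w.re ^ 2 * w.im ^ 2 + w.im ^ 4 := by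
    rw [show w ^ 4 = (w * w) * (w * w) by ring]
    simp only [mul_re, mul_im]; ring
  rw [h1, h2]
  nlinarith [sq_nonneg (w.re ^ 2 - 7 * w.im ^ 2)]

theorem norm_cauchyTransform_le_of_memLp {f : ℝ → ℂ} (hf : MemLp f 2 volume) {z : ℂ}
    (hz : z.im ≠ 0) :
    ‖cauchyTransform f z‖ₑ ≤ eLpNorm f 2 volume * ENNReal.ofReal (Real.sqrt (Real.pi / |z.im|)) := by
  refine (enorm_integral_le_lintegral_enorm _).trans ?_
  simp_rw [div_eq_mul_one_div (f _)]
  rw [← eLpNorm_inv_sub hz]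
  exact lintegral_enorm_mul_le hf.1 (memLp_inv_sub hz).1

theorem IsPlus.mul_of_bounded {f : ℝ → ℂ} (hf : IsPlus f) {M : ℝ} (hM : ∀ x, ‖f x‖ ≤ M) :
    IsPlus (f * f) := by
  refine ⟨?_, fun z hz => cauchyTransform_mul_eq_zero hf hf hz⟩
  refine (hf.1.const_mul (M : ℂ)).mono (hf.1.1.mul hf.1.1) (Eventually.of_forall fun x => ?_)
  simp only [Pi.mul_apply, norm_mul, norm_real]
  exact mul_le_mul_of_nonneg_right ((hM x).trans (le_abs_self M)) (norm_nonneg _)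

theorem eLpNorm_four (f : ℝ → ℂ) :
    eLpNorm f 4 volume = (∫⁻ x, ENNReal.ofReal (‖f x‖ ^ 4)) ^ (1 / 4 : ℝ) := by
  rw [eLpNorm_eq_lintegral_rpow_enorm_toReal (by norm_num) (by norm_num)]
  simp only [ENNReal.toReal_ofNat]
  congr 2 with x
  rw [← ofReal_norm, ENNReal.ofReal_rpow_of_nonneg (norm_nonneg _) (by norm_num)]
  norm_num

/-- For real h the imaginary part of the transform is π times a Poisson integral, a contraction on
L⁴. On a horizontal line F is bounded, so F² is again in the upper Hardy space and the integral of
F⁴ = F² · F² is zero. -/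
theorem eLpNorm_cauchyTransform_ofReal_le {h : ℝ → ℝ} (hh : MemLp (fun t => (h t : ℂ)) 2 volume)
    {y : ℝ} (hy : 0 < y) :
    eLpNorm (fun x : ℝ => cauchyTransform (fun t => (h t : ℂ)) ((x : ℂ) + y * I)) 4 volume
      ≤ ENNReal.ofReal (3 * Real.pi) * eLpNorm (fun t => (h t : ℂ)) 4 volume := by
  set f : ℝ → ℂ := fun t => (h t : ℂ) with hf
  obtain ⟨C, hC⟩ := exists_hardyBound_cauchyTransform hh
  set F : ℝ → ℂ := fun x => cauchyTransform f ((x : ℂ) + y * I) with hFdef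
  have hF : IsPlus F := hC.isPlus_line hy
  obtain ⟨M, hM⟩ : ∃ M : ℝ, ∀ x, ‖F x‖ ≤ M := by
    refine ⟨(eLpNorm f 2 volume * ENNReal.ofReal (Real.sqrt (Real.pi / y))).toReal, fun x => ?_⟩
    have h1 := norm_cauchyTransform_le_of_memLp hh (z := (x : ℂ) + y * I) (by simpa using hy.ne')
    have h2 : ((x : ℂ) + y * I).im = y := by simp
    rw [h2, abs_of_pos hy] at h1
    rw [← toReal_enorm]
    exact ENNReal.toReal_mono (ENNReal.mul_ne_top hh.eLpNorm_ne_top ENNReal.ofReal_ne_top) h1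
  have hFF := hF.mul_of_bounded hM
  have hint : Integrable (fun x => F x ^ 4) := by
    refine (integrable_mul_of_memLp_two hFF.1 hFF.1).congr (Eventually.of_forall fun x => ?_)
    simp only [Pi.mul_apply]; ring
  have hzero : ∫ x, F x ^ 4 = 0 := by
    rw [← integral_mul_eq_zero hFF hFF]
    congr 1 with x
    simp only [Pi.mul_apply]; ring
  have hn : Integrable (fun x => ‖F x‖ ^ 4) := by
    simpa using hint.norm
  have him : ∀ x, (F x).im ^ 4 = Real.pi ^ 4 * ‖poissonIntegral f x y‖ ^ 4 := fun x => by
    have h1 := im_cauchyTransform_ofReal (cauchyIntegrable_of_memLp hh) hy x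
    have h2 : ‖poissonIntegral f x y‖ = |∫ t, halfPlaneKernel x y t * h t| := by
      rw [hf, poissonIntegral_ofReal, norm_real, Real.norm_eq_abs]
    have h3 : (F x).im = _ := h1
    rw [h3, h2, mul_pow, Even.pow_abs (by decide)]
  have hP : Integrable (fun x => (F x).im ^ 4) := by
    refine hn.mono ((hF.1.1.im).pow 4) (Eventually.of_forall fun x => ?_)
    rw [norm_pow, norm_pow, norm_norm]
    gcongr
    exact abs_im_le_norm _
  have hre : ∫ x, (F x ^ 4).re = 0 := by
    have := integral_re hint
    simp only [RCLike.re_to_complex] at this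
    rw [this, hzero, zero_re]
  have hmain : ∫ x, ‖F x‖ ^ 4 ≤ ∫ x, 48 * (F x).im ^ 4 := by
    have h1 : Integrable fun x => (F x ^ 4).re := hint.re
    have h2 : ∫ x, ‖F x‖ ^ 4 ≤ ∫ x, (48 * (F x).im ^ 4 + 2 * (F x ^ 4).re) :=
      integral_mono hn ((hP.const_mul 48).add (h1.const_mul 2)) fun x => norm_pow_four_le _
    rwa [integral_add (hP.const_mul 48) (h1.const_mul 2), integral_const_mul 2, hre, mul_zero,
      add_zero] at h2
  -- 48 is rounded up to 81 = 3⁴, so that the fourth root is the integer 3.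
  have h81 : ∫ x, 48 * (F x).im ^ 4 ≤ ∫ x, (3 * Real.pi) ^ 4 * ‖poissonIntegral f x y‖ ^ 4 := by
    refine integral_mono (hP.const_mul 48) ?_ fun x => ?_
    · refine (hP.const_mul 81).congr (Eventually.of_forall fun x => ?_)
      simp only [him]; ring
    · simp only [him]
      have : 0 ≤ Real.pi ^ 4 * ‖poissonIntegral f x y‖ ^ 4 := by positivity
      nlinarith
  have hintP : Integrable fun x => (3 * Real.pi) ^ 4 * ‖poissonIntegral f x y‖ ^ 4 := by
    refine (hP.const_mul 81).congr (Eventually.of_forall fun x => ?_)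
    simp only [him]; ring
  have hfin := ENNReal.ofReal_le_ofReal (hmain.trans h81)
  rw [ofReal_integral_eq_lintegral_ofReal hn (Eventually.of_forall fun x => by positivity),
    ofReal_integral_eq_lintegral_ofReal hintP (Eventually.of_forall fun x => by positivity)] at hfin
  have hpi := Real.pi_pos
  have e1 : (fun x => ENNReal.ofReal ((3 * Real.pi) ^ 4 * ‖poissonIntegral f x y‖ ^ 4))
      = fun x => ENNReal.ofReal (‖((3 * Real.pi : ℝ) : ℂ) • poissonIntegral f x y‖ ^ 4) := by
    ext x
    rw [norm_smul, mul_pow ‖_‖, norm_real, Real.norm_of_nonneg (by positivity)]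
  rw [e1] at hfin
  have h4 := ENNReal.rpow_le_rpow hfin (by norm_num : (0 : ℝ) ≤ 1 / 4)
  rw [← eLpNorm_four, ← eLpNorm_four] at h4
  refine h4.trans ?_
  have e2 : (fun x => ((3 * Real.pi : ℝ) : ℂ) • poissonIntegral f x y)
      = ((3 * Real.pi : ℝ) : ℂ) • fun x => poissonIntegral f x y := rfl
  rw [e2, eLpNorm_const_smul]
  have e3 : ‖((3 * Real.pi : ℝ) : ℂ)‖ₑ = ENNReal.ofReal (3 * Real.pi) := by
    rw [← ofReal_norm, norm_real, Real.norm_of_nonneg (by positivity)]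
  rw [e3]
  gcongr
  exact eLpNorm_poissonIntegral_le hh.1 hy (by norm_num) (by norm_num)

/-- The Cauchy transform along horizontal lines is uniformly bounded on `L⁴`. -/
theorem eLpNorm_cauchyTransform_four_le {f : ℝ → ℂ} (hf : MemLp f 2 volume) {y : ℝ} (hy : 0 < y) :
    eLpNorm (fun x : ℝ => cauchyTransform f ((x : ℂ) + y * I)) 4 volume
      ≤ ENNReal.ofReal (6 * Real.pi) * eLpNorm f 4 volume := by
  have hre : MemLp (fun t => ((f t).re : ℂ)) 2 volume := hf.re.ofReal
  have him : MemLp (fun t => ((f t).im : ℂ)) 2 volume := hf.im.ofReal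
  have hre4 : eLpNorm (fun t => ((f t).re : ℂ)) 4 volume ≤ eLpNorm f 4 volume :=
    eLpNorm_mono fun x => by rw [norm_real]; exact abs_re_le_norm _
  have him4 : eLpNorm (fun t => ((f t).im : ℂ)) 4 volume ≤ eLpNorm f 4 volume :=
    eLpNorm_mono fun x => by rw [norm_real]; exact abs_im_le_norm _
  have h1 := (eLpNorm_cauchyTransform_ofReal_le hre hy).trans (mul_le_mul_right hre4 _)
  have h2 := (eLpNorm_cauchyTransform_ofReal_le him hy).trans (mul_le_mul_right him4 _)
  obtain ⟨C1, hC1⟩ := exists_hardyBound_cauchyTransform hre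
  obtain ⟨C2, hC2⟩ := exists_hardyBound_cauchyTransform him
  have heq : (fun x : ℝ => cauchyTransform f ((x : ℂ) + y * I))
      = (fun x : ℝ => cauchyTransform (fun t => ((f t).re : ℂ)) ((x : ℂ) + y * I))
        + I • fun x : ℝ => cauchyTransform (fun t => ((f t).im : ℂ)) ((x : ℂ) + y * I) := by
    ext x
    have hz : ((x : ℂ) + y * I).im ≠ 0 := by simpa using hy.ne'
    have e : f = (fun t => ((f t).re : ℂ)) + fun t => I * ((f t).im : ℂ) := by
      ext t; simp only [Pi.add_apply]; rw [mul_comm I, re_add_im]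
    conv_lhs => rw [e]
    rw [cauchyTransform_add (cauchyIntegrable_of_memLp hre)
      ((cauchyIntegrable_of_memLp him).const_mul I) hz, cauchyTransform_const_mul]
    rfl
  rw [heq]
  refine (eLpNorm_add_le (hC1.memLp hy).1 ((hC2.memLp hy).1.const_smul I) (by norm_num)).trans ?_
  rw [eLpNorm_const_smul]
  have : ‖I‖ₑ = 1 := by rw [← ofReal_norm, norm_I, ENNReal.ofReal_one]
  rw [this, one_mul]
  refine (add_le_add h1 h2).trans (le_of_eq ?_)
  have hpi := Real.pi_pos
  rw [← add_mul, ← ENNReal.ofReal_add (by positivity) (by positivity)]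
  congr 2; ring

theorem eLpNorm_conjFun (f : ℝ → ℂ) (p : ENNReal) :
    eLpNorm (conjFun f) p volume = eLpNorm f p volume :=
  eLpNorm_congr_norm_ae (Eventually.of_forall fun x => by simp [conjFun])

theorem eLpNorm_cauchyTransform_four_lower_le {f : ℝ → ℂ} (hf : MemLp f 2 volume) {y : ℝ}
    (hy : 0 < y) :
    eLpNorm (fun x : ℝ => cauchyTransform f ((x : ℂ) - y * I)) 4 volume
      ≤ ENNReal.ofReal (6 * Real.pi) * eLpNorm f 4 volume := by
  have h := eLpNorm_cauchyTransform_four_le (memLp_conjFun hf) hy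
  rw [eLpNorm_conjFun] at h
  refine le_trans (le_of_eq ?_) h
  refine eLpNorm_congr_norm_ae (Eventually.of_forall fun x => ?_)
  rw [cauchyTransform_lower_eq, norm_conj]

theorem holderTriple_four : ENNReal.HolderTriple 4 (4 / 3) 1 := by
  refine ⟨?_⟩
  rw [ENNReal.inv_div (by simp) (by simp), inv_one, ← one_div, ← ENNReal.add_div,
    show (1 + 3 : ENNReal) = 4 by norm_num, ENNReal.div_self (by simp) (by simp)]

theorem CauchyIntegrable.continuous_line {f : ℝ → ℂ} (hf : CauchyIntegrable f) {y : ℝ}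
    (hy : y ≠ 0) : Continuous fun x : ℝ => cauchyTransform f ((x : ℂ) + y * I) :=
  continuous_iff_continuousAt.2 fun x => ContinuousAt.comp (f := fun x : ℝ => (x : ℂ) + y * I)
    (hf.continuousAt (by simpa using hy)) (by fun_prop)

theorem lintegral_enorm_mul_le_four {f g : ℝ → ℂ} (hf : AEStronglyMeasurable f volume)
    (hg : AEStronglyMeasurable g volume) :
    ∫⁻ x, ‖f x * g x‖ₑ ≤ eLpNorm f 4 volume * eLpNorm g (4 / 3) volume := by
  have := holderTriple_four
  have h := eLpNorm_smul_le_mul_eLpNorm (p := 4) (q := 4 / 3) (r := 1) hg hf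
  rwa [eLpNorm_one_eq_lintegral_enorm] at h

/-- Fubini: exchanging the variables turns the kernel with pole x + iy into minus the kernel with
pole t - iy. The transpose of the upper transform is thus minus the lower one. -/
theorem integral_cauchyTransform_mul {b h : ℝ → ℂ} (hb : Integrable b) (hh : Integrable h) {y : ℝ}
    (hy : 0 < y) :
    ∫ x : ℝ, cauchyTransform b ((x : ℂ) + y * I) * h x
      = -∫ t : ℝ, b t * cauchyTransform h ((t : ℂ) - y * I) := by
  have hne : ∀ x t : ℝ, (t : ℂ) - ((x : ℂ) + y * I) ≠ 0 := fun x t =>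
    ofReal_sub_ne_zero (by simpa using hy.ne') t
  have hint : Integrable (fun p : ℝ × ℝ => b p.2 / ((p.2 : ℂ) - ((p.1 : ℂ) + y * I)) * h p.1)
      (volume.prod volume) := by
    have h1 := (hh.mul_prod hb).bdd_mul (c := 1 / y)
      (f := fun p : ℝ × ℝ => 1 / ((p.2 : ℂ) - ((p.1 : ℂ) + y * I)))
      (Measurable.aestronglyMeasurable (by fun_prop)) (Eventually.of_forall fun p => by
        have := norm_inv_sub_le (z := (p.1 : ℂ) + y * I) (by simpa using hy.ne') p.2
        have h2 : ((p.1 : ℂ) + y * I).im = y := by simp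
        rwa [h2, abs_of_pos hy] at this)
    refine h1.congr (Eventually.of_forall fun p => ?_)
    simp only
    ring
  have hl : ∀ x : ℝ, cauchyTransform b ((x : ℂ) + y * I) * h x
      = ∫ t : ℝ, b t / ((t : ℂ) - ((x : ℂ) + y * I)) * h x := fun x => by
    rw [integral_mul_const]; rfl
  simp_rw [hl]
  rw [integral_integral_swap hint, ← integral_neg]
  congr 1 with t
  unfold cauchyTransform
  rw [← integral_const_mul, ← integral_neg]
  congr 1 with x
  have h1 := hne x t
  have h2 : (x : ℂ) - ((t : ℂ) - y * I) ≠ 0 := ofReal_sub_ne_zero (by simpa using hy.ne') x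
  field_simp
  ring

/-- The function dual to `F` in the pairing of `L⁴` with `L^{4/3}`. -/
noncomputable def dualFun (F : ℝ → ℂ) (x : ℝ) : ℂ :=
  (starRingEnd ℂ) (F x) * ((‖F x‖ ^ (-(2 / 3) : ℝ) : ℝ) : ℂ)

theorem mul_dualFun (F : ℝ → ℂ) (x : ℝ) :
    F x * dualFun F x = ((‖F x‖ ^ (4 / 3 : ℝ) : ℝ) : ℂ) := by
  rw [dualFun, ← mul_assoc, mul_conj, normSq_eq_norm_sq, ← ofReal_mul]
  rcases eq_or_ne ‖F x‖ 0 with h | h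
  · rw [h, Real.zero_rpow (by norm_num)]; norm_num
  · have hp : 0 < ‖F x‖ := lt_of_le_of_ne (norm_nonneg _) h.symm
    rw [← Real.rpow_natCast, ← Real.rpow_add hp]
    norm_num

theorem norm_dualFun (F : ℝ → ℂ) (x : ℝ) : ‖dualFun F x‖ = ‖F x‖ ^ (1 / 3 : ℝ) := by
  rw [dualFun, norm_mul, norm_conj, norm_real, Real.norm_of_nonneg (by positivity)]
  rcases eq_or_ne ‖F x‖ 0 with h | h
  · rw [h, Real.zero_rpow (by norm_num)]; norm_num
  · have hp : 0 < ‖F x‖ := lt_of_le_of_ne (norm_nonneg _) h.symm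
    conv_lhs => rw [← Real.rpow_one ‖F x‖, ← Real.rpow_mul hp.le, ← Real.rpow_add hp]
    norm_num

theorem toReal_four_div_three : (4 / 3 : ENNReal).toReal = 4 / 3 := by simp

theorem eLpNorm_fourThirds (f : ℝ → ℂ) :
    eLpNorm f (4 / 3) volume = (∫⁻ x, ENNReal.ofReal (‖f x‖ ^ (4 / 3 : ℝ))) ^ (3 / 4 : ℝ) := by
  rw [eLpNorm_eq_lintegral_rpow_enorm_toReal (by norm_num) (by finiteness)]
  rw [toReal_four_div_three]
  norm_num
  congr 2 with x
  rw [← ofReal_norm, ENNReal.ofReal_rpow_of_nonneg (norm_nonneg _) (by norm_num)]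

/-- Duality with the L⁴ bound, tested on the extremal function `dualFun`. Truncation to a compact
interval makes the test function bounded with compact support and the quantity S finite. -/
theorem eLpNorm_indicator_cauchyTransform_le {b : ℝ → ℂ} (hb : Integrable b) {y : ℝ} (hy : 0 < y)
    (n : ℕ) :
    eLpNorm ((Set.Icc (-(n : ℝ)) n).indicator
        fun x : ℝ => cauchyTransform b ((x : ℂ) + y * I)) (4 / 3) volume
      ≤ ENNReal.ofReal (6 * Real.pi) * eLpNorm b (4 / 3) volume := by
  set s := Set.Icc (-(n : ℝ)) n
  set F : ℝ → ℂ := s.indicator fun x : ℝ => cauchyTransform b ((x : ℂ) + y * I) with hF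
  have hcont := (cauchyIntegrable_of_integrable hb).continuous_line hy.ne'
  have hFm : Measurable F := hcont.measurable.indicator measurableSet_Icc
  obtain ⟨M, hM⟩ : ∃ M : ℝ, ∀ x, ‖F x‖ ≤ M := by
    obtain ⟨M, hM⟩ := isCompact_Icc.exists_bound_of_continuousOn (s := s) hcont.continuousOn
    refine ⟨max M 0, fun x => ?_⟩
    by_cases hx : x ∈ s
    · rw [hF, Set.indicator_of_mem hx]; exact (hM x hx).trans (le_max_left _ _)
    · rw [hF, Set.indicator_of_notMem hx, norm_zero]; exact le_max_right _ _
  set h := dualFun F with hh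
  have hhm : Measurable h := by unfold dualFun at hh; rw [hh]; fun_prop
  have hhz : ∀ x, x ∉ s → h x = 0 := fun x hx => by
    rw [← norm_eq_zero, norm_dualFun, hF, Set.indicator_of_notMem hx, norm_zero,
      Real.zero_rpow (by norm_num)]
  have hM0 : 0 ≤ M := (norm_nonneg _).trans (hM 0)
  have hhmem : ∀ p, MemLp h p volume := fun p => by
    refine ((memLp_indicator_one (K := s) isCompact_Icc p).const_mul
      ((M ^ (1 / 3 : ℝ) : ℝ) : ℂ)).mono hhm.aestronglyMeasurable (Eventually.of_forall fun x => ?_)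
    by_cases hx : x ∈ s
    · rw [Set.indicator_of_mem hx, norm_dualFun, mul_one, norm_real,
        Real.norm_of_nonneg (by positivity)]
      exact Real.rpow_le_rpow (norm_nonneg _) (hM x) (by norm_num)
    · rw [hhz x hx, norm_zero]; positivity
  have hhi : Integrable h := memLp_one_iff_integrable.1 (hhmem 1)
  have hprod : ∀ x : ℝ, cauchyTransform b ((x : ℂ) + y * I) * h x
      = ((‖F x‖ ^ (4 / 3 : ℝ) : ℝ) : ℂ) := fun x => by
    rw [← mul_dualFun]
    by_cases hx : x ∈ s
    · rw [hF, Set.indicator_of_mem hx]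
    · rw [← hh, hhz x hx]; simp
  have hFi : Integrable fun x => ‖F x‖ ^ (4 / 3 : ℝ) := by
    have h1 : Integrable fun x => F x * h x :=
      hhi.bdd_mul hFm.aestronglyMeasurable (Eventually.of_forall hM)
    refine h1.re.congr (Eventually.of_forall fun x => ?_)
    simp only [hh, mul_dualFun, RCLike.re_to_complex, ofReal_re]
  set S := ∫⁻ x, ENNReal.ofReal (‖F x‖ ^ (4 / 3 : ℝ)) with hS
  have hS1 : S = ‖∫ x : ℝ, cauchyTransform b ((x : ℂ) + y * I) * h x‖ₑ := by
    simp_rw [hprod]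
    rw [integral_complex_ofReal, ← ofReal_norm, norm_real,
      Real.norm_of_nonneg (integral_nonneg fun x => by positivity),
      ofReal_integral_eq_lintegral_ofReal hFi (Eventually.of_forall fun x => by positivity)]
  have hStop : S ≠ ⊤ := by rw [hS1]; exact enorm_ne_top
  have hh4 : eLpNorm h 4 volume = S ^ (1 / 4 : ℝ) := by
    rw [eLpNorm_four]
    congr 2 with x
    rw [norm_dualFun, ← Real.rpow_natCast, ← Real.rpow_mul (norm_nonneg _)]
    norm_num
  have hkey : S ≤ ENNReal.ofReal (6 * Real.pi) * S ^ (1 / 4 : ℝ) * eLpNorm b (4 / 3) volume := by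
    conv_lhs => rw [hS1, integral_cauchyTransform_mul hb hhi hy, enorm_neg]
    refine (enorm_integral_le_lintegral_enorm _).trans ?_
    simp_rw [mul_comm (b _)]
    have hcl : Continuous fun x : ℝ => cauchyTransform h ((x : ℂ) - y * I) := by
      simpa [sub_eq_add_neg] using
        (cauchyIntegrable_of_integrable hhi).continuous_line (neg_ne_zero.2 hy.ne')
    refine (lintegral_enorm_mul_le_four hcl.aestronglyMeasurable hb.1).trans ?_
    rw [← hh4]
    gcongr
    exact eLpNorm_cauchyTransform_four_lower_le (hhmem 2) hy
  rw [eLpNorm_fourThirds]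
  change S ^ (3 / 4 : ℝ) ≤ _
  rcases eq_or_ne S 0 with h0 | h0
  · rw [h0, ENNReal.zero_rpow_of_pos (by norm_num)]; exact zero_le
  -- The estimate bounds S by a constant times S^{1/4}; finiteness and positivity of S allow the
  -- common factor to be cancelled.
  have h1 : S = S ^ (1 / 4 : ℝ) * S ^ (3 / 4 : ℝ) := by
    rw [← ENNReal.rpow_add _ _ h0 hStop]; norm_num
  have h2 : S ^ (1 / 4 : ℝ) * S ^ (3 / 4 : ℝ)
      ≤ S ^ (1 / 4 : ℝ) * (ENNReal.ofReal (6 * Real.pi) * eLpNorm b (4 / 3) volume) := by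
    rw [← h1]
    refine hkey.trans (le_of_eq (by ring))
  refine (ENNReal.mul_le_mul_iff_right ?_ ?_).1 h2
  · exact (ENNReal.rpow_pos (pos_iff_ne_zero.2 h0) hStop).ne'
  · exact ENNReal.rpow_ne_top_of_nonneg (by norm_num) hStop

theorem eLpNorm_cauchyTransform_fourThirds_le {b : ℝ → ℂ} (hb : Integrable b) {y : ℝ}
    (hy : 0 < y) :
    eLpNorm (fun x : ℝ => cauchyTransform b ((x : ℂ) + y * I)) (4 / 3) volume
      ≤ ENNReal.ofReal (6 * Real.pi) * eLpNorm b (4 / 3) volume := by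
  have hcont := (cauchyIntegrable_of_integrable hb).continuous_line hy.ne'
  refine (Lp.eLpNorm_lim_le_liminf_eLpNorm (f := fun n : ℕ => (Set.Icc (-(n : ℝ)) n).indicator
    fun x : ℝ => cauchyTransform b ((x : ℂ) + y * I))
    (fun n => (hcont.measurable.indicator measurableSet_Icc).aestronglyMeasurable) _
    (Eventually.of_forall fun x => ?_)).trans ?_
  · obtain ⟨N, hN⟩ := exists_nat_ge |x|
    refine tendsto_const_nhds.congr' ?_
    filter_upwards [eventually_ge_atTop N] with n hn
    rw [Set.indicator_of_mem]
    exact abs_le.1 (hN.trans (by exact_mod_cast hn))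
  · exact liminf_le_of_frequently_le'
      (Frequently.of_forall fun n => eLpNorm_indicator_cauchyTransform_le hb hy n)

/-- Fatou's lemma along the heights 1/(n + 1). -/
theorem eLpNorm_cauchyUpper_le {f : ℝ → ℂ} (hf : CauchyIntegrable f) {p K : ENNReal}
    (h : ∀ y : ℝ, 0 < y →
      eLpNorm (fun x : ℝ => cauchyTransform f ((x : ℂ) + y * I)) p volume ≤ K) :
    eLpNorm (cauchyUpper f) p volume ≤ K := by
  have hpos : ∀ n : ℕ, (0 : ℝ) < 1 / (n + 1) := fun n => by positivity
  have hlim : Tendsto (fun n : ℕ => (1 : ℝ) / (n + 1)) atTop (𝓝[>] 0) :=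
    tendsto_nhdsWithin_iff.2 ⟨tendsto_one_div_add_atTop_nhds_zero_nat, Eventually.of_forall hpos⟩
  refine (Lp.eLpNorm_lim_le_liminf_eLpNorm
    (f := fun (n : ℕ) (x : ℝ) => cauchyTransform f ((x : ℂ) + ((1 / (n + 1) : ℝ) : ℂ) * I))
    (fun n => (hf.continuous_line (hpos n).ne').aestronglyMeasurable) _ ?_).trans
    (liminf_le_of_frequently_le' (Frequently.of_forall fun n => h _ (hpos n)))
  filter_upwards [hf.ae_tendsto_upper] with k hk
  exact hk.comp hlim

theorem aestronglyMeasurable_cauchyUpper {f : ℝ → ℂ} (hf : CauchyIntegrable f) :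
    AEStronglyMeasurable (cauchyUpper f) volume := by
  have hpos : ∀ n : ℕ, (0 : ℝ) < 1 / (n + 1) := fun n => by positivity
  have hlim : Tendsto (fun n : ℕ => (1 : ℝ) / (n + 1)) atTop (𝓝[>] 0) :=
    tendsto_nhdsWithin_iff.2 ⟨tendsto_one_div_add_atTop_nhds_zero_nat, Eventually.of_forall hpos⟩
  refine aestronglyMeasurable_of_tendsto_ae atTop
    (f := fun (n : ℕ) (x : ℝ) => cauchyTransform f ((x : ℂ) + ((1 / (n + 1) : ℝ) : ℂ) * I))
    (fun n => (hf.continuous_line (hpos n).ne').aestronglyMeasurable) ?_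
  filter_upwards [hf.ae_tendsto_upper] with k hk
  exact hk.comp hlim

theorem eLpNorm_cauchyUpper_four_le {f : ℝ → ℂ} (hf : MemLp f 2 volume) :
    eLpNorm (cauchyUpper f) 4 volume ≤ ENNReal.ofReal (6 * Real.pi) * eLpNorm f 4 volume :=
  eLpNorm_cauchyUpper_le (cauchyIntegrable_of_memLp hf)
    fun _ hy => eLpNorm_cauchyTransform_four_le hf hy

theorem eLpNorm_cauchyUpper_fourThirds_le {f : ℝ → ℂ} (hf : Integrable f) :
    eLpNorm (cauchyUpper f) (4 / 3) volume
      ≤ ENNReal.ofReal (6 * Real.pi) * eLpNorm f (4 / 3) volume :=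
  eLpNorm_cauchyUpper_le (cauchyIntegrable_of_integrable hf)
    fun _ hy => eLpNorm_cauchyTransform_fourThirds_le hf hy

theorem enorm_cauchyTransform_mul_le {f g : ℝ → ℂ} (hf : AEStronglyMeasurable f volume)
    (hg : AEStronglyMeasurable g volume) {z : ℂ} (hz : z.im ≠ 0) :
    ‖cauchyTransform (f * g) z‖ₑ
      ≤ ENNReal.ofReal (1 / |z.im|) * (eLpNorm f 4 volume * eLpNorm g (4 / 3) volume) := by
  refine (enorm_integral_le_lintegral_enorm _).trans ?_
  refine le_trans ?_ (mul_le_mul_right (lintegral_enorm_mul_le_four hf hg) _)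
  rw [← lintegral_const_mul' _ _ ENNReal.ofReal_ne_top]
  refine lintegral_mono fun x => ?_
  rw [div_eq_mul_one_div, mul_comm, enorm_mul, Pi.mul_apply]
  gcongr
  rw [← ofReal_norm]
  exact ENNReal.ofReal_le_ofReal (norm_inv_sub_le hz x)

/-- Approximate b in L^{4/3} by simple functions s, which are also in L². For s the product of
boundary values is one of two Hardy functions and has no transform below the line; the remainder is
small by Hölder with exponents 4 and 4/3. -/
theorem isUpperBoundary_mul_of_L4 {a b : ℝ → ℂ} (ha : MemLp a 2 volume) (ha4 : MemLp a 4 volume)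
    (hb : Integrable b) (hb4 : MemLp b (4 / 3) volume) :
    IsUpperBoundary (cauchyUpper a * cauchyUpper b) := by
  have hA : MemLp (cauchyUpper a) 4 volume :=
    ⟨aestronglyMeasurable_cauchyUpper (cauchyIntegrable_of_memLp ha),
      (eLpNorm_cauchyUpper_four_le ha).trans_lt
        (ENNReal.mul_lt_top ENNReal.ofReal_lt_top ha4.eLpNorm_lt_top)⟩
  have hBm := aestronglyMeasurable_cauchyUpper (cauchyIntegrable_of_integrable hb)
  have hB : MemLp (cauchyUpper b) (4 / 3) volume :=
    ⟨hBm, (eLpNorm_cauchyUpper_fourThirds_le hb).trans_lt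
        (ENNReal.mul_lt_top ENNReal.ofReal_lt_top hb4.eLpNorm_lt_top)⟩
  have hAB : Integrable (cauchyUpper a * cauchyUpper b) :=
    ⟨hA.1.mul hBm, (lintegral_enorm_mul_le_four hA.1 hBm).trans_lt
      (ENNReal.mul_lt_top hA.eLpNorm_lt_top hB.eLpNorm_lt_top)⟩
  refine ⟨cauchyIntegrable_of_integrable hAB, fun z hz => ?_⟩
  set K := ENNReal.ofReal (1 / |z.im|) * (eLpNorm (cauchyUpper a) 4 volume
    * ENNReal.ofReal (6 * Real.pi)) with hK
  have hKtop : K ≠ ⊤ := ENNReal.mul_ne_top ENNReal.ofReal_ne_top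
    (ENNReal.mul_ne_top hA.eLpNorm_ne_top ENNReal.ofReal_ne_top)
  have hbound : ∀ ε : ENNReal, ε ≠ 0 →
      ‖cauchyTransform (cauchyUpper a * cauchyUpper b) z‖ₑ ≤ K * ε := fun ε hε => by
    obtain ⟨s, hs, hsp⟩ : ∃ s : ℝ → ℂ, eLpNorm (b - s) (4 / 3) volume < ε ∧
        ∀ p, MemLp s p volume := by
      obtain ⟨t, ht, ht2⟩ := hb4.exists_simpleFunc_eLpNorm_sub_lt (by finiteness) hε
      exact ⟨t, ht, fun p => SimpleFunc.memLp_of_finite_measure_preimage p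
        ((SimpleFunc.memLp_iff (by norm_num) (by finiteness)).1 ht2)⟩
    have hs1 : Integrable s := memLp_one_iff_integrable.1 (hsp 1)
    have hbs : Integrable (b - s) := hb.sub hs1
    have hsplit : cauchyUpper b =ᵐ[volume] cauchyUpper (b - s) + cauchyUpper s := by
      have := cauchyUpper_add (cauchyIntegrable_of_integrable hbs) (cauchyIntegrable_of_integrable hs1)
      rwa [sub_add_cancel] at this
    have hU2 := isUpperBoundary_mul_of_L2 ha (hsp 2)
    have hm := aestronglyMeasurable_cauchyUpper (cauchyIntegrable_of_integrable hbs)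
    have hprod : cauchyUpper a * cauchyUpper b
        =ᵐ[volume] cauchyUpper a * cauchyUpper (b - s) + cauchyUpper a * cauchyUpper s := by
      filter_upwards [hsplit] with x hx
      simp only [Pi.mul_apply, Pi.add_apply] at hx ⊢
      rw [hx, mul_add]
    have hci : CauchyIntegrable (cauchyUpper a * cauchyUpper (b - s)) :=
      ((cauchyIntegrable_of_integrable hAB).sub hU2.1).congr (by
        filter_upwards [hprod] with x hx
        simp only [Pi.sub_apply, hx, Pi.add_apply, add_sub_cancel_right])
    rw [cauchyTransform_congr hprod, cauchyTransform_add hci hU2.1 hz.ne, hU2.2 z hz, add_zero]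
    refine (enorm_cauchyTransform_mul_le hA.1 hm hz.ne).trans ?_
    rw [hK, mul_assoc, mul_assoc]
    gcongr
    exact (eLpNorm_cauchyUpper_fourThirds_le hbs).trans (by gcongr)
  rw [← enorm_eq_zero]
  refine le_antisymm (ENNReal.le_of_forall_pos_le_add fun ε hε _ => ?_) zero_le
  rw [zero_add]
  have hε' : (ε : ENNReal) / (K + 1) ≠ 0 :=
    (ENNReal.div_pos (by exact_mod_cast hε.ne') (by finiteness)).ne'
  refine (hbound _ hε').trans ?_
  rw [← mul_div_assoc]
  refine ENNReal.div_le_of_le_mul ?_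
  rw [mul_comm]
  gcongr
  exact le_self_add

/-! ### Boundary form of the orthogonality condition -/

section

theorem cauchyTransform_eq_conj (f : ℝ → ℂ) (z : ℂ) :
    cauchyTransform f z
      = (starRingEnd ℂ) (cauchyTransform (conjFun f) ((starRingEnd ℂ) z)) := by
  rw [cauchyTransform_conj, conj_conj]

/-- The expression is of bounded type, being built from Cauchy transforms by sums and products, so
it vanishes above the line exactly when its boundary values vanish a.e. -/
theorem bilinear_eq_zero_iff {w a b c : ℝ → ℂ} (hw : CauchyIntegrable w) (ha : CauchyIntegrable a)
    (hb : CauchyIntegrable b) (hc : CauchyIntegrable c) :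
    (∀ z : ℂ, 0 < z.im → (1 + cauchyTransform w z) * cauchyTransform a z
        - cauchyTransform b z * cauchyTransform c z = 0) ↔
      ∀ᵐ k : ℝ, (1 + cauchyUpper w k) * cauchyUpper a k - cauchyUpper b k * cauchyUpper c k = 0 := by
  have hlim : ∀ᵐ k : ℝ, Tendsto (fun ε : ℝ =>
      (1 + cauchyTransform w ((k : ℂ) + ε * I)) * cauchyTransform a ((k : ℂ) + ε * I)
        - cauchyTransform b ((k : ℂ) + ε * I) * cauchyTransform c ((k : ℂ) + ε * I)) (𝓝[>] 0)
      (𝓝 ((1 + cauchyUpper w k) * cauchyUpper a k - cauchyUpper b k * cauchyUpper c k)) := by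
    filter_upwards [hw.ae_tendsto_upper, ha.ae_tendsto_upper, hb.ae_tendsto_upper,
      hc.ae_tendsto_upper] with k h1 h2 h3 h4
    exact ((h1.const_add 1).mul h2).sub (h3.mul h4)
  constructor
  · intro h
    filter_upwards [hlim] with k hk
    refine tendsto_nhds_unique hk (tendsto_const_nhds.congr'
      (eventually_nhdsWithin_of_forall fun ε hε => ?_))
    exact (h _ (by simpa using hε)).symm
  · intro h z hz
    have hbt : BoundedType fun z => (1 + cauchyTransform w z) * cauchyTransform a z
        - cauchyTransform b z * cauchyTransform c z :=
      (((BoundedType.const 1).add hw.boundedType).mul ha.boundedType).sub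
        (hb.boundedType.mul hc.boundedType)
    refine hbt.eq_zero ?_ hz
    filter_upwards [hlim, h] with k hk hk0
    rwa [hk0] at hk

theorem bilinear_eq_zero_iff_lower {w a b c : ℝ → ℂ} (hw : CauchyIntegrable w)
    (ha : CauchyIntegrable a) (hb : CauchyIntegrable b) (hc : CauchyIntegrable c) :
    (∀ z : ℂ, z.im < 0 → (1 + cauchyTransform w z) * cauchyTransform a z
        - cauchyTransform b z * cauchyTransform c z = 0) ↔
      ∀ᵐ k : ℝ, (1 + cauchyLower w k) * cauchyLower a k - cauchyLower b k * cauchyLower c k = 0 := by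
  have h1 : (∀ z : ℂ, z.im < 0 → (1 + cauchyTransform w z) * cauchyTransform a z
        - cauchyTransform b z * cauchyTransform c z = 0) ↔
      ∀ z : ℂ, 0 < z.im →
        (1 + cauchyTransform (conjFun w) z) * cauchyTransform (conjFun a) z
        - cauchyTransform (conjFun b) z * cauchyTransform (conjFun c) z = 0 := by
    have key : ∀ z : ℂ, (1 + cauchyTransform (conjFun w) z) * cauchyTransform (conjFun a) z
        - cauchyTransform (conjFun b) z * cauchyTransform (conjFun c) z
        = (starRingEnd ℂ) ((1 + cauchyTransform w ((starRingEnd ℂ) z))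
            * cauchyTransform a ((starRingEnd ℂ) z)
          - cauchyTransform b ((starRingEnd ℂ) z) * cauchyTransform c ((starRingEnd ℂ) z)) :=
        fun z => by
      rw [cauchyTransform_eq_conj (conjFun w), cauchyTransform_eq_conj (conjFun a),
        cauchyTransform_eq_conj (conjFun b), cauchyTransform_eq_conj (conjFun c)]
      simp only [conjFun_conjFun, map_sub, map_mul, map_add, map_one]
    constructor
    · intro h z hz
      rw [key, h _ (by simpa using hz), map_zero]
    · intro h z hz
      have := h ((starRingEnd ℂ) z) (by simpa using hz)
      rw [key, conj_conj] at this
      exact (map_eq_zero (starRingEnd ℂ)).1 this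
  rw [h1, bilinear_eq_zero_iff hw.conj ha.conj hb.conj hc.conj]
  have h2 : ∀ᵐ k : ℝ,
      (1 + cauchyLower w k) * cauchyLower a k - cauchyLower b k * cauchyLower c k
      = (starRingEnd ℂ) ((1 + cauchyUpper (conjFun w) k) * cauchyUpper (conjFun a) k
        - cauchyUpper (conjFun b) k * cauchyUpper (conjFun c) k) := by
    filter_upwards [hw.lower_eq, ha.lower_eq, hb.lower_eq, hc.lower_eq] with k e1 e2 e3 e4
    rw [e1, e2, e3, e4]
    simp only [conjFun, map_sub, map_mul, map_add, map_one]
  constructor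
  · intro h
    filter_upwards [h, h2] with k hk hk2
    rw [hk2, hk, map_zero]
  · intro h
    filter_upwards [h, h2] with k hk hk2
    rw [hk2] at hk
    exact (map_eq_zero (starRingEnd ℂ)).1 hk

variable (φ ψ : L2)

theorem ae_tendsto_perturbDet_upper :
    ∀ᵐ k : ℝ, Tendsto (fun ε : ℝ => perturbDet φ ψ ((k : ℂ) + ε * I)) (𝓝[>] 0)
      (𝓝 (1 + cauchyUpper (ψ * conjFun φ) k)) := by
  filter_upwards [(cauchyIntegrable_mul_conj_L2 ψ φ).ae_tendsto_upper] with k hk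
  simp_rw [perturbDet_eq]
  exact hk.const_add 1

theorem ae_tendsto_perturbDet_lower :
    ∀ᵐ k : ℝ, Tendsto (fun ε : ℝ => perturbDet φ ψ ((k : ℂ) - ε * I)) (𝓝[>] 0)
      (𝓝 (1 + cauchyLower (ψ * conjFun φ) k)) := by
  filter_upwards [(cauchyIntegrable_mul_conj_L2 ψ φ).ae_tendsto_lower] with k hk
  simp_rw [perturbDet_eq]
  exact hk.const_add 1

theorem detPlus_eq : ∀ᵐ k : ℝ, detPlus φ ψ k = 1 + cauchyUpper (ψ * conjFun φ) k := by
  filter_upwards [ae_tendsto_perturbDet_upper φ ψ] with k hk using hk.limUnder_eq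

theorem detMinus_eq : ∀ᵐ k : ℝ, detMinus φ ψ k = 1 + cauchyLower (ψ * conjFun φ) k := by
  filter_upwards [ae_tendsto_perturbDet_lower φ ψ] with k hk using hk.limUnder_eq

theorem hasBoundaryValues_perturbDet : HasBoundaryValues (perturbDet φ ψ) := by
  filter_upwards [ae_tendsto_perturbDet_upper φ ψ, ae_tendsto_perturbDet_lower φ ψ] with k h1 h2
  exact ⟨⟨_, h1⟩, ⟨_, h2⟩⟩

theorem one_add_cauchyUpper_ne_zero {w : ℝ → ℂ} (hw : CauchyIntegrable w)
    (h : ∃ z : ℂ, 0 < z.im ∧ 1 + cauchyTransform w z ≠ 0) :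
    ∀ᵐ k : ℝ, 1 + cauchyUpper w k ≠ 0 := by
  filter_upwards [((BoundedType.const 1).add hw.boundedType).ae_boundary.2 h, hw.ae_tendsto_upper]
    with k ⟨l, hl0, hl⟩ hk
  rwa [tendsto_nhds_unique (hk.const_add 1) hl]

theorem det_ne_zero : ∀ᵐ k : ℝ, detPlus φ ψ k ≠ 0 ∧ detMinus φ ψ k ≠ 0 := by
  obtain ⟨y, hy, h1, h2⟩ := exists_perturbDet_ne_zero φ ψ
  have hw := cauchyIntegrable_mul_conj_L2 ψ φ
  rw [perturbDet_eq] at h1 h2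
  have h3 : 1 + cauchyTransform (conjFun (ψ * conjFun φ)) (y * I) ≠ 0 := fun h => by
    rw [cauchyTransform_eq_conj, conjFun_conjFun] at h
    apply h2
    have := congrArg (starRingEnd ℂ) h
    simpa using this
  filter_upwards [detPlus_eq φ ψ, detMinus_eq φ ψ, hw.lower_eq,
    one_add_cauchyUpper_ne_zero hw ⟨y * I, by simpa using hy, h1⟩,
    one_add_cauchyUpper_ne_zero hw.conj ⟨y * I, by simpa using hy, h3⟩] with k e1 e2 e3 n1 n2
  rw [e1, e2, e3]
  refine ⟨n1, fun h => n2 ?_⟩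
  have := congrArg (starRingEnd ℂ) h
  simpa [conjFun] using this

/-- Boundary values from above of the function `defectFun`. -/
noncomputable def upperDefect (g : L2) (k : ℝ) : ℂ :=
  detPlus φ ψ k * cauchyUpper (conjFun g) k
    - cauchyUpper (conjFun φ) k * cauchyUpper (ψ * conjFun g) k

/-- Boundary values from below of the function `defectFun`. -/
noncomputable def lowerDefect (g : L2) (k : ℝ) : ℂ :=
  detMinus φ ψ k * cauchyLower (conjFun g) k
    - cauchyLower (conjFun φ) k * cauchyLower (ψ * conjFun g) k

theorem mem_orthogonal_iff_boundary (g : L2) :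
    g ∈ (detectableSubspace φ ψ)ᗮ ↔
      (∀ᵐ k : ℝ, upperDefect φ ψ g k = 0) ∧ ∀ᵐ k : ℝ, lowerDefect φ ψ g k = 0 := by
  have hw := cauchyIntegrable_mul_conj_L2 ψ φ
  have ha := cauchyIntegrable_conj_L2 g
  have hb := cauchyIntegrable_conj_L2 φ
  have hc := cauchyIntegrable_mul_conj_L2 ψ g
  have h1 : (∀ᵐ k : ℝ, upperDefect φ ψ g k = 0) ↔
      ∀ z : ℂ, 0 < z.im → defectFun φ ψ g z = 0 := by
    simp only [defectFun, perturbDet_eq]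
    rw [bilinear_eq_zero_iff hw ha hb hc]
    refine eventually_congr ?_
    filter_upwards [detPlus_eq φ ψ] with k hk
    rw [upperDefect, hk]
  have h2 : (∀ᵐ k : ℝ, lowerDefect φ ψ g k = 0) ↔
      ∀ z : ℂ, z.im < 0 → defectFun φ ψ g z = 0 := by
    simp only [defectFun, perturbDet_eq]
    rw [bilinear_eq_zero_iff_lower hw ha hb hc]
    refine eventually_congr ?_
    filter_upwards [detMinus_eq φ ψ] with k hk
    rw [lowerDefect, hk]
  rw [mem_orthogonal_iff_defectFun, h1, h2]
  exact ⟨fun h => ⟨fun z hz => h z hz.ne', fun z hz => h z hz.ne⟩,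
    fun h z hz => hz.lt_or_gt.elim (h.2 z) (h.1 z)⟩

theorem rieszPlus_eq (f : ℝ → ℂ) (k : ℝ) :
    rieszPlus f k = 1 / (2 * Real.pi * I) * cauchyUpper f k := rfl

theorem rieszMinus_eq (f : ℝ → ℂ) (k : ℝ) :
    rieszMinus f k = -(1 / (2 * Real.pi * I)) * cauchyLower f k := rfl

theorem CauchyIntegrable.rieszPlus_add_rieszMinus {f : ℝ → ℂ} (hf : CauchyIntegrable f) :
    ∀ᵐ k : ℝ, rieszPlus f k + rieszMinus f k = f k := by
  filter_upwards [hf.upper_sub_lower] with k hk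
  have := two_pi_I_ne
  rw [rieszPlus_eq, rieszMinus_eq]
  field_simp
  linear_combination hk

/-- Up to sign the two expressions are the boundary defects divided by 2πi D₊ and 2πi D₋, which are
non-zero a.e. -/
theorem mem_orthogonal_iff_riesz (g : L2) :
    g ∈ (detectableSubspace φ ψ)ᗮ ↔
      (∀ᵐ k : ℝ, rieszPlus (conjFun g) k - 2 * Real.pi * I / detPlus φ ψ k
          * rieszPlus (conjFun φ) k * rieszPlus (ψ * conjFun g) k = 0) ∧
      (∀ᵐ k : ℝ, rieszMinus (conjFun g) k + 2 * Real.pi * I / detMinus φ ψ k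
          * rieszMinus (conjFun φ) k * rieszMinus (ψ * conjFun g) k = 0) := by
  rw [mem_orthogonal_iff_boundary]
  have hne := two_pi_I_ne
  refine and_congr (eventually_congr ?_) (eventually_congr ?_)
  · filter_upwards [det_ne_zero φ ψ] with k hk
    have h1 := hk.1
    have : rieszPlus (conjFun g) k - 2 * Real.pi * I / detPlus φ ψ k
          * rieszPlus (conjFun φ) k * rieszPlus (ψ * conjFun g) k
        = upperDefect φ ψ g k / (2 * Real.pi * I * detPlus φ ψ k) := by
      rw [upperDefect]
      simp only [rieszPlus_eq]
      field_simp
    rw [this, div_eq_zero_iff, or_iff_left (mul_ne_zero hne h1)]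
  · filter_upwards [det_ne_zero φ ψ] with k hk
    have h1 := hk.2
    have : rieszMinus (conjFun g) k + 2 * Real.pi * I / detMinus φ ψ k
          * rieszMinus (conjFun φ) k * rieszMinus (ψ * conjFun g) k
        = -(lowerDefect φ ψ g k / (2 * Real.pi * I * detMinus φ ψ k)) := by
      rw [lowerDefect]
      simp only [rieszMinus_eq]
      field_simp
      ring
    rw [this, neg_eq_zero, div_eq_zero_iff, or_iff_left (mul_ne_zero hne h1)]

end

/-! ### The Hardy space criterion, and the jump of the defect -/

section

theorem differentiableOn_conj_comp_conj {F : ℂ → ℂ} {U V : Set ℂ} (hU : IsOpen U)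
    (hF : DifferentiableOn ℂ F U) (hVU : ∀ z ∈ V, (starRingEnd ℂ) z ∈ U) :
    DifferentiableOn ℂ (fun z => (starRingEnd ℂ) (F ((starRingEnd ℂ) z))) V := fun z hz => by
  have h := (hF _ (hVU z hz)).differentiableAt (hU.mem_nhds (hVU z hz))
  have := h.conj_conj
  rw [conj_conj] at this
  exact this.differentiableWithinAt

/-- Reflection in the real line: F(z) is replaced by the conjugate of F at the conjugate point. -/
theorem isHardyMinus_iff {u : ℝ → ℂ} : IsHardyMinus u ↔ IsPlus (conjFun u) := by
  rw [← isHardyPlus_iff]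
  have hline : ∀ x y : ℝ, (starRingEnd ℂ) ((x : ℂ) - y * I) = (x : ℂ) + y * I := fun x y => by
    rw [← conj_line, conj_conj]
  constructor
  · rintro ⟨F, hF, ⟨C, hC⟩, hlim⟩
    refine ⟨fun z => (starRingEnd ℂ) (F ((starRingEnd ℂ) z)),
      differentiableOn_conj_comp_conj (isOpen_lt continuous_im continuous_const) hF
        fun z hz => by simpa using hz, ⟨C, fun y hy => ?_⟩, ?_⟩
    · simp_rw [conj_line]
      exact (eLpNorm_conjFun _ _).trans_le (hC y hy)
    · filter_upwards [hlim] with x hx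
      simp_rw [conj_line]
      exact (continuous_conj.tendsto _).comp hx
  · rintro ⟨F, hF, ⟨C, hC⟩, hlim⟩
    refine ⟨fun z => (starRingEnd ℂ) (F ((starRingEnd ℂ) z)),
      differentiableOn_conj_comp_conj (isOpen_lt continuous_const continuous_im) hF
        fun z hz => by simpa using hz, ⟨C, fun y hy => ?_⟩, ?_⟩
    · simp_rw [hline]
      exact (eLpNorm_conjFun _ _).trans_le (hC y hy)
    · filter_upwards [hlim] with x hx
      simp_rw [hline]
      have := (continuous_conj.tendsto _).comp hx
      rwa [conjFun, conj_conj] at this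

theorem isPlus_rieszPlus {f : ℝ → ℂ} (hf : MemLp f 2 volume) : IsPlus (rieszPlus f) := by
  obtain ⟨u, v, hu, hv, -, h⟩ := exists_isPlus_decomp hf
  exact hu.congr (rieszPlus_of_decomp hu hv h).symm

theorem isPlus_conj_rieszMinus {f : ℝ → ℂ} (hf : MemLp f 2 volume) :
    IsPlus (conjFun (rieszMinus f)) := by
  obtain ⟨u, v, hu, hv, -, h⟩ := exists_isPlus_decomp hf
  refine hv.congr ?_
  filter_upwards [rieszMinus_of_decomp hu hv h] with k hk
  rw [conjFun, conjFun, hk]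

theorem IsPlus.conj_const_mul {u : ℝ → ℂ} (c : ℂ) (hu : IsPlus (conjFun u)) :
    IsPlus (conjFun fun x => c * u x) :=
  (hu.const_mul ((starRingEnd ℂ) c)).congr (Eventually.of_forall fun x => by simp [conjFun])

theorem memLp_rieszMinus {f : ℝ → ℂ} (hf : MemLp f 2 volume) : MemLp (rieszMinus f) 2 volume := by
  rw [← conjFun_conjFun (rieszMinus f)]
  exact memLp_conjFun (isPlus_conj_rieszMinus hf).1

variable (φ ψ : L2)

/-- The three conditions decompose ḡ into an upper and a lower Hardy function. Such a decomposition
is unique, so the two terms must be P₊ḡ and P₋ḡ, which is the previous criterion. -/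
theorem mem_orthogonal_iff_hardy (g : L2) :
    g ∈ (detectableSubspace φ ψ)ᗮ ↔
      IsHardyPlus (fun k => rieszPlus (conjFun φ) k * rieszPlus (ψ * conjFun g) k
        / detPlus φ ψ k) ∧
      IsHardyMinus (fun k => rieszMinus (conjFun φ) k * rieszMinus (ψ * conjFun g) k
        / detMinus φ ψ k) ∧
      (∀ᵐ k : ℝ, conjFun g k
        - 2 * Real.pi * I / detPlus φ ψ k
          * rieszPlus (conjFun φ) k * rieszPlus (ψ * conjFun g) k
        + 2 * Real.pi * I / detMinus φ ψ k
          * rieszMinus (conjFun φ) k * rieszMinus (ψ * conjFun g) k = 0) := by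
  have hg := memLp_conjFun (Lp.memLp g)
  have hne := two_pi_I_ne
  rw [mem_orthogonal_iff_riesz, isHardyPlus_iff, isHardyMinus_iff]
  constructor
  · rintro ⟨h1, h2⟩
    refine ⟨?_, ?_, ?_⟩
    · refine ((isPlus_rieszPlus hg).const_mul (2 * Real.pi * I)⁻¹).congr ?_
      filter_upwards [h1] with k hk
      rw [sub_eq_zero.1 hk]
      field_simp
    · refine ((isPlus_conj_rieszMinus hg).conj_const_mul (-(2 * Real.pi * I)⁻¹)).congr ?_
      filter_upwards [h2] with k hk
      rw [conjFun, conjFun, eq_neg_of_add_eq_zero_left hk]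
      congr 1
      field_simp
    · filter_upwards [h1, h2, (cauchyIntegrable_conj_L2 g).rieszPlus_add_rieszMinus] with k h1 h2 h3
      rw [← h3]
      linear_combination h1 + h2
  · rintro ⟨h1, h2, h3⟩
    have hu := h1.const_mul (2 * Real.pi * I)
    have hv := h2.conj_const_mul (-(2 * Real.pi * I))
    have huv : conjFun g =ᵐ[volume]
        (fun x => 2 * Real.pi * I * (rieszPlus (conjFun φ) x * rieszPlus (ψ * conjFun g) x
          / detPlus φ ψ x)) + fun x => -(2 * Real.pi * I) * (rieszMinus (conjFun φ) x
            * rieszMinus (ψ * conjFun g) x / detMinus φ ψ x) := by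
      filter_upwards [h3] with k hk
      rw [Pi.add_apply]
      linear_combination hk
    constructor
    · filter_upwards [rieszPlus_of_decomp hu hv huv] with k hk
      rw [hk]; ring
    · filter_upwards [rieszMinus_of_decomp hu hv huv] with k hk
      rw [hk]; ring

/-- The difference of the boundary defects, as a function on the line. -/
theorem upperDefect_sub_lowerDefect (g : L2) :
    ∀ᵐ k : ℝ, upperDefect φ ψ g k - lowerDefect φ ψ g k = 2 * Real.pi * I *
      ((detPlus φ ψ k - 2 * Real.pi * I * rieszPlus (conjFun φ) k * ψ k) * conjFun g k
        - 2 * Real.pi * I * conjFun φ k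
          * (ψ k * rieszMinus (conjFun g) k - rieszMinus (ψ * conjFun g) k)) := by
  filter_upwards [detPlus_eq φ ψ, detMinus_eq φ ψ,
    (cauchyIntegrable_mul_conj_L2 ψ φ).upper_sub_lower,
    (cauchyIntegrable_conj_L2 g).upper_sub_lower,
    (cauchyIntegrable_conj_L2 φ).upper_sub_lower,
    (cauchyIntegrable_mul_conj_L2 ψ g).upper_sub_lower] with k e1 e2 j1 j2 j3 j4
  have hne := two_pi_I_ne
  simp only [Pi.mul_apply] at j1 j4
  have r1 : 2 * Real.pi * I * rieszPlus (conjFun φ) k = cauchyUpper (conjFun φ) k := by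
    rw [rieszPlus_eq]; field_simp
  have r2 : 2 * Real.pi * I * rieszMinus (conjFun g) k = -cauchyLower (conjFun g) k := by
    rw [rieszMinus_eq]; field_simp
  have r3 : 2 * Real.pi * I * rieszMinus (ψ * conjFun g) k = -cauchyLower (ψ * conjFun g) k := by
    rw [rieszMinus_eq]; field_simp
  rw [upperDefect, lowerDefect]
  set t : ℂ := 2 * Real.pi * I
  -- The jump of D is 2πi ψφ̄; the difference of the two products in each defect is then telescoped
  -- factor by factor with the Plemelj relations.
  have e3 : detPlus φ ψ k - detMinus φ ψ k = t * (ψ k * conjFun φ k) := by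
    rw [e1, e2, ← j1]; ring
  linear_combination detPlus φ ψ k * j2 + cauchyLower (conjFun g) k * e3
    - cauchyUpper (conjFun φ) k * j4 - cauchyLower (ψ * conjFun g) k * j3
    + t * ψ k * conjFun g k * r1 + t * conjFun φ k * ψ k * r2 - t * conjFun φ k * r3

end

/-! ### The single identity under the integrability hypotheses -/

section

theorem isUpperBoundary_bilinear {a w b c : ℝ → ℂ} (ha : MemLp a 2 volume) (hw : MemLp w 2 volume)
    (hbc : IsUpperBoundary (cauchyUpper b * cauchyUpper c)) :
    IsUpperBoundary fun k =>
      (1 + cauchyUpper w k) * cauchyUpper a k - cauchyUpper b k * cauchyUpper c k := by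
  refine (((isPlus_cauchyUpper ha).isUpperBoundary.add (isUpperBoundary_mul_of_L2 hw ha)).sub
    hbc).congr (Eventually.of_forall fun k => ?_)
  simp only [Pi.sub_apply, Pi.add_apply, Pi.mul_apply]
  ring

theorem CauchyIntegrable.conj_cauchyLower {f : ℝ → ℂ} (hf : CauchyIntegrable f) :
    ∀ᵐ k : ℝ, (starRingEnd ℂ) (cauchyLower f k) = cauchyUpper (conjFun f) k := by
  filter_upwards [hf.lower_eq] with k hk
  rw [hk, conjFun, conj_conj]

variable (φ ψ : L2)

theorem memLp_mul_conj_of_top {ψ : ℝ → ℂ} (hψ : MemLp ψ ⊤ volume) (g : L2) :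
    MemLp (ψ * conjFun g) 2 volume :=
  (memLp_conjFun (Lp.memLp g)).mul (p := ⊤) (q := 2) (r := 2) hψ

theorem holderTriple_four_two : ENNReal.HolderTriple 4 2 (4 / 3) := by
  refine ⟨?_⟩
  rw [ENNReal.inv_div (by simp) (by simp), ENNReal.eq_div_iff (by simp) (by simp), mul_add,
    ENNReal.mul_inv_cancel (by simp) (by simp), show (4 : ENNReal) = 2 * 2 by norm_num, mul_assoc,
    ENNReal.mul_inv_cancel (by simp) (by simp)]
  norm_num

theorem holderTriple_four_four : ENNReal.HolderTriple 4 4 2 := by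
  refine ⟨?_⟩
  rw [show (4 : ENNReal) = 2 * 2 by norm_num, ENNReal.mul_inv (by simp) (by simp), ← mul_add,
    ENNReal.inv_two_add_inv_two, mul_one]

/-- Either hypothesis puts ψφ̄ in L², so the term with D is harmless. For the other product, bounded
ψ gives ψḡ ∈ L². In the L⁴ case ψḡ ∈ L^{4/3} is paired with φ̄ ∈ L⁴. The lower defect is treated
through its conjugate, which has the same form. -/
theorem upperDefect_lowerDefect_isUpperBoundary
    (h : MemLp ψ ⊤ volume ∨ (MemLp φ 4 volume ∧ MemLp ψ 4 volume)) (g : L2) :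
    IsUpperBoundary (upperDefect φ ψ g) ∧ IsUpperBoundary (conjFun (lowerDefect φ ψ g)) := by
  have hg := memLp_conjFun (Lp.memLp g)
  have hφ := memLp_conjFun (Lp.memLp φ)
  have hc1 : Integrable (ψ * conjFun g : ℝ → ℂ) := integrable_mul_of_memLp_two (Lp.memLp ψ) hg
  obtain ⟨hw, hbc, hbc'⟩ : MemLp (ψ * conjFun φ : ℝ → ℂ) 2 volume ∧
      IsUpperBoundary (cauchyUpper (conjFun φ) * cauchyUpper (ψ * conjFun g)) ∧
      IsUpperBoundary (cauchyUpper (conjFun (conjFun φ))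
        * cauchyUpper (conjFun (ψ * conjFun g))) := by
    rcases h with h | ⟨h1, h2⟩
    · have hc := memLp_mul_conj_of_top h g
      exact ⟨memLp_mul_conj_of_top h φ, isUpperBoundary_mul_of_L2 hφ hc,
        isUpperBoundary_mul_of_L2 (memLp_conjFun hφ) (memLp_conjFun hc)⟩
    · have := holderTriple_four_four
      have := holderTriple_four_two
      have hc : MemLp (ψ * conjFun g : ℝ → ℂ) (4 / 3) volume := hg.mul (p := 4) (q := 2) h2
      exact ⟨(memLp_conjFun h1).mul (p := 4) (q := 4) h2,
        isUpperBoundary_mul_of_L4 hφ (memLp_conjFun h1) hc1 hc,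
        isUpperBoundary_mul_of_L4 (memLp_conjFun hφ) (memLp_conjFun (memLp_conjFun h1))
          (memLp_one_iff_integrable.1 (memLp_conjFun (memLp_one_iff_integrable.2 hc1)))
          (memLp_conjFun hc)⟩
  constructor
  · refine (isUpperBoundary_bilinear hg hw hbc).congr ?_
    filter_upwards [detPlus_eq φ ψ] with k hk
    rw [upperDefect, hk]
  · refine (isUpperBoundary_bilinear (memLp_conjFun hg) (memLp_conjFun hw) hbc').congr ?_
    filter_upwards [detMinus_eq φ ψ, (cauchyIntegrable_conj_L2 g).conj_cauchyLower,
      (cauchyIntegrable_conj_L2 φ).conj_cauchyLower,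
      (cauchyIntegrable_mul_conj_L2 ψ φ).conj_cauchyLower,
      (cauchyIntegrable_mul_conj_L2 ψ g).conj_cauchyLower] with k e e1 e2 e3 e4
    rw [conjFun, lowerDefect, e]
    simp only [map_sub, map_mul, map_add, map_one, e1, e2, e3, e4]

/-- The identity states that the upper and lower defects coincide. Their common value has vanishing
Cauchy transform on both sides of the line, hence is zero. -/
theorem mem_orthogonal_iff_defect_eq
    (h : MemLp ψ ⊤ volume ∨ (MemLp φ 4 volume ∧ MemLp ψ 4 volume)) (g : L2) :
    g ∈ (detectableSubspace φ ψ)ᗮ ↔ ∀ᵐ k : ℝ,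
      (detPlus φ ψ k - 2 * Real.pi * I * rieszPlus (conjFun φ) k * ψ k) * conjFun g k
        = 2 * Real.pi * I * conjFun φ k
          * (ψ k * rieszMinus (conjFun g) k - rieszMinus (ψ * conjFun g) k) := by
  have hne := two_pi_I_ne
  rw [mem_orthogonal_iff_boundary]
  constructor
  · rintro ⟨h1, h2⟩
    filter_upwards [h1, h2, upperDefect_sub_lowerDefect φ ψ g] with k e1 e2 e3
    rw [e1, e2, sub_zero] at e3
    exact sub_eq_zero.1 ((mul_eq_zero.1 e3.symm).resolve_left hne)
  · intro hid
    have heq : upperDefect φ ψ g =ᵐ[volume] lowerDefect φ ψ g := by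
      filter_upwards [hid, upperDefect_sub_lowerDefect φ ψ g] with k e1 e2
      rw [e1, sub_self, mul_zero] at e2
      exact sub_eq_zero.1 e2
    obtain ⟨hu, hl⟩ := upperDefect_lowerDefect_isUpperBoundary φ ψ h g
    have h0 := hu.ae_eq_zero (hl.congr (by
      filter_upwards [heq] with k hk
      rw [conjFun, conjFun, hk]))
    exact ⟨h0, by filter_upwards [h0, heq] with k e1 e2; rw [← e2, e1]; rfl⟩

theorem cauchyIntegrable_mul_of_memLp {f : ℝ → ℂ} (hf : MemLp f 2 volume) :
    CauchyIntegrable (ψ * f) :=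
  cauchyIntegrable_of_integrable (integrable_mul_of_memLp_two (Lp.memLp ψ) hf)

theorem mul_rieszMinus_sub_eq (g : L2) :
    ∀ᵐ k : ℝ, ψ k * rieszMinus (conjFun g) k - rieszMinus (ψ * conjFun g) k
      = -(ψ k * rieszPlus (conjFun g) k) + rieszPlus (ψ * conjFun g) k := by
  filter_upwards [(cauchyIntegrable_conj_L2 g).rieszPlus_add_rieszMinus,
    (cauchyIntegrable_mul_conj_L2 ψ g).rieszPlus_add_rieszMinus] with k h1 h2
  rw [Pi.mul_apply] at h2
  linear_combination ψ k * h1 - h2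

/-- Split ψḡ into ψP₊ḡ + ψP₋ḡ under P₋, and write ψP₋ḡ as the sum of its own two projections; the
terms P₋(ψP₋ḡ) cancel. -/
theorem mul_rieszMinus_sub_eq_commutator (g : L2) :
    ∀ᵐ k : ℝ, ψ k * rieszMinus (conjFun g) k - rieszMinus (ψ * conjFun g) k
      = rieszPlus (ψ * rieszMinus (conjFun g)) k - rieszMinus (ψ * rieszPlus (conjFun g)) k := by
  have hg := memLp_conjFun (Lp.memLp g)
  have hp := cauchyIntegrable_mul_of_memLp ψ (isPlus_rieszPlus hg).1
  have hm := cauchyIntegrable_mul_of_memLp ψ (memLp_rieszMinus hg)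
  have hsum : (ψ * conjFun g : ℝ → ℂ) =ᵐ[volume]
      ψ * rieszPlus (conjFun g) + ψ * rieszMinus (conjFun g) := by
    filter_upwards [(cauchyIntegrable_conj_L2 g).rieszPlus_add_rieszMinus] with k hk
    simp only [Pi.add_apply, Pi.mul_apply]
    rw [← mul_add, hk]
  filter_upwards [hm.rieszPlus_add_rieszMinus, cauchyLower_add hp hm] with k h1 h2
  have h3 : rieszMinus (ψ * conjFun g) k
      = rieszMinus (ψ * rieszPlus (conjFun g)) k + rieszMinus (ψ * rieszMinus (conjFun g)) k := by
    simp only [rieszMinus_eq]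
    rw [cauchyLower_congr hsum, h2, Pi.add_apply, mul_add]
  rw [Pi.mul_apply] at h1
  linear_combination -h1 - h3

end

end Friedrichs

/-! ### The theorem -/

open Friedrichs

theorem proposition8p1 (φ ψ : L2) :
    -- the boundary values of `D` exist and are non-zero almost everywhere
    HasBoundaryValues (perturbDet φ ψ) ∧
    (∀ᵐ k : ℝ, detPlus φ ψ k ≠ 0 ∧ detMinus φ ψ k ≠ 0) ∧
    HasBoundaryValues (cauchyTransform (conjFun φ)) ∧
    -- first part
    (∀ g : L2,
      HasBoundaryValues (cauchyTransform (conjFun g)) ∧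
      HasBoundaryValues (cauchyTransform (ψ * conjFun g)) ∧
      (g ∈ (detectableSubspace φ ψ)ᗮ ↔
        (∀ᵐ k : ℝ, rieszPlus (conjFun g) k
          - 2 * Real.pi * Complex.I / detPlus φ ψ k
            * rieszPlus (conjFun φ) k * rieszPlus (ψ * conjFun g) k = 0) ∧
        (∀ᵐ k : ℝ, rieszMinus (conjFun g) k
          + 2 * Real.pi * Complex.I / detMinus φ ψ k
            * rieszMinus (conjFun φ) k * rieszMinus (ψ * conjFun g) k = 0)) ∧
      (g ∈ (detectableSubspace φ ψ)ᗮ ↔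
        IsHardyPlus (fun k => rieszPlus (conjFun φ) k * rieszPlus (ψ * conjFun g) k
          / detPlus φ ψ k) ∧
        IsHardyMinus (fun k => rieszMinus (conjFun φ) k * rieszMinus (ψ * conjFun g) k
          / detMinus φ ψ k) ∧
        (∀ᵐ k : ℝ, conjFun g k
          - 2 * Real.pi * Complex.I / detPlus φ ψ k
            * rieszPlus (conjFun φ) k * rieszPlus (ψ * conjFun g) k
          + 2 * Real.pi * Complex.I / detMinus φ ψ k
            * rieszMinus (conjFun φ) k * rieszMinus (ψ * conjFun g) k = 0))) ∧
    -- second part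
    ((MemLp ψ ⊤ volume ∨ (MemLp φ 4 volume ∧ MemLp ψ 4 volume)) →
      ∀ g : L2,
        HasBoundaryValues (cauchyTransform (ψ * rieszPlus (conjFun g))) ∧
        HasBoundaryValues (cauchyTransform (ψ * rieszMinus (conjFun g))) ∧
        (g ∈ (detectableSubspace φ ψ)ᗮ ↔
          ∀ᵐ k : ℝ,
            (detPlus φ ψ k - 2 * Real.pi * Complex.I * rieszPlus (conjFun φ) k * ψ k)
                * conjFun g k
              = 2 * Real.pi * Complex.I * conjFun φ k
                * (ψ k * rieszMinus (conjFun g) k - rieszMinus (ψ * conjFun g) k)) ∧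
        (g ∈ (detectableSubspace φ ψ)ᗮ ↔
          ∀ᵐ k : ℝ,
            (detPlus φ ψ k - 2 * Real.pi * Complex.I * rieszPlus (conjFun φ) k * ψ k)
                * conjFun g k
              = 2 * Real.pi * Complex.I * conjFun φ k
                * (-(ψ k * rieszPlus (conjFun g) k) + rieszPlus (ψ * conjFun g) k)) ∧
        (g ∈ (detectableSubspace φ ψ)ᗮ ↔
          ∀ᵐ k : ℝ,
            (detPlus φ ψ k - 2 * Real.pi * Complex.I * rieszPlus (conjFun φ) k * ψ k)
                * conjFun g k
              = 2 * Real.pi * Complex.I * conjFun φ k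
                * (rieszPlus (ψ * rieszMinus (conjFun g)) k
                  - rieszMinus (ψ * rieszPlus (conjFun g)) k))) := by
  refine ⟨hasBoundaryValues_perturbDet φ ψ, det_ne_zero φ ψ,
    (cauchyIntegrable_conj_L2 φ).hasBoundaryValues, fun g =>
      ⟨(cauchyIntegrable_conj_L2 g).hasBoundaryValues,
        (cauchyIntegrable_mul_conj_L2 ψ g).hasBoundaryValues,
        mem_orthogonal_iff_riesz φ ψ g, mem_orthogonal_iff_hardy φ ψ g⟩, fun h g => ?_⟩
  have hg := memLp_conjFun (Lp.memLp g)
  refine ⟨(cauchyIntegrable_mul_of_memLp ψ (isPlus_rieszPlus hg).1).hasBoundaryValues,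
    (cauchyIntegrable_mul_of_memLp ψ (memLp_rieszMinus hg)).hasBoundaryValues,
    mem_orthogonal_iff_defect_eq φ ψ h g, ?_, ?_⟩
  -- The remaining two right-hand sides agree a.e. with the first one, by P₊ + P₋ = 1 applied to ḡ,
  -- ψḡ and ψP₋ḡ.
  · rw [mem_orthogonal_iff_defect_eq φ ψ h g]
    refine eventually_congr ?_
    filter_upwards [mul_rieszMinus_sub_eq ψ g] with k hk
    rw [hk]
  · rw [mem_orthogonal_iff_defect_eq φ ψ h g]
    refine eventually_congr ?_
    filter_upwards [mul_rieszMinus_sub_eq_commutator ψ g] with k hk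
    rw [hk]
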